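/- Let $n\ge 1$ and let $\underline a=(a_1,\dots,a_k)$ be a composition of $n$ (positive integers with sum $n$). \textbf{Index.} For a finite-dimensional complex Lie algebra $\mathfrak g$ put $\chi[\mathfrak g]=\min\{\dim\mathfrak g_f : f\in\mathfrak g^*\}$, where $\mathfrak g_f=\{x\in\mathfrak g: f([x,y])=0 \text{ for all } y\in\mathfrak g\}$. Let $\mathfrak p(a_1,\dots,a_k)\subseteq\mathfrak{gl}(n,\mathbb C)$ be the parabolic subalgebra of block upper triangular matrices with successive diagonal blocks of sizes $a_1,\dots,a_k$. \textbf{Meander.} Let $\theta_{\underline a}$ be the involution of $\{1,\dots,n\}$ which reverses each of the successive intervals of lengths $a_1,\dots,a_k$, that is, $\theta_{\underline a}(x)=2(a_1+\dots+a_{i-1})+a_i-x+1$ for $a_1+\dots+a_{i-1}<x\le a_1+\dots+a_i$, and let $\theta_n(x)=n+1-x$. The meander $\Gamma(a_1,\dots,a_k)$ is the graph with vertices $1,\dots,n$ in which every pair of distinct vertices of the form $\{x,\theta_{\underline a}(x)\}$ is joined by an arc (drawn below the line), and likewise every such pair $\{x,\theta_n(x)\}$ (drawn above the line). A connected component $X$,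 with vertex set $S_X$, is called a cycle if no vertex of $X$ is fixed by $\theta_{\underline a}$ or by $\theta_n$, and a segment otherwise. The vertices of a cycle $X$ are of the form $x_1<x_1+s-1<x_2<x_2+s-1<\dots<x_m<x_m+s-1$ with $m\ge 1$ and an integer $s>1$, the dimension of $X$. If $s>2$, a component (cycle or segment) $Y\ne X$ is said to be inside $X$ if it has a vertex $y\in S_Y$ with $x_i\le y\le x_i+s-1$ for some $i$. The maximal cycles of $\Gamma(a_1,\dots,a_k)$ are the cycles which are not inside another cycle together with, by convention, the segments which are not inside a cycle. \textbf{Lemma.} 1) The number $r$ of maximal cycles of $\Gamma(a_1,\dots,a_k)$ satisfies $r\le\left[\frac{k+1}{2}\right]$, where $[\cdot]$ denotes the integer part. 2) $\Gamma(a_1,\dots,a_k)$ has exactly one maximal cycle if and only if $\chi[\mathfrak p(a_1,\dots,a_k)]=\gcd(a_1,\dots,a_k)$. -/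

import Mathlib

noncomputable section

namespace Meander

/-! ### The index of a Lie algebra -/

section Index

variable (K L : Type*) [Field K] [LieRing L] [LieAlgebra K L]

variable {L} in
/-- For a linear form `f` on `L`, the subspace `L_f = {x ∈ L | f [x, y] = 0 for all y ∈ L}`, the
stabilizer of `f` for the coadjoint action. -/
def coadjointStabilizer (f : Module.Dual K L) : Submodule K L where
  carrier := {x | ∀ y : L, f ⁅x, y⁆ = 0}
  zero_mem' := fun y => by simp
  add_mem' := fun {a b} ha hb y => by
    rw [add_lie, map_add, ha y, hb y, add_zero]
  smul_mem' := fun t a ha y => by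
    rw [smul_lie, map_smul, ha y, smul_zero]

/-- The index of a finite-dimensional Lie algebra `L`: the minimum of `dim L_f` over all linear
forms `f` on `L` (the set of these dimensions is a nonempty set of natural numbers). -/
def lieIndex : ℕ :=
  sInf (Set.range fun f : Module.Dual K L => Module.finrank K (coadjointStabilizer K f))

end Index

/-! ### The parabolic subalgebra of `𝔤𝔩(n, ℂ)` attached to a composition -/

attribute [local instance] LieRing.ofAssociativeRing

/-- The standard parabolic subalgebra `𝔭(a₁, …, a_k)` of `𝔤𝔩(n, ℂ)`: the block upper triangular
matrices with successive diagonal blocks of sizes `a₁, …, a_k`. -/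
def parabolic {n : ℕ} (a : Composition n) : LieSubalgebra ℂ (Matrix (Fin n) (Fin n) ℂ) where
  carrier := {M | M.BlockTriangular a.index}
  zero_mem' := Matrix.blockTriangular_zero
  add_mem' := fun hM hN => hM.add hN
  smul_mem' := fun t M hM i j hij => by
    rw [Matrix.smul_apply, hM hij, smul_zero]
  lie_mem' := fun {M N} hM hN => by
    change (⁅M, N⁆ : Matrix (Fin n) (Fin n) ℂ).BlockTriangular a.index
    rw [Ring.lie_def]
    exact (hM.mul hN).sub (hN.mul hM)

/-! ### Meanders. The vertices `1, …, n` are represented by `Fin n`, that is, by `0, …, n - 1`. -/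

/-- The involution `θ_a` attached to a composition `a` of `n`: it reverses the order of the
vertices within each of the successive blocks of sizes `a₁, …, a_k`. -/
def theta {n : ℕ} (a : Composition n) (x : Fin n) : Fin n :=
  a.embedding (a.index x) (a.invEmbedding x).rev

/-- The meander `Γ(a | b)`: two distinct vertices are joined when they are exchanged by `θ_a`
(an arc below the line) or by `θ_b` (an arc above the line). -/
def meander {n : ℕ} (a b : Composition n) : SimpleGraph (Fin n) :=
  SimpleGraph.fromRel fun x y => theta a x = y ∨ theta b x = y

/-- The meander `Γ(a) = Γ(a | n)`. -/
abbrev parabolicMeander {n : ℕ} (hn : 0 < n) (a : Composition n) : SimpleGraph (Fin n) :=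
  meander a (Composition.single n hn)

variable {n : ℕ} (hn : 0 < n) (a : Composition n)

/-- A connected component of `Γ(a)` is a cycle if none of its vertices is fixed by `θ_a` or by
`θ_(n)`; otherwise it is a segment. -/
def IsCycle (X : (parabolicMeander hn a).ConnectedComponent) : Prop :=
  ∀ x ∈ X.supp, theta a x ≠ x ∧ theta (Composition.single n hn) x ≠ x

/-- The elements of `S` are `x₁ < x₁ + s - 1 < x₂ < x₂ + s - 1 < ⋯ < x_m < x_m + s - 1`, where
`s > 1` and `m ≥ 1`; here `y i` stands for `x i + s - 1`. When `S` is the vertex set of a cycle,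
`s` is the dimension of that cycle. -/
structure IsPattern (S : Set (Fin n)) (s m : ℕ) (x y : Fin m → Fin n) : Prop where
  one_lt : 1 < s
  pos : 0 < m
  gap : ∀ i, (y i : ℕ) = x i + (s - 1)
  sep : ∀ i j, i < j → y i < x j
  mem_iff : ∀ v, v ∈ S ↔ ∃ i, v = x i ∨ v = y i

/-- The component (cycle or segment) `Y` is inside the cycle `X`: it is another component, and it
has a vertex `v` with `x_i ≤ v ≤ x_i + s - 1` for some `i`, where `s > 2` is the dimension of `X`
and `x₁ < x₁ + s - 1 < x₂ < ⋯ < x_m < x_m + s - 1` are the vertices of `X`. -/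
def IsInside (Y X : (parabolicMeander hn a).ConnectedComponent) : Prop :=
  Y ≠ X ∧ IsCycle hn a X ∧ ∃ (s m : ℕ) (x y : Fin m → Fin n),
    IsPattern X.supp s m x y ∧ 2 < s ∧ ∃ i, ∃ v ∈ Y.supp, x i ≤ v ∧ v ≤ y i

/-- The maximal cycles of `Γ(a)`: the cycles that are not inside another cycle and, by convention,
the segments that are not inside a cycle. -/
def IsMaximalCycle (Y : (parabolicMeander hn a).ConnectedComponent) : Prop :=
  ∀ X, ¬ IsInside hn a Y X

/-- The number of maximal cycles of `Γ(a)`. -/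
def numMaximalCycles : ℕ :=
  {Y : (parabolicMeander hn a).ConnectedComponent | IsMaximalCycle hn a Y}.ncard

end Meander

end

set_option linter.unusedSectionVars false
-- Call the gap between two consecutive vertices bad if reflections in the blocks of the two
-- compositions link it to a block boundary. The bad gaps cut the vertices into strips. Both
-- involutions carry strips to strips and reverse their order, so whole strips move rigidly along
-- the arcs.
--
-- A parity count (`IsStrip.exists_fixed`) shows that from any strip the arcs lead to a strip which
-- one involution maps to itself. Hence each vertex is linked to its mirror image in its strip. In
-- particular the two ends of a strip lie in one component. If the strip has width greater than 1,
-- this component is a cycle whose dimension is the width, and an interior vertex outside the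
-- component is inside the cycle. So the maximal cycles are the linking classes of strips
-- (`isMaximalCycle_iff`).
--
-- For the bound (`two_mul_card_le`), count the pairs formed by a strip and an involution which maps
-- it to itself. Each class has at least two of them, by parity, and each of the `k + 1` blocks of
-- the two compositions has at most one, in its middle.
--
-- For the criterion, the index is the number of orbits of the product of the two involutions
-- (`lieIndex_parabolic_eq_orbitCount`), and each orbit meets a strip of its class in exactly one
-- vertex, so a class of strips of width `w` accounts for `w` orbits. All widths are multiples of
-- `d`, the gcd of the parts. If there is one class, all strips have the same width `s`, which then
-- divides every boundary, so `s = d` and the index is `d`. With a second class the index is at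
-- least `2d`.
--
-- The index formula is proved for all seaweed algebras, defined by two compositions
-- (`hasIndex_seaweed`), by a Euclidean induction on the first blocks. Equal first blocks split off
-- a factor `𝔤𝔩(p)`, of index `p`. Unequal ones are shortened by a symplectic reduction along an
-- abelian ideal (`IsReduction.hasIndex`), and the number of orbits satisfies the same recursion.
namespace Meander

open Module

/-! ### Linear algebra: kernels along a line and radicals of skew forms. -/

/-- Upper semicontinuity of the dimension of the kernel along a line. -/
theorem finite_finrank_ker_lt {K E E' : Type*} [Field K] [AddCommGroup E] [Module K E]
    [FiniteDimensional K E] [AddCommGroup E'] [Module K E'] (T₀ T₁ : E →ₗ[K] E') :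
    {t : K | finrank K (LinearMap.ker T₀) < finrank K (LinearMap.ker (T₀ + t • T₁))}.Finite := by
  obtain ⟨C, hC⟩ := Submodule.exists_isCompl (LinearMap.ker T₀)
  have hinj : LinearMap.ker (T₀.domRestrict C) = ⊥ := by
    rw [LinearMap.ker_eq_bot']
    intro x hx
    have h : (x : E) ∈ LinearMap.ker T₀ ⊓ C := ⟨hx, x.2⟩
    rw [hC.inf_eq_bot] at h
    exact Subtype.ext h
  obtain ⟨g, hg⟩ := LinearMap.exists_leftInverse_of_injective _ hinj
  -- If `x` in `C` is killed by `T₀ + t • T₁`, applying `g` gives `x + t N x = 0`. So unless `-t⁻¹`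
  -- is one of the finitely many eigenvalues of `N`, the kernel misses `C` and cannot exceed `ker
  -- T₀`.
  set N : End K C := g ∘ₗ T₁.domRestrict C with hN
  have hfin : {t : K | N.HasEigenvalue (-t⁻¹)}.Finite :=
    (N.finite_hasEigenvalue).preimage (by
      intro x _ y _ h
      simpa using h)
  refine hfin.subset fun t ht => ?_
  simp only [Set.mem_ofPred_eq] at ht ⊢
  by_contra hne
  have hCker : C ⊓ LinearMap.ker (T₀ + t • T₁) = ⊥ := by
    rw [eq_bot_iff]
    rintro x ⟨hx, hxk⟩
    by_contra hx0
    have h1 : T₀ x + t • T₁ x = 0 := hxk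
    have h2 : g (T₀ x) = ⟨x, hx⟩ := LinearMap.congr_fun hg ⟨x, hx⟩
    have h3 : (⟨x, hx⟩ : C) + t • N ⟨x, hx⟩ = 0 := by
      have := congrArg g h1
      rw [map_add, map_smul, h2, map_zero] at this
      exact this
    have hx0' : (⟨x, hx⟩ : C) ≠ 0 := fun h => hx0 (by simpa using congrArg Subtype.val h)
    have ht0 : t ≠ 0 := by
      rintro rfl
      rw [zero_smul, add_zero] at h3
      exact hx0' h3
    refine hne (End.hasEigenvalue_of_hasEigenvector (x := ⟨x, hx⟩) ⟨?_, hx0'⟩)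
    rw [End.mem_eigenspace_iff, neg_smul, eq_neg_iff_add_eq_zero,
      ← smul_right_injective _ ht0 |>.eq_iff]
    rw [smul_add, smul_zero, smul_smul, mul_inv_cancel₀ ht0, one_smul, add_comm]
    exact h3
  have h1 := Submodule.finrank_sup_add_finrank_inf_eq C (LinearMap.ker (T₀ + t • T₁))
  have h2 := Submodule.finrank_add_eq_of_isCompl hC
  have h3 := Submodule.finrank_le (C ⊔ LinearMap.ker (T₀ + t • T₁))
  rw [hCker, finrank_bot] at h1
  omega

theorem finrank_submodule_prod {K E E' : Type*} [Field K] [AddCommGroup E] [Module K E]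
    [AddCommGroup E'] [Module K E'] (p : Submodule K E) (q : Submodule K E')
    [FiniteDimensional K p] [FiniteDimensional K q] :
    finrank K (p.prod q) = finrank K p + finrank K q := by
  let D : (p.prod q) ≃ₗ[K] p × q :=
    { toFun := fun z => (⟨z.1.1, z.2.1⟩, ⟨z.1.2, z.2.2⟩)
      map_add' := fun _ _ => rfl
      map_smul' := fun _ _ => rfl
      invFun := fun z => ⟨(z.1, z.2), z.1.2, z.2.2⟩
      left_inv := fun _ => rfl
      right_inv := fun _ => rfl }
  exact D.finrank_eq.trans finrank_prod

section Forms

variable {K E E' : Type*} [Field K] [AddCommGroup E] [Module K E] [AddCommGroup E'] [Module K E']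

theorem finrank_ker_eq_of_equiv {ω : E →ₗ[K] E →ₗ[K] K} {ω' : E' →ₗ[K] E' →ₗ[K] K} (e : E ≃ₗ[K] E')
    (h : ∀ x y, ω' (e x) (e y) = ω x y) :
    finrank K (LinearMap.ker ω) = finrank K (LinearMap.ker ω') := by
  have : (LinearMap.ker ω).map (e : E →ₗ[K] E') = LinearMap.ker ω' := by
    ext z
    constructor
    · rintro ⟨x, hx, rfl⟩
      refine LinearMap.ext fun w => ?_
      obtain ⟨y, rfl⟩ := e.surjective w
      have hx' : ω x = 0 := hx
      change ω' (e x) (e y) = 0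
      rw [h, hx', LinearMap.zero_apply]
    · intro hz
      obtain ⟨x, rfl⟩ := e.surjective z
      refine ⟨x, LinearMap.ext fun y => ?_, rfl⟩
      have hz' : ω' (e x) = 0 := hz
      rw [← h, hz', LinearMap.zero_apply, LinearMap.zero_apply]
  rw [← this]
  exact (LinearEquiv.finrank_map_eq e _).symm

/-- Symplectic reduction: if the orthogonal of the subspace `V`, which meets the radical trivially,
is `V ⊕ s(E')`, then the radical of `ω` has the dimension of the radical of the form
induced on `E'`. -/
theorem finrank_ker_eq_of_reduction [FiniteDimensional K E] [FiniteDimensional K E']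
    (ω : E →ₗ[K] E →ₗ[K] K) (ω' : E' →ₗ[K] E' →ₗ[K] K)
    (skew : ∀ x y, ω x y = - ω y x) (s : E' →ₗ[K] E) (hs : ∀ x y, ω (s x) (s y) = ω' x y)
    (s_inj : Function.Injective s) (V : Submodule K E)
    (disj : Disjoint V (LinearMap.range s))
    (perp : ∀ x, (∀ v ∈ V, ω v x = 0) ↔ x ∈ V ⊔ LinearMap.range s)
    (rad : ∀ v ∈ V, (∀ y, ω v y = 0) → v = 0) :
    finrank K (LinearMap.ker ω) = finrank K (LinearMap.ker ω') := by
  set M := (LinearMap.ker ω').map s with hM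
  have hdisjV : V ⊓ LinearMap.ker ω = ⊥ := by
    rw [eq_bot_iff]
    rintro v ⟨hv, hk⟩
    have hk' : ω v = 0 := hk
    exact rad v hv fun y => by rw [hk', LinearMap.zero_apply]
  have hdisjM : V ⊓ M = ⊥ := by
    rw [eq_bot_iff, ← disj.eq_bot]
    exact inf_le_inf_left _ LinearMap.map_le_range
  -- Both sums are direct, so this equality gives `ker ω` and `ker ω'` the same dimension.
  have hsup : V ⊔ LinearMap.ker ω = V ⊔ M := by
    apply le_antisymm
    · refine sup_le le_sup_left fun x hx => ?_
      have hx' : ω x = 0 := hx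
      have hp : x ∈ V ⊔ LinearMap.range s := (perp x).1 fun v _ => by
        rw [skew, hx', LinearMap.zero_apply, neg_zero]
      obtain ⟨v, hv, _, ⟨y, rfl⟩, rfl⟩ := Submodule.mem_sup.1 hp
      refine Submodule.add_mem_sup hv ⟨y, LinearMap.ext fun z => ?_, rfl⟩
      have h1 : ω (v + s y) (s z) = 0 := by rw [hx', LinearMap.zero_apply]
      rw [map_add, LinearMap.add_apply, hs,
        (perp (s z)).2 (Submodule.mem_sup_right ⟨z, rfl⟩) v hv, zero_add] at h1
      rw [h1, LinearMap.zero_apply]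
    · refine sup_le le_sup_left ?_
      rintro _ ⟨y, hy, rfl⟩
      have hy' : ω' y = 0 := hy
      -- `ω (s y)` vanishes on the orthogonal of `V`. By biduality it is `ω v` for some `v` in `V`,
      -- and `s y - v` is then in the radical.
      have hann : ω (s y) ∈ (V.map ω).dualCoannihilator.dualAnnihilator := by
        rw [Submodule.mem_dualAnnihilator]
        intro x hx
        rw [Submodule.mem_dualCoannihilator] at hx
        have hp := (perp x).1 fun v hv => hx _ ⟨v, hv, rfl⟩
        obtain ⟨v, hv, _, ⟨z, rfl⟩, rfl⟩ := Submodule.mem_sup.1 hp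
        rw [map_add, hs, hy', skew, (perp (s y)).2 (Submodule.mem_sup_right ⟨y, rfl⟩) v hv]
        simp
      rw [Subspace.dualCoannihilator_dualAnnihilator_eq] at hann
      obtain ⟨v, hv, hvy⟩ := hann
      refine Submodule.mem_sup.2 ⟨v, hv, s y - v, ?_, by abel⟩
      rw [LinearMap.mem_ker, map_sub, hvy, sub_self]
  have h1 := Submodule.finrank_sup_add_finrank_inf_eq V (LinearMap.ker ω)
  have h2 := Submodule.finrank_sup_add_finrank_inf_eq V M
  have h3 : finrank K M = finrank K (LinearMap.ker ω') :=
    (Submodule.equivMapOfInjective s s_inj _).finrank_eq.symm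
  rw [hdisjV, hsup] at h1
  rw [hdisjM] at h2
  omega

end Forms

open Module Matrix

/-! ### The index of the algebra of matrices supported on a relation. -/

section Incidence

variable {ι ι' : Type*} [Fintype ι] [Fintype ι']

/-- The bilinear form `(x, y) ↦ tr (F [x, y])` on square matrices. -/
def traceForm (F : Matrix ι ι ℂ) : Matrix ι ι ℂ →ₗ[ℂ] Matrix ι ι ℂ →ₗ[ℂ] ℂ :=
  LinearMap.mk₂ ℂ (fun x y => trace (F * (x * y - y * x)))
    (fun x x' y => by rw [← trace_add]; congr 1; noncomm_ring)
    (fun c x y => by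
      rw [smul_mul_assoc, mul_smul_comm, ← smul_sub, mul_smul_comm, trace_smul])
    (fun x y y' => by rw [← trace_add]; congr 1; noncomm_ring)
    (fun c x y => by
      rw [smul_mul_assoc, mul_smul_comm, ← smul_sub, mul_smul_comm, trace_smul])

theorem traceForm_apply (F x y : Matrix ι ι ℂ) :
    traceForm F x y = trace (F * (x * y - y * x)) := rfl

theorem traceForm_add_smul (F G : Matrix ι ι ℂ) (t : ℂ) :
    traceForm (F + t • G) = traceForm F + t • traceForm G := by
  refine LinearMap.ext fun x => LinearMap.ext fun y => ?_
  simp only [LinearMap.add_apply, LinearMap.smul_apply, traceForm_apply, add_mul, trace_add,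
    smul_mul_assoc, trace_smul]

/-- The matrices whose support is contained in the relation `R`. -/
def incidence (R : ι → ι → Prop) : Submodule ℂ (Matrix ι ι ℂ) where
  carrier := {x | ∀ i j, ¬ R i j → x i j = 0}
  zero_mem' := fun _ _ _ => rfl
  add_mem' := fun hx hy i j h => by rw [Matrix.add_apply, hx i j h, hy i j h, add_zero]
  smul_mem' := fun c x hx i j h => by rw [Matrix.smul_apply, hx i j h, smul_zero]

theorem mul_mem_incidence {R : ι → ι → Prop} (hR : ∀ i j k, R i j → R j k → R i k)
    {x y : Matrix ι ι ℂ} (hx : x ∈ incidence R) (hy : y ∈ incidence R) : x * y ∈ incidence R := by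
  intro i j h
  rw [Matrix.mul_apply]
  refine Finset.sum_eq_zero fun k _ => ?_
  by_cases hik : R i k
  · rw [hy k j fun hkj => h (hR _ _ _ hik hkj), mul_zero]
  · rw [hx i k hik, zero_mul]

/-- The restriction of `traceForm F` to the matrices supported on `R`. -/
def incidenceForm (R : ι → ι → Prop) (F : Matrix ι ι ℂ) :
    incidence R →ₗ[ℂ] incidence R →ₗ[ℂ] ℂ :=
  (traceForm F).domRestrict₁₂ (incidence R) (incidence R)

theorem incidenceForm_apply (R : ι → ι → Prop) (F : Matrix ι ι ℂ) (x y : incidence R) :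
    incidenceForm R F x y =
      trace (F * ((x : Matrix ι ι ℂ) * (y : Matrix ι ι ℂ) -
        (y : Matrix ι ι ℂ) * (x : Matrix ι ι ℂ))) := rfl

theorem incidenceForm_skew (R : ι → ι → Prop) (F : Matrix ι ι ℂ) (x y : incidence R) :
    incidenceForm R F x y = - incidenceForm R F y x := by
  rw [incidenceForm_apply, incidenceForm_apply, ← trace_neg, ← mul_neg, neg_sub]

/-- The dimension of the coadjoint stabilizer of the form `tr (F ·)` on `incidence R`. -/
noncomputable def stabDim (R : ι → ι → Prop) (F : Matrix ι ι ℂ) : ℕ :=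
  finrank ℂ (LinearMap.ker (incidenceForm R F))

/-- `m` is the minimal dimension of a coadjoint stabilizer for `incidence R`. -/
def HasIndex (R : ι → ι → Prop) (m : ℕ) : Prop :=
  (∃ F, stabDim R F = m) ∧ ∀ F, m ≤ stabDim R F

theorem finite_stabDim_lt (R : ι → ι → Prop) (F G : Matrix ι ι ℂ) :
    {t : ℂ | stabDim R F < stabDim R (F + t • G)}.Finite := by
  refine (finite_finrank_ker_lt (incidenceForm R F) (incidenceForm R G)).subset fun t ht => ?_
  have : incidenceForm R (F + t • G) = incidenceForm R F + t • incidenceForm R G := by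
    refine LinearMap.ext fun x => LinearMap.ext fun y => ?_
    exact LinearMap.congr_fun (LinearMap.congr_fun (traceForm_add_smul F G t) _) _
  rw [Set.mem_ofPred_eq, ← this]
  exact ht

/-- A condition which fails only for finitely many parameters on a line holds at a point where
the stabilizer is no larger than at the origin of the line. -/
theorem exists_stabDim_le (R : ι → ι → Prop) (F G : Matrix ι ι ℂ) (P : ℂ → Prop)
    (hP : {t | ¬ P t}.Finite) : ∃ t, P t ∧ stabDim R (F + t • G) ≤ stabDim R F := by
  obtain ⟨t, ht⟩ := (hP.union (finite_stabDim_lt R F G)).exists_notMem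
  rw [Set.mem_union, not_or] at ht
  exact ⟨t, not_not.1 ht.1, not_lt.1 ht.2⟩

/-- The automorphism `x ↦ u x v` of the algebra pulls `tr (F ·)` back to `tr (v F u ·)`. -/
theorem stabDim_conj {R : ι → ι → Prop} [DecidableEq ι] (hR : ∀ i j k, R i j → R j k → R i k)
    {u v : Matrix ι ι ℂ} (hu : u ∈ incidence R) (hv : v ∈ incidence R) (huv : u * v = 1)
    (F : Matrix ι ι ℂ) : stabDim R (v * F * u) = stabDim R F := by
  have hvu : v * u = 1 := mul_eq_one_comm.1 huv
  let e : incidence R ≃ₗ[ℂ] incidence R :=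
    { toFun := fun x => ⟨u * x * v, mul_mem_incidence hR (mul_mem_incidence hR hu x.2) hv⟩
      map_add' := fun x y => Subtype.ext (by simp [mul_add, add_mul])
      map_smul' := fun c x => Subtype.ext (by simp)
      invFun := fun x => ⟨v * x * u, mul_mem_incidence hR (mul_mem_incidence hR hv x.2) hu⟩
      left_inv := fun x => Subtype.ext (by
        change v * (u * (x : Matrix ι ι ℂ) * v) * u = x
        rw [mul_assoc u, ← mul_assoc v, hvu, one_mul, mul_assoc, hvu, mul_one])
      right_inv := fun x => Subtype.ext (by
        change u * (v * (x : Matrix ι ι ℂ) * u) * v = x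
        rw [mul_assoc v, ← mul_assoc u, huv, one_mul, mul_assoc, huv, mul_one]) }
  refine finrank_ker_eq_of_equiv e fun x y => ?_
  rw [incidenceForm_apply, incidenceForm_apply]
  change trace (F * (u * x.1 * v * (u * y.1 * v) - u * y.1 * v * (u * x.1 * v))) = _
  have h (a b : Matrix ι ι ℂ) : u * a * v * (u * b * v) = u * (a * b) * v := by
    rw [mul_assoc (u * a), ← mul_assoc v, ← mul_assoc v, hvu, one_mul]
    simp only [mul_assoc]
  rw [h, h, ← sub_mul, ← mul_sub, ← mul_assoc, trace_mul_comm, ← mul_assoc, ← mul_assoc]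

theorem HasIndex.reindex {R : ι → ι → Prop} {R' : ι' → ι' → Prop} (e : ι ≃ ι')
    (he : ∀ i j, R i j ↔ R' (e i) (e j)) {m : ℕ} (h : HasIndex R m) : HasIndex R' m := by
  have key (F : Matrix ι' ι' ℂ) : stabDim R (F.submatrix e e) = stabDim R' F := by
    let E : incidence R' ≃ₗ[ℂ] incidence R :=
      { toFun := fun x => ⟨(x : Matrix ι' ι' ℂ).submatrix e e, fun i j hij =>
          x.2 _ _ fun h => hij ((he i j).2 h)⟩
        map_add' := fun x y => rfl
        map_smul' := fun c x => rfl
        invFun := fun x => ⟨(x : Matrix ι ι ℂ).submatrix e.symm e.symm, fun i j hij =>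
          x.2 _ _ fun h => hij (by simpa using (he _ _).1 h)⟩
        left_inv := fun x => Subtype.ext (by ext i j; simp)
        right_inv := fun x => Subtype.ext (by ext i j; simp) }
    refine (finrank_ker_eq_of_equiv E fun x y => ?_).symm
    rw [incidenceForm_apply, incidenceForm_apply]
    change trace (F.submatrix e e * ((x : Matrix ι' ι' ℂ).submatrix e e *
      (y : Matrix ι' ι' ℂ).submatrix e e - (y : Matrix ι' ι' ℂ).submatrix e e *
      (x : Matrix ι' ι' ℂ).submatrix e e)) = _
    rw [submatrix_mul_equiv, submatrix_mul_equiv,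
      show ∀ A B : Matrix ι' ι' ℂ, A.submatrix e e - B.submatrix e e = (A - B).submatrix e e
      from fun _ _ => rfl, submatrix_mul_equiv]
    exact e.sum_comp fun i => (F * ((x : Matrix ι' ι' ℂ) * y - (y : Matrix ι' ι' ℂ) * x)) i i
  obtain ⟨⟨F, hF⟩, hmin⟩ := h
  refine ⟨⟨F.submatrix e.symm e.symm, ?_⟩, fun F' => key F' ▸ hmin _⟩
  rw [← key, submatrix_submatrix]
  simpa using hF

/-- Transposition reverses products, hence changes the sign of brackets. Replacing `F` by `-Fᵀ`
compensates for this. -/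
theorem HasIndex.swap {R : ι → ι → Prop} {m : ℕ} (h : HasIndex R m) :
    HasIndex (fun i j => R j i) m := by
  have key (F : Matrix ι ι ℂ) : stabDim R (-Fᵀ) = stabDim (fun i j => R j i) F := by
    let E : incidence R ≃ₗ[ℂ] incidence (fun i j => R j i) :=
      { toFun := fun x => ⟨(x : Matrix ι ι ℂ)ᵀ, fun i j hij => x.2 _ _ hij⟩
        map_add' := fun x y => rfl
        map_smul' := fun c x => rfl
        invFun := fun x => ⟨(x : Matrix ι ι ℂ)ᵀ, fun i j hij => x.2 _ _ hij⟩
        left_inv := fun x => rfl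
        right_inv := fun x => rfl }
    refine finrank_ker_eq_of_equiv E fun x y => ?_
    rw [incidenceForm_apply, incidenceForm_apply]
    change trace (F * ((x : Matrix ι ι ℂ)ᵀ * (y : Matrix ι ι ℂ)ᵀ -
      (y : Matrix ι ι ℂ)ᵀ * (x : Matrix ι ι ℂ)ᵀ)) = _
    rw [← transpose_mul, ← transpose_mul, ← transpose_sub, ← trace_transpose, transpose_mul,
      transpose_transpose, trace_mul_comm, ← neg_sub, mul_neg, neg_mul]
  obtain ⟨⟨F, hF⟩, hmin⟩ := h
  refine ⟨⟨-Fᵀ, ?_⟩, fun F' => key F' ▸ hmin _⟩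
  rw [← key, transpose_neg, transpose_transpose, neg_neg]
  exact hF

theorem HasIndex.sum {R : ι → ι → Prop} {R' : ι' → ι' → Prop} {Q : ι ⊕ ι' → ι ⊕ ι' → Prop}
    (h₁₁ : ∀ i j, Q (.inl i) (.inl j) ↔ R i j) (h₂₂ : ∀ i j, Q (.inr i) (.inr j) ↔ R' i j)
    (h₁₂ : ∀ i j, ¬ Q (.inl i) (.inr j)) (h₂₁ : ∀ i j, ¬ Q (.inr i) (.inl j)) {m m' : ℕ}
    (h : HasIndex R m) (h' : HasIndex R' m') : HasIndex Q (m + m') := by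
  -- The algebra is a direct product, and only the diagonal blocks of `F` are seen by it.
  have key (F : Matrix (ι ⊕ ι') (ι ⊕ ι') ℂ) :
      stabDim Q F = stabDim R F.toBlocks₁₁ + stabDim R' F.toBlocks₂₂ := by
    let E : (incidence R × incidence R') ≃ₗ[ℂ] incidence Q :=
      { toFun := fun x => ⟨fromBlocks x.1 0 0 x.2, by
          rintro (i | i) (j | j) hij
          · exact x.1.2 _ _ fun h => hij ((h₁₁ _ _).2 h)
          · rfl
          · rfl
          · exact x.2.2 _ _ fun h => hij ((h₂₂ _ _).2 h)⟩
        map_add' := fun x y => Subtype.ext (by simp [fromBlocks_add])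
        map_smul' := fun c x => Subtype.ext (by simp [fromBlocks_smul])
        invFun := fun x => (⟨x.1.toBlocks₁₁, fun i j hij => show x.1 (.inl i) (.inl j) = 0
            from x.2 _ _ fun h => hij ((h₁₁ _ _).1 h)⟩,
          ⟨x.1.toBlocks₂₂, fun i j hij => show x.1 (.inr i) (.inr j) = 0
            from x.2 _ _ fun h => hij ((h₂₂ _ _).1 h)⟩)
        left_inv := fun x => rfl
        right_inv := fun x => Subtype.ext (by
          ext (i | i) (j | j)
          · rfl
          · exact (x.2 _ _ (h₁₂ _ _)).symm
          · exact (x.2 _ _ (h₂₁ _ _)).symm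
          · rfl) }
    have hE (x y : incidence R × incidence R') : incidenceForm Q F (E x) (E y) =
        incidenceForm R F.toBlocks₁₁ x.1 y.1 + incidenceForm R' F.toBlocks₂₂ x.2 y.2 := by
      simp only [incidenceForm_apply]
      change trace (F * (fromBlocks (x.1 : Matrix ι ι ℂ) 0 0 (x.2 : Matrix ι' ι' ℂ) *
        fromBlocks (y.1 : Matrix ι ι ℂ) 0 0 (y.2 : Matrix ι' ι' ℂ) -
        fromBlocks (y.1 : Matrix ι ι ℂ) 0 0 (y.2 : Matrix ι' ι' ℂ) *
        fromBlocks (x.1 : Matrix ι ι ℂ) 0 0 (x.2 : Matrix ι' ι' ℂ))) = _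
      conv_lhs => rw [← fromBlocks_toBlocks F]
      simp only [fromBlocks_multiply, add_zero, zero_add, sub_eq_add_neg,
        fromBlocks_neg, fromBlocks_add, trace, diag, Fintype.sum_sum_type, fromBlocks_apply₁₁,
        fromBlocks_apply₂₂, neg_zero, Matrix.mul_zero, Matrix.zero_mul]
    have hker : (LinearMap.ker (incidenceForm Q F)) =
        ((LinearMap.ker (incidenceForm R F.toBlocks₁₁)).prod
          (LinearMap.ker (incidenceForm R' F.toBlocks₂₂))).map (E : _ →ₗ[ℂ] incidence Q) := by
      ext z
      obtain ⟨x, rfl⟩ := E.surjective z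
      rw [Submodule.mem_map_equiv, LinearEquiv.symm_apply_apply, Submodule.mem_prod]
      constructor
      · intro hz
        have hz' : incidenceForm Q F (E x) = 0 := hz
        constructor
        · refine LinearMap.ext fun y => ?_
          have := hE x (y, 0)
          rw [hz'] at this
          simpa using this.symm
        · refine LinearMap.ext fun y => ?_
          have := hE x (0, y)
          rw [hz'] at this
          simpa using this.symm
      · rintro ⟨h1, h2⟩
        refine LinearMap.ext fun w => ?_
        obtain ⟨y, rfl⟩ := E.surjective w
        have h1' : incidenceForm R F.toBlocks₁₁ x.1 = 0 := h1
        have h2' : incidenceForm R' F.toBlocks₂₂ x.2 = 0 := h2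
        rw [hE, h1', h2']
        simp
    rw [stabDim, hker, LinearEquiv.finrank_map_eq]
    exact finrank_submodule_prod _ _
  obtain ⟨⟨F, hF⟩, hmin⟩ := h
  obtain ⟨⟨F', hF'⟩, hmin'⟩ := h'
  refine ⟨⟨fromBlocks F 0 0 F', ?_⟩, fun G => ?_⟩
  · rw [key, toBlocks_fromBlocks₁₁, toBlocks_fromBlocks₂₂, hF, hF']
  · rw [key]
    exact add_le_add (hmin _) (hmin' _)

end Incidence

/-! ### The index of `𝔤𝔩(p)`, by means of cyclic vectors. -/

/-- The matrix whose columns are `e₀, A e₀, A² e₀, …`. -/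
def krylov {S : Type*} [CommRing S] {q : ℕ} (A : Matrix (Fin (q + 1)) (Fin (q + 1)) S) :
    Matrix (Fin (q + 1)) (Fin (q + 1)) S :=
  of fun i j => (A ^ (j : ℕ)) i 0

theorem krylov_map {S S' : Type*} [CommRing S] [CommRing S'] {q : ℕ} (f : S →+* S')
    (A : Matrix (Fin (q + 1)) (Fin (q + 1)) S) :
    (krylov A).map f = krylov (A.map f) := by
  ext i j
  have : (f.mapMatrix A) ^ (j : ℕ) = f.mapMatrix (A ^ (j : ℕ)) := (map_pow _ _ _).symm
  exact (congrFun (congrFun this i) 0).symm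

theorem krylov_shift (q : ℕ) :
    krylov (of fun i j : Fin (q + 1) => if (i : ℕ) = j + 1 then (1 : ℂ) else 0) = 1 := by
  have key (m : ℕ) (i : Fin (q + 1)) :
      ((of fun i j : Fin (q + 1) => if (i : ℕ) = j + 1 then (1 : ℂ) else 0) ^ m) i 0 =
        if (i : ℕ) = m then 1 else 0 := by
    induction m generalizing i with
    | zero => rw [pow_zero, Matrix.one_apply]; simp only [Fin.ext_iff, Fin.val_zero]
    | succ m ih =>
      rw [pow_succ', Matrix.mul_apply]
      simp only [ih, of_apply]
      by_cases h : (i : ℕ) = m + 1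
      · rw [Finset.sum_eq_single ⟨m, by omega⟩]
        · rw [if_pos rfl, if_pos h, mul_one]
        · intro b _ hb
          have : (b : ℕ) ≠ m := fun hh => hb (Fin.ext hh)
          simp [this]
        · simp
      · rw [if_neg h]
        refine Finset.sum_eq_zero fun k _ => ?_
        split_ifs <;> first | omega | simp
  ext i j
  simp only [krylov, of_apply, key, Matrix.one_apply, Fin.ext_iff]

/-- The determinant is a polynomial in `t`, and it is not zero at `t₀`. -/
theorem finite_det_krylov_eq_zero {q : ℕ} (F G : Matrix (Fin (q + 1)) (Fin (q + 1)) ℂ) (t₀ : ℂ)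
    (h₀ : (krylov (F + t₀ • G)).det ≠ 0) : {t : ℂ | ¬ (krylov (F + t • G)).det ≠ 0}.Finite := by
  open Polynomial in
  let A : Matrix (Fin (q + 1)) (Fin (q + 1)) ℂ[X] := F.map C + (X : ℂ[X]) • G.map C
  have hA (t : ℂ) : (krylov A).det.eval t = (krylov (F + t • G)).det := by
    have h1 : A.map (Polynomial.evalRingHom t) = F + t • G := by
      ext i j
      simp only [A, Matrix.map_apply, Matrix.add_apply, Matrix.smul_apply, smul_eq_mul,
        Polynomial.coe_evalRingHom, Polynomial.eval_add, Polynomial.eval_C, Polynomial.eval_mul,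
        Polynomial.eval_X]
    rw [← h1, ← krylov_map]
    exact (Polynomial.evalRingHom t).map_det _
  have hne : (krylov A).det ≠ 0 := fun h => h₀ (by rw [← hA, h, Polynomial.eval_zero])
  refine (Polynomial.finite_setOfPred_isRoot hne).subset fun t ht => ?_
  rw [Set.mem_ofPred_eq, not_not] at ht
  rw [Set.mem_ofPred_eq, Polynomial.IsRoot, hA, ht]

section

variable {ι : Type*} [Fintype ι] [DecidableEq ι]

theorem traceForm_single (F x : Matrix ι ι ℂ) (i j : ι) :
    traceForm F x (single i j 1) = (F * x - x * F) j i := by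
  rw [traceForm_apply, mul_sub, ← mul_assoc, ← mul_assoc, trace_sub, trace_mul_comm (F * _) x,
    ← mul_assoc, ← trace_sub, ← sub_mul]
  simp [trace_mul_single]

theorem mem_ker_incidenceForm_top {F : Matrix ι ι ℂ} {x : incidence fun _ _ : ι => True} :
    x ∈ LinearMap.ker (incidenceForm (fun _ _ => True) F) ↔ F * x.1 = x.1 * F := by
  constructor
  · intro h
    rw [← sub_eq_zero]
    ext j i
    have := LinearMap.congr_fun h ⟨single i j 1, fun _ _ h => absurd trivial h⟩
    rw [← traceForm_single]
    exact this
  · intro h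
    refine LinearMap.ext fun y => ?_
    rw [incidenceForm_apply, mul_sub, ← mul_assoc, h, ← mul_assoc, trace_sub,
      trace_mul_comm (F * _) x.1, ← mul_assoc, sub_self, LinearMap.zero_apply]

end

/-- The stabilizer is the centralizer of `F`, and `e₀` is a cyclic vector. A matrix commuting with
`F` is determined by its value at `e₀`, which bounds the dimension above. The powers of `F` are
independent because their values at `e₀` are, which bounds it below. -/
theorem stabDim_top_of_krylov {q : ℕ} (F : Matrix (Fin (q + 1)) (Fin (q + 1)) ℂ)
    (h : (krylov F).det ≠ 0) : stabDim (fun _ _ => True) F = q + 1 := by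
  have hunit : IsUnit (krylov F).det := isUnit_iff_ne_zero.2 h
  apply le_antisymm
  · let f : LinearMap.ker (incidenceForm (fun _ _ => True) F) →ₗ[ℂ] (Fin (q + 1) → ℂ) :=
      { toFun := fun x i => x.1.1 i 0
        map_add' := fun _ _ => rfl
        map_smul' := fun _ _ => rfl }
    have hf : Function.Injective f := by
      refine (injective_iff_map_eq_zero _).2 ?_
      rintro ⟨x, hx⟩ h0
      rw [mem_ker_incidenceForm_top] at hx
      have hK : x.1 * krylov F = 0 := by
        ext i j
        have hc : F ^ (j : ℕ) * x.1 = x.1 * F ^ (j : ℕ) := (show Commute F x.1 from hx).pow_left _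
        have : (x.1 * krylov F) i j = (x.1 * F ^ (j : ℕ)) i 0 := rfl
        rw [this, ← hc, Matrix.mul_apply]
        refine Finset.sum_eq_zero fun k _ => ?_
        rw [show x.1 k 0 = 0 from congrFun h0 k, mul_zero]
      refine Subtype.ext (Subtype.ext ?_)
      have := congrArg (· * (krylov F)⁻¹) hK
      simpa [mul_assoc, Matrix.mul_nonsing_inv _ hunit] using this
    exact (LinearMap.finrank_le_finrank_of_injective hf).trans_eq (by simp)
  · let g : (Fin (q + 1) → ℂ) →ₗ[ℂ] LinearMap.ker (incidenceForm (fun _ _ => True) F) :=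
      { toFun := fun c => ⟨⟨∑ j, c j • F ^ (j : ℕ), fun _ _ h => absurd trivial h⟩, by
          rw [mem_ker_incidenceForm_top]
          refine (show Commute F _ from Commute.sum_right _ _ _ fun j _ => ?_)
          exact ((Commute.refl F).pow_right _).smul_right _⟩
        map_add' := fun c d => Subtype.ext (Subtype.ext (by
          simp [add_smul, Finset.sum_add_distrib]))
        map_smul' := fun c d => Subtype.ext (Subtype.ext (by
          simp [mul_smul, Finset.smul_sum])) }
    have hg : Function.Injective g := by
      refine (injective_iff_map_eq_zero _).2 ?_
      intro c h0
      have h1 : ∑ j, c j • F ^ (j : ℕ) = 0 := congrArg (fun z => z.1.1) h0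
      have h2 : krylov F *ᵥ c = 0 := by
        ext i
        have := congrFun (congrFun h1 i) 0
        rw [Matrix.sum_apply] at this
        simpa [krylov, mulVec, dotProduct, mul_comm] using this
      exact Matrix.eq_zero_of_mulVec_eq_zero h h2
    exact le_of_eq_of_le (by simp) (LinearMap.finrank_le_finrank_of_injective hg)

/-- The index of `𝔤𝔩(p)` is `p`. -/
theorem hasIndex_top (p : ℕ) : HasIndex (fun _ _ : Fin p => True) p := by
  cases p with
  | zero =>
    refine ⟨⟨0, ?_⟩, fun _ => Nat.zero_le _⟩
    have : Subsingleton (LinearMap.ker (incidenceForm (fun _ _ : Fin 0 => True) 0)) :=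
      ⟨fun x y => Subtype.ext (Subtype.ext (Subsingleton.elim _ _))⟩
    exact finrank_zero_of_subsingleton
  | succ q =>
    set N : Matrix (Fin (q + 1)) (Fin (q + 1)) ℂ :=
      of fun i j => if (i : ℕ) = j + 1 then (1 : ℂ) else 0 with hN
    have hdet : (krylov N).det ≠ 0 := by
      rw [krylov_shift, det_one]
      exact one_ne_zero
    refine ⟨⟨N, stabDim_top_of_krylov N hdet⟩, fun F => ?_⟩
    -- The line joins `F` to the shift `N`, reached at `t = 1`, so `e₀` is cyclic at almost all of
    -- its points.
    obtain ⟨t, ht, hle⟩ := exists_stabDim_le (fun _ _ => True) F (N - F)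
      (fun t => (krylov (F + t • (N - F))).det ≠ 0)
      (finite_det_krylov_eq_zero F (N - F) 1 (by simpa using hdet))
    rwa [stabDim_top_of_krylov _ ht] at hle

/-! ### Symplectic reduction of an incidence algebra along an abelian ideal. -/

section Reduction

variable {κ ι : Type*} [Fintype κ] [Fintype ι] [DecidableEq κ] [DecidableEq ι]

theorem traceForm_eq_trace_mul {ι : Type*} [Fintype ι] (F x y : Matrix ι ι ℂ) :
    traceForm F x y = trace ((F * x - x * F) * y) := by
  rw [traceForm_apply, mul_sub, ← mul_assoc, ← mul_assoc, trace_sub, trace_mul_comm (F * y) x,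
    ← mul_assoc, ← trace_sub, ← sub_mul]

theorem exists_forall_eq_trace {ι : Type*} [Fintype ι] (φ : Matrix ι ι ℂ →ₗ[ℂ] ℂ) :
    ∃ F : Matrix ι ι ℂ, ∀ x, φ x = trace (F * x) := by
  classical
  refine ⟨of fun j i => φ (single i j 1), fun x => ?_⟩
  conv_lhs => rw [matrix_eq_sum_single x]
  simp only [map_sum, trace, diag, Matrix.mul_apply, of_apply]
  rw [Finset.sum_comm]
  refine Finset.sum_congr rfl fun i _ => Finset.sum_congr rfl fun j _ => ?_
  rw [mul_comm, ← smul_eq_mul, ← map_smul, smul_single, smul_eq_mul, mul_one]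

/-- The hypotheses on a relation `R` on `κ ⊕ ι` under which the incidence algebra of `R` has the
index of the incidence algebra of a relation `R'` on `ι`. The rows `κ ∪ S` and the columns
`T ∪ b(κ)` form an abelian ideal. -/
structure IsReduction (R : κ ⊕ ι → κ ⊕ ι → Prop) (R' : ι → ι → Prop) (b : κ → ι)
    (S T : ι → Prop) : Prop where
  inj : Function.Injective b
  refl : ∀ i, R i i
  trans : ∀ i j k, R i j → R j k → R i k
  inl_inl : ∀ k l, R (.inl k) (.inl l)
  inl_inr : ∀ k j, R (.inl k) (.inr j) ↔ S j ∨ T j ∨ j ∈ Set.range b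
  inr_inl : ∀ i k, R (.inr i) (.inl k) ↔ S i
  row : ∀ i j, S i → (R (.inr i) (.inr j) ↔ S j ∨ T j ∨ j ∈ Set.range b)
  col : ∀ i j, R (.inr i) (.inr j) → S j → S i
  closed : ∀ i j, (T i ∨ i ∈ Set.range b) → R (.inr i) (.inr j) → T j ∨ j ∈ Set.range b
  not_S : ∀ k, ¬ S (b k)
  not_T : ∀ k, ¬ T (b k)
  T_rel : ∀ i k, T i → R (.inr i) (.inr (b k))
  or : ∀ i j, S i → ¬ T j
  rel_iff : ∀ i j, R' i j ↔ R (.inr i) (.inr j) ∧ ¬ (T i ∧ j ∈ Set.range b)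

variable (b : κ → ι) (S T : ι → Prop)

/-- The form `tr (F ·)` restricts to the standard form on the rows `κ ∪ S` and the columns
`T ∪ b(κ)`. -/
structure IsStandard (F : Matrix (κ ⊕ ι) (κ ⊕ ι) ℂ) : Prop where
  one : ∀ k l, F (.inr (b l)) (.inl k) = if l = k then 1 else 0
  left : ∀ k t, T t → F (.inr t) (.inl k) = 0
  right : ∀ k s, S s → F (.inr (b k)) (.inr s) = 0

variable [DecidablePred S]

/-- The embedding of the reduced incidence algebra. -/
def spread : Matrix ι ι ℂ →ₗ[ℂ] Matrix (κ ⊕ ι) (κ ⊕ ι) ℂ where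
  -- The `b(κ) × b(κ)` block is duplicated on `κ × κ`. In the rows of `S`, the entry of column `b k`
  -- is moved to column `k`, because the position `(i, b k)` with `S i` belongs to the ideal.
  toFun y := fromBlocks (of fun k l => y (b k) (b l)) 0
    (of fun i k => if S i then y i (b k) else 0)
    (of fun i j => if S i ∧ ¬ S j then 0 else y i j)
  map_add' x y := by
    ext (i | i) (j | j) <;> simp <;> split_ifs <;> simp
  map_smul' c y := by
    ext (i | i) (j | j) <;> simp

@[simp] theorem spread_inl_inl (y : Matrix ι ι ℂ) (k l : κ) :
    spread b S y (.inl k) (.inl l) = y (b k) (b l) := rfl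

@[simp] theorem spread_inl_inr (y : Matrix ι ι ℂ) (k : κ) (j : ι) :
    spread b S y (.inl k) (.inr j) = 0 := rfl

@[simp] theorem spread_inr_inl (y : Matrix ι ι ℂ) (i : ι) (k : κ) :
    spread b S y (.inr i) (.inl k) = if S i then y i (b k) else 0 := rfl

@[simp] theorem spread_inr_inr (y : Matrix ι ι ℂ) (i j : ι) :
    spread b S y (.inr i) (.inr j) = if S i ∧ ¬ S j then 0 else y i j := rfl

variable {b S T} {R : κ ⊕ ι → κ ⊕ ι → Prop} {R' : ι → ι → Prop}

namespace IsReduction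

variable (h : IsReduction R R' b S T)
include h

theorem spread_mem {y : Matrix ι ι ℂ} (hy : y ∈ incidence R') : spread b S y ∈ incidence R := by
  rintro (i | i) (j | j) hij
  · exact absurd (h.inl_inl _ _) hij
  · rfl
  · rw [spread_inr_inl, if_neg fun hS => hij ((h.inr_inl _ _).2 hS)]
  · rw [spread_inr_inr]
    split_ifs
    · rfl
    · exact hy _ _ fun hR => hij ((h.rel_iff _ _).1 hR).1

/-- Products of duplicated or moved entries run over `b(κ)` only, or over `b(κ)` and `S`. The other
intermediate indices contribute nothing: they would have to lie in `T`, and `R'` has no pair in `T ×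
b(κ)`. -/
theorem spread_mul {x y : Matrix ι ι ℂ} (hx : x ∈ incidence R') (hy : y ∈ incidence R') :
    spread b S x * spread b S y = spread b S (x * y) := by
  have hzero (i j : ι) (hi : i ∈ Set.range b ∨ S i) (hj : j ∈ Set.range b) (l : ι)
      (hl : l ∉ Set.range b) (hSl : ¬ S l) : x i l * y l j = 0 := by
    by_cases hil : R' i l
    · have hR := ((h.rel_iff _ _).1 hil).1
      have hT : T l := by
        rcases hi with hi | hi
        · exact (h.closed _ _ (.inr hi) hR).resolve_right hl
        · rcases (h.row _ _ hi).1 hR with h1 | h1 | h1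
          exacts [absurd h1 hSl, h1, absurd h1 hl]
      rw [hy l j fun hR => ((h.rel_iff _ _).1 hR).2 ⟨hT, hj⟩, mul_zero]
    · rw [hx _ _ hil, zero_mul]
  have hSU (i l : ι) (hi : i ∈ Set.range b) (hSl : S l) : x i l = 0 := by
    refine hx _ _ fun hR => ?_
    obtain ⟨k, rfl⟩ := hi
    exact h.not_S k (h.col _ _ ((h.rel_iff _ _).1 hR).1 hSl)
  have hcol (z : Matrix ι ι ℂ) (hz : z ∈ incidence R') (i l : ι) (hi : ¬ S i) (hSl : S l) :
      z i l = 0 := hz _ _ fun hR => hi (h.col _ _ ((h.rel_iff _ _).1 hR).1 hSl)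
  ext (i | i) (j | j)
  · rw [Matrix.mul_apply, Fintype.sum_sum_type, spread_inl_inl, Matrix.mul_apply]
    simp only [spread_inl_inl, spread_inl_inr, zero_mul, Finset.sum_const_zero, add_zero]
    refine Fintype.sum_of_injective b h.inj _ _ (fun l hl => ?_) fun k => rfl
    by_cases hSl : S l
    · rw [hSU _ _ ⟨i, rfl⟩ hSl, zero_mul]
    · exact hzero _ _ (.inl ⟨i, rfl⟩) ⟨j, rfl⟩ l hl hSl
  · rw [Matrix.mul_apply, Fintype.sum_sum_type]
    simp
  · rw [Matrix.mul_apply, Fintype.sum_sum_type, spread_inr_inl, Matrix.mul_apply]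
    simp only [spread_inr_inl, spread_inl_inl, spread_inr_inr]
    by_cases hi : S i
    · simp only [hi, if_true, true_and]
      have h1 : ∑ k, x i (b k) * y (b k) (b j) =
          ∑ l, if S l then 0 else x i l * y l (b j) := by
        refine Fintype.sum_of_injective b h.inj _ _ (fun l hl => ?_) fun k => ?_
        · split_ifs with hSl
          · rfl
          · exact hzero _ _ (.inr hi) ⟨j, rfl⟩ l hl hSl
        · rw [if_neg (h.not_S k)]
      rw [h1, ← Finset.sum_add_distrib]
      refine Finset.sum_congr rfl fun l _ => ?_
      by_cases hl : S l <;> simp [hl]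
    · simp only [hi, if_false, zero_mul, Finset.sum_const_zero, zero_add, false_and]
      refine Finset.sum_eq_zero fun l _ => ?_
      split_ifs with hl
      · rw [hcol x hx i l hi hl, zero_mul]
      · rw [mul_zero]
  · rw [Matrix.mul_apply, Fintype.sum_sum_type, spread_inr_inr, Matrix.mul_apply]
    simp only [spread_inr_inl, spread_inl_inr, spread_inr_inr, mul_zero, Finset.sum_const_zero,
      zero_add]
    by_cases hi : S i <;> by_cases hj : S j <;> simp only [hi, hj, not_true, not_false_eq_true,
      and_true, and_false, true_and, false_and, if_true, if_false]
    · refine Finset.sum_congr rfl fun l _ => ?_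
      by_cases hl : S l
      · simp [hl]
      · simp [hl, hcol y hy l j hl hj]
    · refine Finset.sum_eq_zero fun l _ => ?_
      by_cases hl : S l <;> simp [hl]
    · refine Finset.sum_congr rfl fun l _ => ?_
      by_cases hl : S l
      · simp [hcol x hx i l hi hl]
      · simp [hl]

/-- This is `finrank_ker_eq_of_reduction` for the ideal `V` of rows `κ ∪ S` and columns `T ∪ b(κ)`.
For a standard `F` its orthogonal is `V` plus the image of `spread`. -/
theorem stabDim_eq {F : Matrix (κ ⊕ ι) (κ ⊕ ι) ℂ} (hF : IsStandard b S T F) {F' : Matrix ι ι ℂ}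
    (hFF' : ∀ z ∈ incidence R', trace (F * spread b S z) = trace (F' * z)) :
    stabDim R F = stabDim R' F' := by
  have trans' : ∀ i j k, R' i j → R' j k → R' i k := by
    intro i j k hij hjk
    rw [h.rel_iff] at hij hjk ⊢
    refine ⟨h.trans _ _ _ hij.1 hjk.1, fun hc => ?_⟩
    rcases h.closed _ _ (.inl hc.1) hij.1 with h1 | h1
    · exact hjk.2 ⟨h1, hc.2⟩
    · exact hij.2 ⟨hc.1, h1⟩
  let s : incidence R' →ₗ[ℂ] incidence R :=
    (spread b S).restrict fun y hy => h.spread_mem hy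
  let rowP : κ ⊕ ι → Prop := Sum.elim (fun _ => True) S
  let colU : κ ⊕ ι → Prop := Sum.elim (fun _ => False) fun j => T j ∨ j ∈ Set.range b
  let V : Submodule ℂ (incidence R) :=
    (incidence fun i j => rowP i ∧ colU j).comap (incidence R).subtype
  have hPU : ∀ i j, rowP i → colU j → R i j := by
    rintro (i | i) (j | j) hi hj
    · exact h.inl_inl _ _
    · exact (h.inl_inr _ _).2 (.inr hj)
    · exact hj.elim
    · exact (h.row _ _ hi).2 (.inr hj)
  have hFU : ∀ i j, rowP i → colU j →
      F j i = ∑ k, if Sum.inl k = i ∧ Sum.inr (b k) = j then 1 else 0 := by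
    rintro (i | i) (j | j) hi hj
    · exact hj.elim
    · rcases hj with hj | ⟨l, rfl⟩
      · rw [hF.left _ _ hj, Finset.sum_eq_zero]
        rintro k -
        rw [if_neg]
        rintro ⟨-, h2⟩
        exact h.not_T k (by rwa [Sum.inr.inj h2])
      · rw [hF.one, Finset.sum_eq_single i]
        · simp [h.inj.eq_iff, eq_comm]
        · intro k _ hk
          simp [hk]
        · simp
    · exact hj.elim
    · rcases hj with hj | ⟨l, rfl⟩
      · exact absurd hj (h.or _ _ hi)
      · rw [hF.right _ _ hi]
        simp
  -- Since `V` is an ideal, these entries of the commutator involve `F` only at transposed positions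
  -- of `V`, where it is standard.
  have hmulF (x : Matrix (κ ⊕ ι) (κ ⊕ ι) ℂ) (hx : x ∈ incidence R) (i j : κ ⊕ ι) (hi : rowP i)
      (hj : colU j) : (F * x - x * F) j i =
        (∑ k, if Sum.inr (b k) = j then x (.inl k) i else 0) -
          ∑ k, if Sum.inl k = i then x j (.inr (b k)) else 0 := by
    rw [Matrix.sub_apply, Matrix.mul_apply, Matrix.mul_apply]
    congr 1
    · have h1 : ∀ m, F j m * x m i =
          ∑ k, if Sum.inl k = m ∧ Sum.inr (b k) = j then x m i else 0 := by
        intro m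
        by_cases hm : rowP m
        · rw [hFU m j hm hj, Finset.sum_mul]
          simp only [ite_mul, one_mul, zero_mul]
        · rw [hx m i, mul_zero]
          · simp
          · intro hR
            refine hm ?_
            rcases m with m | m
            · trivial
            · rcases i with i | i
              · exact (h.inr_inl _ _).1 hR
              · exact h.col _ _ hR hi
      rw [Finset.sum_congr rfl fun m _ => h1 m, Finset.sum_comm]
      refine Finset.sum_congr rfl fun k _ => ?_
      rw [Finset.sum_eq_single (Sum.inl k)]
      · simp
      · intro m _ hm
        simp [hm.symm]
      · simp
    · have h1 : ∀ m, x j m * F m i =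
          ∑ k, if Sum.inl k = i ∧ Sum.inr (b k) = m then x j m else 0 := by
        intro m
        by_cases hm : colU m
        · rw [hFU i m hi hm, Finset.mul_sum]
          simp only [mul_ite, mul_one, mul_zero]
        · rw [hx j m, zero_mul]
          · refine (Finset.sum_eq_zero fun k _ => ?_).symm
            split_ifs <;> rfl
          · intro hR
            refine hm ?_
            rcases j with j | j
            · exact hj.elim
            · rcases m with m | m
              · have hS := (h.inr_inl _ _).1 hR
                rcases hj with hj | ⟨l, rfl⟩
                · exact (h.or _ _ hS hj).elim
                · exact (h.not_S _ hS).elim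
              · exact h.closed _ _ hj hR
      rw [Finset.sum_congr rfl fun m _ => h1 m, Finset.sum_comm]
      refine Finset.sum_congr rfl fun k _ => ?_
      rw [Finset.sum_eq_single (Sum.inr (b k))]
      · simp
      · intro m _ hm
        simp [hm.symm]
      · simp
  have hc1 (x : Matrix (κ ⊕ ι) (κ ⊕ ι) ℂ) (hx : x ∈ incidence R) (k l : κ) :
      (F * x - x * F) (.inr (b l)) (.inl k) =
        x (.inl l) (.inl k) - x (.inr (b l)) (.inr (b k)) := by
    rw [hmulF x hx (.inl k) (.inr (b l)) trivial (Or.inr ⟨l, rfl⟩)]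
    simp [h.inj.eq_iff]
  have hc2 (x : Matrix (κ ⊕ ι) (κ ⊕ ι) ℂ) (hx : x ∈ incidence R) (k : κ) (t : ι) (ht : T t) :
      (F * x - x * F) (.inr t) (.inl k) = - x (.inr t) (.inr (b k)) := by
    rw [hmulF x hx (.inl k) (.inr t) trivial (Or.inl ht), Finset.sum_eq_zero, zero_sub]
    · simp
    · intro m _
      rw [if_neg]
      intro hm
      exact h.not_T m (by rwa [Sum.inr.inj hm])
  have hc3 (x : Matrix (κ ⊕ ι) (κ ⊕ ι) ℂ) (hx : x ∈ incidence R) (l : κ) (s : ι) (hs : S s) :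
      (F * x - x * F) (.inr (b l)) (.inr s) = x (.inl l) (.inr s) := by
    rw [hmulF x hx (.inr s) (.inr (b l)) hs (Or.inr ⟨l, rfl⟩)]
    simp [h.inj.eq_iff]
  have hVx (x : incidence R) : (∀ v ∈ V, incidenceForm R F v x = 0) ↔
      ∀ i j, rowP i → colU j → (F * x.1 - x.1 * F) j i = 0 := by
    constructor
    · intro hx i j hi hj
      have hmem : single i j 1 ∈ incidence R := fun i' j' hij => by
        rw [single_apply_of_ne]
        rintro ⟨rfl, rfl⟩
        exact hij (hPU _ _ hi hj)
      have := hx ⟨single i j 1, hmem⟩ (fun i' j' hij => by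
        change single i j (1 : ℂ) i' j' = 0
        rw [single_apply_of_ne]
        rintro ⟨rfl, rfl⟩
        exact hij ⟨hi, hj⟩)
      rw [incidenceForm_skew, neg_eq_zero] at this
      rw [← traceForm_single]
      exact this
    · intro hx v hv
      rw [incidenceForm_skew, neg_eq_zero]
      change traceForm F x.1 v.1 = 0
      rw [traceForm_eq_trace_mul, trace]
      refine Finset.sum_eq_zero fun j _ => ?_
      rw [diag_apply, Matrix.mul_apply]
      refine Finset.sum_eq_zero fun i _ => ?_
      by_cases hij : rowP i ∧ colU j
      · rw [hx _ _ hij.1 hij.2, zero_mul]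
      · rw [show v.1 i j = 0 from hv i j hij, mul_zero]
  have hperp (x : incidence R) : (∀ v ∈ V, incidenceForm R F v x = 0) ↔
      (∀ k l, x.1 (.inl l) (.inl k) = x.1 (.inr (b l)) (.inr (b k))) ∧
      (∀ t k, T t → x.1 (.inr t) (.inr (b k)) = 0) ∧ ∀ k s, S s → x.1 (.inl k) (.inr s) = 0 := by
    rw [hVx]
    constructor
    · intro hx
      refine ⟨fun k l => ?_, fun t k ht => ?_, fun k s hs => ?_⟩
      · rw [← sub_eq_zero, ← hc1 _ x.2]
        exact hx _ _ trivial (.inr ⟨l, rfl⟩)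
      · rw [← neg_eq_zero, ← hc2 _ x.2 _ _ ht]
        exact hx _ _ trivial (.inl ht)
      · rw [← hc3 _ x.2 _ _ hs]
        exact hx _ _ hs (.inr ⟨k, rfl⟩)
    · rintro ⟨h1, h2, h3⟩ (i | i) (j | j) hi hj
      · exact hj.elim
      · rcases hj with hj | ⟨l, rfl⟩
        · rw [hc2 _ x.2 _ _ hj, h2 _ _ hj, neg_zero]
        · rw [hc1 _ x.2, h1, sub_self]
      · exact hj.elim
      · rcases hj with hj | ⟨l, rfl⟩
        · exact absurd hj (h.or _ _ hi)
        · rw [hc3 _ x.2 _ _ hi, h3 _ _ hi]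
  have hsform (x y : incidence R') :
      incidenceForm R F (s x) (s y) = incidenceForm R' F' x y := by
    rw [incidenceForm_apply, incidenceForm_apply]
    change trace (F * (spread b S x.1 * spread b S y.1 - spread b S y.1 * spread b S x.1)) = _
    rw [h.spread_mul x.2 y.2, h.spread_mul y.2 x.2, ← map_sub]
    exact hFF' _ (Submodule.sub_mem _ (mul_mem_incidence trans' x.2 y.2)
      (mul_mem_incidence trans' y.2 x.2))
  have hs_inj : Function.Injective s := by
    refine (injective_iff_map_eq_zero _).2 fun y hy => Subtype.ext ?_
    have hy' : spread b S y.1 = 0 := congrArg Subtype.val hy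
    ext i j
    have h1 := congrFun (congrFun hy' (.inr i)) (.inr j)
    rw [spread_inr_inr] at h1
    by_cases hij : S i ∧ ¬ S j
    · by_cases hj : j ∈ Set.range b
      · obtain ⟨k, rfl⟩ := hj
        have h2 := congrFun (congrFun hy' (.inr i)) (.inl k)
        rw [spread_inr_inl, if_pos hij.1] at h2
        exact h2
      · refine y.2 _ _ fun hR => ?_
        rcases (h.row _ _ hij.1).1 ((h.rel_iff _ _).1 hR).1 with h3 | h3 | h3
        exacts [hij.2 h3, h.or _ _ hij.1 h3, hj h3]
    · rw [if_neg hij] at h1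
      exact h1
  have hV0 (x : incidence R) (hx : x ∈ V) (i j : κ ⊕ ι) (hij : ¬ (rowP i ∧ colU j)) :
      x.1 i j = 0 := hx i j hij
  have hbP (l : κ) (j : κ ⊕ ι) : ¬ (rowP (.inr (b l)) ∧ colU j) := fun hc => h.not_S _ hc.1
  have hinlU (i : κ ⊕ ι) (k : κ) : ¬ (rowP i ∧ colU (.inl k)) := fun hc => hc.2
  have hSU (i : κ ⊕ ι) (j : ι) (hj : S j) : ¬ (rowP i ∧ colU (.inr j)) := by
    rintro ⟨-, hj' | ⟨k, rfl⟩⟩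
    exacts [h.or _ _ hj hj', h.not_S _ hj]
  have hTP (i : ι) (j : κ ⊕ ι) (hi : T i) : ¬ (rowP (.inr i) ∧ colU j) := fun hc =>
    h.or _ _ hc.1 hi
  refine finrank_ker_eq_of_reduction _ _ (incidenceForm_skew R F) s hsform hs_inj V ?_ ?_ ?_
  · rw [Submodule.disjoint_def]
    rintro _ hv ⟨y, rfl⟩
    refine Subtype.ext ?_
    change spread b S y.1 = 0
    ext i j
    by_cases hij : rowP i ∧ colU j
    · rcases i with i | i <;> rcases j with j | j
      · exact hij.2.elim
      · rfl
      · exact hij.2.elim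
      · rw [spread_inr_inr, if_pos ⟨hij.1, fun hj => hSU _ _ hj hij⟩, Matrix.zero_apply]
    · exact hV0 _ hv i j hij
  · intro x
    rw [hperp, Submodule.mem_sup]
    constructor
    · rintro ⟨h1, h2, h3⟩
      -- The preimage is read off the `ι × ι` block, except that in the rows of `S` the entry of
      -- column `b k` is taken from column `k`.
      let y : Matrix ι ι ℂ := of fun i j =>
        if S i then (if S j then x.1 (.inr i) (.inr j) else
          ∑ k, if b k = j then x.1 (.inr i) (.inl k) else 0) else x.1 (.inr i) (.inr j)
      have hyb (i : ι) (k : κ) (hi : S i) : y i (b k) = x.1 (.inr i) (.inl k) := by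
        simp only [y, of_apply, if_pos hi, if_neg (h.not_S k), h.inj.eq_iff]
        simp
      have hyS (i j : ι) (hij : ¬ (S i ∧ ¬ S j)) : y i j = x.1 (.inr i) (.inr j) := by
        simp only [y, of_apply]
        by_cases hi : S i
        · have hj : S j := by tauto
          rw [if_pos hi, if_pos hj]
        · rw [if_neg hi]
      have hy : y ∈ incidence R' := by
        intro i j hij
        by_cases hS : S i ∧ ¬ S j
        · simp only [y, of_apply, if_pos hS.1, if_neg hS.2]
          refine Finset.sum_eq_zero fun k _ => ?_
          rw [if_neg]
          rintro rfl
          refine hij ((h.rel_iff _ _).2 ⟨(h.row _ _ hS.1).2 (.inr (.inr ⟨k, rfl⟩)), fun hc => ?_⟩)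
          exact h.or _ _ hS.1 hc.1
        · rw [hyS _ _ hS]
          by_cases hR : R (.inr i) (.inr j)
          · by_cases hT : T i ∧ j ∈ Set.range b
            · obtain ⟨hT, k, rfl⟩ := hT
              exact h2 _ _ hT
            · exact absurd ((h.rel_iff _ _).2 ⟨hR, hT⟩) hij
          · exact x.2 _ _ hR
      refine ⟨x - s ⟨y, hy⟩, ?_, s ⟨y, hy⟩, ⟨_, rfl⟩, sub_add_cancel _ _⟩
      intro i j hij
      change x.1 i j - spread b S y i j = 0
      rcases i with i | i <;> rcases j with j | j
      · rw [spread_inl_inl, hyS _ _ fun hc => h.not_S _ hc.1, h1, sub_self]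
      · rw [spread_inl_inr, sub_zero]
        by_cases hj : S j
        · exact h3 _ _ hj
        · refine x.2 _ _ fun hR => hij ⟨trivial, ?_⟩
          exact ((h.inl_inr _ _).1 hR).resolve_left hj
      · rw [spread_inr_inl]
        split_ifs with hi
        · rw [hyb _ _ hi, sub_self]
        · rw [sub_zero]
          exact x.2 _ _ fun hR => hi ((h.inr_inl _ _).1 hR)
      · rw [spread_inr_inr]
        split_ifs with hS
        · rw [sub_zero]
          refine x.2 _ _ fun hR => hij ⟨hS.1, ?_⟩
          exact ((h.row _ _ hS.1).1 hR).resolve_left hS.2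
        · rw [hyS _ _ hS, sub_self]
    · rintro ⟨v, hv, _, ⟨y, rfl⟩, rfl⟩
      have hadd (i j) : (v + s y).1 i j = v.1 i j + spread b S y.1 i j := rfl
      refine ⟨fun k l => ?_, fun t k ht => ?_, fun k s hs => ?_⟩
      · rw [hadd, hadd, hV0 v hv _ _ (hinlU _ _), hV0 v hv _ _ (hbP _ _), spread_inl_inl,
          spread_inr_inr, if_neg fun hc => h.not_S _ hc.1]
      · rw [hadd, hV0 v hv _ _ (hTP _ _ ht), spread_inr_inr, if_neg fun hc => h.or _ _ hc.1 ht,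
          zero_add]
        exact y.2 _ _ fun hR => ((h.rel_iff _ _).1 hR).2 ⟨ht, k, rfl⟩
      · rw [hadd, hV0 v hv _ _ (hSU _ _ hs), spread_inl_inr, zero_add]
  · intro v hv hrad
    have hEv (i j : κ ⊕ ι) (hij : R i j) : (F * v.1 - v.1 * F) j i = 0 := by
      have hmem : single i j 1 ∈ incidence R := fun i' j' hij' => by
        rw [single_apply_of_ne]
        rintro ⟨rfl, rfl⟩
        exact hij' hij
      rw [← traceForm_single]
      exact hrad ⟨single i j 1, hmem⟩
    -- Testing a radical vector `v` of `V` against the matrix unit at `(k, m)` isolates the entry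
    -- `(m, b k)`. The entries `(i, j)` with `i` in `κ` and `j` in `T` are then isolated by the unit
    -- at `(j, b i)`, which `T_rel` provides.
    have hb (m : κ ⊕ ι) (k : κ) (hm : rowP m) : v.1 m (.inr (b k)) = 0 := by
      have hR : R (.inl k) m := by
        rcases m with m | m
        · exact h.inl_inl _ _
        · exact (h.inl_inr _ _).2 (.inl hm)
      have h1 := hEv _ _ hR
      rw [Matrix.sub_apply, Matrix.mul_apply, Matrix.mul_apply, Finset.sum_eq_zero,
        Finset.sum_eq_single (.inr (b k)), hF.one, if_pos rfl, mul_one, zero_sub,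
        neg_eq_zero] at h1
      · exact h1
      · rintro (j | j) - hj
        · rw [hV0 v hv _ _ (hinlU _ _), zero_mul]
        · by_cases hU : colU (.inr j)
          · rw [hFU (.inl k) _ trivial hU, Finset.sum_eq_zero, mul_zero]
            intro l _
            rw [if_neg]
            rintro ⟨h2, h3⟩
            obtain rfl := Sum.inl.inj h2
            exact hj h3.symm
          · rw [hV0 v hv _ _ fun hc => hU hc.2, zero_mul]
      · simp
      · intro j _
        rw [hV0 v hv _ _ (hinlU _ _), mul_zero]
    refine Subtype.ext ?_
    change v.1 = 0
    ext i j
    by_cases hij : rowP i ∧ colU j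
    · rcases i with i | i <;> rcases j with j | j
      · exact hij.2.elim
      · rcases hij.2 with hj | ⟨k, rfl⟩
        · have h1 := hEv (.inr j) (.inr (b i)) (h.T_rel _ _ hj)
          rw [Matrix.sub_apply, Matrix.mul_apply, Matrix.mul_apply,
            Finset.sum_eq_single (.inl i), hF.one, if_pos rfl, one_mul,
            Finset.sum_eq_zero, sub_zero] at h1
          · exact h1
          · intro m _
            rw [hV0 v hv _ _ (hbP _ _), zero_mul]
          · rintro (m | m) - hm
            · rw [hF.one, if_neg fun hc => hm (by rw [hc]), zero_mul]
            · rw [hV0 v hv (.inr m) _ fun hc => h.or m _ hc.1 hj, mul_zero]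
          · simp
        · exact hb _ _ hij.1
      · exact hij.2.elim
      · rcases hij.2 with hj | ⟨k, rfl⟩
        · exact absurd hj (h.or _ _ hij.1)
        · exact hb _ _ hij.1
    · exact hV0 v hv _ _ hij

end IsReduction

end Reduction

section Reduction

variable {κ ι : Type*} [Fintype κ] [Fintype ι] [DecidableEq κ] [DecidableEq ι]
  {b : κ → ι} {S T : ι → Prop} {R : κ ⊕ ι → κ ⊕ ι → Prop} {R' : ι → ι → Prop}

theorem finite_det_add_smul_one_eq_zero (M : Matrix κ κ ℂ) :
    {t : ℂ | ¬ (M + t • 1).det ≠ 0}.Finite := by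
  refine (Polynomial.finite_setOfPred_isRoot (-M).charpoly_monic.ne_zero).subset fun t ht => ?_
  rw [Set.mem_ofPred_eq, not_not] at ht
  rw [Set.mem_ofPred_eq, Polynomial.IsRoot, Matrix.eval_charpoly, sub_neg_eq_add, add_comm]
  convert ht using 3
  ext i j
  simp [Matrix.scalar_apply, Matrix.diagonal_apply, Matrix.one_apply]

namespace IsReduction

variable (h : IsReduction R R' b S T)
include h

/-- The identity block serves as a pivot: conjugation by a unipotent `1 + n` of the algebra clears
the remaining entries dual to the ideal. -/
theorem exists_standard_of_one (F : Matrix (κ ⊕ ι) (κ ⊕ ι) ℂ)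
    (hF : ∀ k l, F (.inr (b l)) (.inl k) = if l = k then 1 else 0) :
    ∃ G, IsStandard b S T G ∧ stabDim R G = stabDim R F := by
  classical
  let n : Matrix (κ ⊕ ι) (κ ⊕ ι) ℂ := fromBlocks 0
    (of fun k s => if S s then - F (.inr (b k)) (.inr s) else 0) 0
    (of fun t j => if T t then ∑ k, if b k = j then F (.inr t) (.inl k) else 0 else 0)
  have hinl (i : κ ⊕ ι) (k : κ) : n i (.inl k) = 0 := by rcases i with i | i <;> rfl
  have h12 (k : κ) (s : ι) : n (.inl k) (.inr s) = if S s then - F (.inr (b k)) (.inr s) else 0 :=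
    rfl
  have h22 (t j : ι) : n (.inr t) (.inr j) =
      if T t then ∑ k, if b k = j then F (.inr t) (.inl k) else 0 else 0 := rfl
  have h22b (t : ι) (k : κ) (ht : T t) : n (.inr t) (.inr (b k)) = F (.inr t) (.inl k) := by
    rw [h22, if_pos ht]
    simp [h.inj.eq_iff]
  have h22' (t j : ι) (hj : j ∉ Set.range b) : n (.inr t) (.inr j) = 0 := by
    rw [h22]
    split_ifs
    · exact Finset.sum_eq_zero fun k _ => if_neg fun hk => hj ⟨k, hk⟩
    · rfl
  have hnT (t : ι) (j : κ ⊕ ι) (ht : ¬ T t) : n (.inr t) j = 0 := by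
    rcases j with j | j
    · rfl
    · rw [h22, if_neg ht]
  have hST (i : ι) (hi : S i) : i ∉ Set.range b := by
    rintro ⟨k, rfl⟩
    exact h.not_S _ hi
  -- The nonzero rows of `n` are in `κ ∪ T` and its nonzero columns in `S ∪ b(κ)`, which are
  -- disjoint. So `1 - n` is the inverse of `1 + n`.
  have hsq : n * n = 0 := by
    ext i j
    rw [Matrix.mul_apply]
    refine Finset.sum_eq_zero ?_
    rintro (m | m) -
    · rw [hinl, zero_mul]
    · by_cases hm : T m
      · rcases i with i | i
        · rw [h12, if_neg fun hs => h.or _ _ hs hm, zero_mul]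
        · rw [h22', zero_mul]
          rintro ⟨k, rfl⟩
          exact h.not_T _ hm
      · rw [hnT _ _ hm, mul_zero]
  have hn : n ∈ incidence R := by
    rintro (i | i) (j | j) hij
    · rfl
    · rw [h12, if_neg fun hs => hij ((h.inl_inr _ _).2 (.inl hs))]
    · rfl
    · rw [h22]
      split_ifs with ht
      · refine Finset.sum_eq_zero fun k _ => if_neg ?_
        rintro rfl
        exact hij (h.T_rel _ _ ht)
      · rfl
  have h1 : (1 : Matrix (κ ⊕ ι) (κ ⊕ ι) ℂ) ∈ incidence R := by
    intro i j hij
    rw [one_apply_ne]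
    rintro rfl
    exact hij (h.refl _)
  refine ⟨(1 - n) * F * (1 + n), ?_, stabDim_conj h.trans (add_mem h1 hn) (sub_mem h1 hn)
    (by rw [show (1 + n) * (1 - n) = 1 - n * n by noncomm_ring, hsq, sub_zero]) F⟩
  have hexp (j i : κ ⊕ ι) : ((1 - n) * F * (1 + n)) j i =
      F j i + (F * n) j i - (n * F) j i - (n * (F * n)) j i := by
    rw [show (1 - n) * F * (1 + n) = F + F * n - n * F - n * (F * n) by noncomm_ring]
    rfl
  have hFn (j : κ ⊕ ι) (k : κ) : (F * n) j (.inl k) = 0 := by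
    rw [Matrix.mul_apply]
    exact Finset.sum_eq_zero fun m _ => by rw [hinl, mul_zero]
  have hnF (A : Matrix (κ ⊕ ι) (κ ⊕ ι) ℂ) (t : ι) (i : κ ⊕ ι) (ht : ¬ T t) :
      (n * A) (.inr t) i = 0 := by
    rw [Matrix.mul_apply]
    exact Finset.sum_eq_zero fun m _ => by rw [hnT _ _ ht, zero_mul]
  have hnFn (j : κ ⊕ ι) (k : κ) : (n * (F * n)) j (.inl k) = 0 := by
    rw [Matrix.mul_apply]
    exact Finset.sum_eq_zero fun m _ => by rw [hFn, mul_zero]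
  refine ⟨fun k l => ?_, fun k t ht => ?_, fun k s hs => ?_⟩
  · rw [hexp, hFn, hnF _ _ _ (h.not_T _), hnFn, hF]
    simp
  · rw [hexp, hFn, hnFn, Matrix.mul_apply, Finset.sum_eq_single (.inr (b k)), h22b _ _ ht, hF]
    · simp
    · rintro (m | m) - hm
      · rw [hinl, zero_mul]
      · by_cases hm' : m ∈ Set.range b
        · obtain ⟨l, rfl⟩ := hm'
          rw [hF, if_neg fun hc => hm (by rw [hc]), mul_zero]
        · rw [h22' _ _ hm', zero_mul]
    · simp
  · rw [hexp, hnF _ _ _ (h.not_T _), hnF _ _ _ (h.not_T _), Matrix.mul_apply,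
      Finset.sum_eq_single (.inl k), h12, if_pos hs, hF]
    · simp
    · rintro (m | m) - hm
      · rw [hF, if_neg fun hc => hm (by rw [hc]), zero_mul]
      · rw [h22' _ _ (hST _ hs), mul_zero]
    · simp

/-- Moving `F` along a line makes its block `M` on `b(κ) × κ` invertible without enlarging the
stabilizer. Conjugation by a matrix of the algebra acting on `κ` turns this block into the identity.
-/
theorem exists_standard (F : Matrix (κ ⊕ ι) (κ ⊕ ι) ℂ) :
    ∃ G, IsStandard b S T G ∧ stabDim R G ≤ stabDim R F := by
  classical
  let E : Matrix (κ ⊕ ι) (κ ⊕ ι) ℂ :=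
    fromBlocks 0 0 (of fun j k => if j = b k then 1 else 0) 0
  let M (A : Matrix (κ ⊕ ι) (κ ⊕ ι) ℂ) : Matrix κ κ ℂ := of fun l k => A (.inr (b l)) (.inl k)
  have hM (t : ℂ) : M (F + t • E) = M F + t • 1 := by
    ext l k
    change F _ _ + t * (if b l = b k then 1 else 0) = F _ _ + t * (1 : Matrix κ κ ℂ) l k
    simp only [Matrix.one_apply, h.inj.eq_iff]
  obtain ⟨t, ht, hle⟩ := exists_stabDim_le R F E (fun t => (M F + t • 1).det ≠ 0)
    (finite_det_add_smul_one_eq_zero _)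
  rw [← hM] at ht
  set A := F + t • E with hA
  have hunit : IsUnit (M A).det := isUnit_iff_ne_zero.2 ht
  have hmem (B : Matrix κ κ ℂ) : (fromBlocks B 0 0 1 : Matrix (κ ⊕ ι) (κ ⊕ ι) ℂ) ∈ incidence R := by
    rintro (i | i) (j | j) hij
    · exact absurd (h.inl_inl _ _) hij
    · rfl
    · rfl
    · change (1 : Matrix ι ι ℂ) i j = 0
      rw [one_apply_ne]
      rintro rfl
      exact hij (h.refl _)
  have hconj := stabDim_conj h.trans (hmem (M A)⁻¹) (hmem (M A)) (by
    rw [fromBlocks_multiply, Matrix.nonsing_inv_mul _ hunit]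
    simp [← fromBlocks_one]) A
  obtain ⟨G, hG, hGA⟩ := h.exists_standard_of_one
    (fromBlocks (M A) 0 0 1 * A * fromBlocks (M A)⁻¹ 0 0 1) (by
      intro k l
      have h1 : (fromBlocks (M A) 0 0 1 * A * fromBlocks (M A)⁻¹ 0 0 1 :
          Matrix (κ ⊕ ι) (κ ⊕ ι) ℂ) (.inr (b l)) (.inl k) =
          (M A * (M A)⁻¹) l k := by
        conv_lhs => rw [← fromBlocks_toBlocks A]
        rw [fromBlocks_multiply, fromBlocks_multiply]
        simp only [Matrix.zero_mul, Matrix.one_mul, Matrix.mul_zero, zero_add, add_zero,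
          fromBlocks_apply₂₁]
        rfl
      rw [h1, Matrix.mul_nonsing_inv _ hunit, Matrix.one_apply])
  exact ⟨G, hG, by rw [hGA, hconj]; exact hle⟩

theorem exists_lift [DecidablePred S] (F' : Matrix ι ι ℂ) :
    ∃ F, IsStandard b S T F ∧
      ∀ z ∈ incidence R', trace (F * spread b S z) = trace (F' * z) := by
  classical
  let F : Matrix (κ ⊕ ι) (κ ⊕ ι) ℂ := fromBlocks 0
    (of fun k i => if S i then F' (b k) i else 0) (of fun j k => if j = b k then 1 else 0)
    (of fun j i => if S i ∧ ¬ S j then 0 else F' j i)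
  refine ⟨F, ⟨fun k l => ?_, fun k t ht => ?_, fun k s hs => ?_⟩, fun z hz => ?_⟩
  · change (if b l = b k then (1 : ℂ) else 0) = _
    simp only [h.inj.eq_iff]
  · change (if t = b k then (1 : ℂ) else 0) = _
    rw [if_neg]
    rintro rfl
    exact h.not_T _ ht
  · change (if S s ∧ ¬ S (b k) then 0 else F' (b k) s) = 0
    rw [if_pos ⟨hs, h.not_S _⟩]
  · rw [trace_mul_comm, trace_mul_comm F', trace, trace, Fintype.sum_sum_type]
    simp only [diag_apply, Matrix.mul_apply, Fintype.sum_sum_type]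
    have h1 : ∀ k, ∑ l, spread b S z (.inl k) (.inl l) * F (.inl l) (.inl k) +
        ∑ j, spread b S z (.inl k) (.inr j) * F (.inr j) (.inl k) = 0 := by
      intro k
      simp only [F, fromBlocks_apply₁₁, Matrix.zero_apply, mul_zero, spread_inl_inr, zero_mul,
        Finset.sum_const_zero, add_zero]
    rw [Finset.sum_congr rfl fun k _ => h1 k, Finset.sum_const_zero, zero_add]
    refine Finset.sum_congr rfl fun i _ => ?_
    simp only [F, fromBlocks_apply₁₂, fromBlocks_apply₂₂, of_apply, spread_inr_inl,
      spread_inr_inr]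
    by_cases hi : S i
    · simp only [hi, if_true, true_and]
      have h2 : ∑ k, z i (b k) * F' (b k) i = ∑ j, if S j then 0 else z i j * F' j i := by
        refine Fintype.sum_of_injective b h.inj _ _ (fun j hj => ?_) fun k => ?_
        · split_ifs with hS
          · rfl
          · rw [hz, zero_mul]
            intro hR
            rcases (h.row _ _ hi).1 ((h.rel_iff _ _).1 hR).1 with h3 | h3 | h3
            exacts [hS h3, h.or _ _ hi h3, hj h3]
        · rw [if_neg (h.not_S k)]
      rw [h2, ← Finset.sum_add_distrib]
      refine Finset.sum_congr rfl fun j _ => ?_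
      by_cases hj : S j <;> simp [hj]
    · simp [hi]

/-- An optimal form for `R'` lifts to a standard one, which attains `m`. Any form for `R` is
replaced by a standard one with no larger stabilizer, which descends to `R'`; this gives the lower
bound. -/
theorem hasIndex {m : ℕ} (hm : HasIndex R' m) : HasIndex R m := by
  classical
  obtain ⟨⟨F', hF'⟩, hmin⟩ := hm
  refine ⟨?_, fun F => ?_⟩
  · obtain ⟨F, hF, hFF'⟩ := h.exists_lift F'
    exact ⟨F, (h.stabDim_eq hF hFF').trans hF'⟩
  · obtain ⟨G, hG, hle⟩ := h.exists_standard F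
    obtain ⟨G', hG'⟩ := exists_forall_eq_trace
      (traceLinearMap (κ ⊕ ι) ℂ ℂ ∘ₗ LinearMap.mulLeft ℂ G ∘ₗ spread b S)
    rw [h.stabDim_eq hG fun z _ => hG' z] at hle
    exact (hmin _).trans hle

end IsReduction

end Reduction

/-! ### Block reversals given by lists of sizes, and recursions for the number of orbits. -/

/-- The index of the block of the list `l` of block sizes which contains the vertex `i`. -/
def blockIdx : List ℕ → ℕ → ℕ
  | [], _ => 0
  | p :: l, i => if i < p then 0 else blockIdx l (i - p) + 1

/-- The reversal of each of the successive blocks with sizes given by a list. -/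
def blockRev : List ℕ → ℕ → ℕ
  | [], i => i
  | p :: l, i => if i < p then p - 1 - i else p + blockRev l (i - p)

theorem blockIdx_cons_lt {p i : ℕ} (l : List ℕ) (h : i < p) : blockIdx (p :: l) i = 0 := if_pos h

theorem blockIdx_cons_ge {p i : ℕ} (l : List ℕ) (h : p ≤ i) :
    blockIdx (p :: l) i = blockIdx l (i - p) + 1 := if_neg (not_lt.2 h)

theorem blockRev_cons_lt {p i : ℕ} (l : List ℕ) (h : i < p) : blockRev (p :: l) i = p - 1 - i :=
  if_pos h

theorem blockRev_cons_ge {p i : ℕ} (l : List ℕ) (h : p ≤ i) :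
    blockRev (p :: l) i = p + blockRev l (i - p) := if_neg (not_lt.2 h)

theorem blockRev_blockRev (l : List ℕ) (i : ℕ) : blockRev l (blockRev l i) = i := by
  induction l generalizing i with
  | nil => rfl
  | cons p l ih =>
    by_cases h : i < p
    · rw [blockRev_cons_lt l h, blockRev_cons_lt l (by omega)]
      omega
    · rw [blockRev_cons_ge l (i := i) (by omega), blockRev_cons_ge l (by omega),
        Nat.add_sub_cancel_left, ih]
      omega

theorem blockRev_lt (l : List ℕ) {i : ℕ} (h : i < l.sum) : blockRev l i < l.sum := by
  induction l generalizing i with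
  | nil => exact h
  | cons p l ih =>
    rw [List.sum_cons] at h ⊢
    by_cases hp : i < p
    · rw [blockRev_cons_lt l hp]
      omega
    · rw [blockRev_cons_ge l (by omega)]
      have := ih (i := i - p) (by omega)
      omega

theorem blockIdx_mono (l : List ℕ) {i j : ℕ} (h : i ≤ j) : blockIdx l i ≤ blockIdx l j := by
  induction l generalizing i j with
  | nil => exact le_rfl
  | cons p l ih =>
    by_cases hp : i < p
    · rw [blockIdx_cons_lt l hp]
      exact Nat.zero_le _
    · rw [blockIdx_cons_ge l (i := i) (by omega), blockIdx_cons_ge l (by omega)]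
      have := ih (i := i - p) (j := j - p) (by omega)
      omega

/-- The relation supporting the seaweed subalgebra of `𝔤𝔩(n)` attached to two lists of block
sizes. -/
def seaweedRel (n : ℕ) (a b : List ℕ) (i j : Fin n) : Prop :=
  blockIdx a i ≤ blockIdx a j ∧ blockIdx b j ≤ blockIdx b i

/-- The number of orbits of `σ` on `{0, …, n - 1}`. -/
noncomputable def orbitCount (n : ℕ) (σ : ℕ → ℕ) : ℕ :=
  Nat.card (Quot fun x y : Fin n => (y : ℕ) = σ x)

/-- The vertices `x, y < n` lie in the same orbit of `σ`. -/
def SameOrbit (n : ℕ) (σ : ℕ → ℕ) (x y : ℕ) : Prop :=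
  ∀ (hx : x < n) (hy : y < n), Quot.mk (fun x y : Fin n => (y : ℕ) = σ x) ⟨x, hx⟩ =
    Quot.mk (fun x y : Fin n => (y : ℕ) = σ x) ⟨y, hy⟩

namespace SameOrbit

variable {n : ℕ} {σ : ℕ → ℕ} {x y z : ℕ}

theorem of_eq (h : x = y) : SameOrbit n σ x y := by
  subst h
  exact fun _ _ => rfl

theorem step (h : y = σ x) : SameOrbit n σ x y := fun _ _ => Quot.sound h

theorem symm (h : SameOrbit n σ x y) : SameOrbit n σ y x := fun hx hy => (h hy hx).symm

/-- The bound on the middle vertex matters: the relation holds vacuously when one of its arguments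
is not below `n`. -/
theorem trans (h : SameOrbit n σ x y) (hy : y < n) (h' : SameOrbit n σ y z) :
    SameOrbit n σ x z := fun hx hz => (h hx hy).trans (h' hy hz)

end SameOrbit

theorem orbitCount_congr {n n' : ℕ} {σ σ' : ℕ → ℕ} (f g : ℕ → ℕ) (hf : ∀ x < n, f x < n')
    (hg : ∀ q < n', g q < n) (hfσ : ∀ x < n, σ x < n → SameOrbit n' σ' (f x) (f (σ x)))
    (hgσ : ∀ q < n', σ' q < n' → SameOrbit n σ (g q) (g (σ' q)))
    (hgf : ∀ x < n, SameOrbit n σ (g (f x)) x) (hfg : ∀ q < n', SameOrbit n' σ' (f (g q)) q) :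
    orbitCount n σ = orbitCount n' σ' := by
  refine Nat.card_congr ⟨Quot.lift (fun x => Quot.mk _ ⟨f x, hf x x.2⟩) ?_,
    Quot.lift (fun q => Quot.mk _ ⟨g q, hg q q.2⟩) ?_, ?_, ?_⟩
  · intro x y hxy
    have hy := y.2
    rw [hxy] at hy
    have := hfσ x x.2 hy (hf _ x.2) (hf _ hy)
    simpa only [hxy] using this
  · intro x y hxy
    have hy := y.2
    rw [hxy] at hy
    have := hgσ x x.2 hy (hg _ x.2) (hg _ hy)
    simpa only [hxy] using this
  · rintro ⟨x⟩
    exact hgf x x.2 _ _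
  · rintro ⟨x⟩
    exact hfg x x.2 _ _

/-- The permutation `θ_a ∘ θ_b`. -/
def seaweedPerm (a b : List ℕ) (x : ℕ) : ℕ := blockRev a (blockRev b x)

/-- Either involution conjugates one product into the other. -/
theorem orbitCount_swap {n : ℕ} {a b : List ℕ} (ha : a.sum = n) (hb : b.sum = n) :
    orbitCount n (seaweedPerm a b) = orbitCount n (seaweedPerm b a) := by
  have hat {x : ℕ} (hx : x < n) : blockRev a x < n := ha ▸ blockRev_lt a (ha.symm ▸ hx)
  have hbt {x : ℕ} (hx : x < n) : blockRev b x < n := hb ▸ blockRev_lt b (hb.symm ▸ hx)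
  refine orbitCount_congr (blockRev b) (blockRev a) (fun x hx => hbt hx) (fun x hx => hat hx)
    (fun x _ _ => .step rfl) (fun x _ _ => .step rfl) (fun x _ => .symm (.step rfl))
    (fun x _ => .symm (.step rfl))

/-- The two reversals cancel on the common first block, which consists of `p` fixed points. -/
theorem orbitCount_equal {n p : ℕ} {a b : List ℕ} (ha : a.sum = n) (hb : b.sum = n) :
    orbitCount (p + n) (seaweedPerm (p :: a) (p :: b)) = p + orbitCount n (seaweedPerm a b) := by
  have hlt {x : ℕ} (hx : x < p) : seaweedPerm (p :: a) (p :: b) x = x := by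
    rw [seaweedPerm, blockRev_cons_lt b hx, blockRev_cons_lt a (by omega)]
    omega
  have hge {x : ℕ} (hx : p ≤ x) :
      seaweedPerm (p :: a) (p :: b) x = p + seaweedPerm a b (x - p) := by
    rw [seaweedPerm, blockRev_cons_ge b hx, blockRev_cons_ge a (by omega),
      Nat.add_sub_cancel_left, seaweedPerm]
  let f : Fin (p + n) → Fin p ⊕ Quot fun x y : Fin n => (y : ℕ) = seaweedPerm a b x :=
    fun x => if h : (x : ℕ) < p then .inl ⟨x, h⟩ else .inr (Quot.mk _ ⟨x - p, by omega⟩)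
  let g : Fin p ⊕ (Quot fun x y : Fin n => (y : ℕ) = seaweedPerm a b x) →
      Quot fun x y : Fin (p + n) => (y : ℕ) = seaweedPerm (p :: a) (p :: b) x :=
    Sum.elim (fun x => Quot.mk _ ⟨x, by omega⟩)
      (Quot.lift (fun x => Quot.mk _ ⟨p + x, by omega⟩) (by
      intro x y hxy
      refine Quot.sound ?_
      change p + (y : ℕ) = _
      rw [hge (Nat.le_add_right _ _), Nat.add_sub_cancel_left, hxy]))
  rw [orbitCount, orbitCount]
  refine (Nat.card_congr ⟨Quot.lift f ?_, g, ?_, ?_⟩).trans ?_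
  · intro x y hxy
    by_cases hx : (x : ℕ) < p
    · rw [hlt hx] at hxy
      rw [Fin.ext hxy]
    · have hy := hge (not_lt.1 hx)
      rw [← hxy] at hy
      simp only [f, dif_neg hx, dif_neg (show ¬ (y : ℕ) < p by omega)]
      refine congrArg _ (Quot.sound ?_)
      change (y : ℕ) - p = _
      rw [hy, Nat.add_sub_cancel_left]
  · rintro ⟨x⟩
    change g (f x) = _
    by_cases hx : (x : ℕ) < p
    · simp only [f, dif_pos hx]
      rfl
    · simp only [f, dif_neg hx]
      refine congrArg (Quot.mk _) (Fin.ext ?_)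
      change p + ((x : ℕ) - p) = x
      omega
  · rintro (x | ⟨⟨x⟩⟩)
    · change f _ = _
      simp only [f, dif_pos x.2]
    · change f _ = _
      simp [f]
  · rw [Nat.card_sum]
    simp

/-- After a shift by `p`, the permutation on the right is the first return map of the one on the
left to the vertices `≥ p`. A vertex `x < p` is sent to its successor. -/
theorem orbitCount_short {n p t : ℕ} {a b : List ℕ} (ha : a.sum = n) (hb : t + p + b.sum = n) :
    orbitCount (p + n) (seaweedPerm (p :: a) ((p + t + p) :: b)) =
      orbitCount n (seaweedPerm a (t :: p :: b)) := by
  have hat {x : ℕ} (hx : x < n) : blockRev a x < n := ha ▸ blockRev_lt a (ha.symm ▸ hx)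
  have h1 {x : ℕ} (hx : x < p) :
      seaweedPerm (p :: a) ((p + t + p) :: b) x = p + blockRev a (t + p - 1 - x) := by
    rw [seaweedPerm, blockRev_cons_lt b (by omega), blockRev_cons_ge a (by omega)]
    congr 2
    omega
  have h2 {q : ℕ} (hq : q < t ∨ t + p ≤ q) :
      seaweedPerm (p :: a) ((p + t + p) :: b) (q + p) = seaweedPerm a (t :: p :: b) q + p := by
    rcases hq with hq | hq
    · rw [seaweedPerm, seaweedPerm, blockRev_cons_lt b (by omega), blockRev_cons_lt _ hq,
        blockRev_cons_ge a (by omega), add_comm]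
      congr 2
      omega
    · rw [seaweedPerm, seaweedPerm, blockRev_cons_ge b (by omega),
        blockRev_cons_ge (p :: b) (show t ≤ q by omega),
        blockRev_cons_ge b (show p ≤ q - t by omega), blockRev_cons_ge a (by omega), add_comm,
        show q + p - (p + t + p) = q - t - p by omega]
      congr 2
      omega
  have h3 {q : ℕ} (hq : t ≤ q) (hq' : q < t + p) :
      seaweedPerm (p :: a) ((p + t + p) :: b) (q + p) = q - t := by
    rw [seaweedPerm, blockRev_cons_lt b (by omega), blockRev_cons_lt a (by omega)]
    omega
  have h4 {q : ℕ} (hq : t ≤ q) (hq' : q < t + p) :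
      seaweedPerm a (t :: p :: b) q = blockRev a (t + p - 1 - (q - t)) := by
    rw [seaweedPerm, blockRev_cons_ge _ hq, blockRev_cons_lt _ (by omega)]
    congr 1
    omega
  have hfx {x : ℕ} (hx : x < p) : t + p - 1 - x < n := by omega
  refine orbitCount_congr (fun x => if x < p then blockRev a (t + p - 1 - x) else x - p)
    (fun q => q + p) ?_ ?_ ?_ ?_ ?_ ?_
  · intro x hx
    split_ifs with h
    · exact hat (hfx h)
    · omega
  · intro q hq
    omega
  · intro x hx hσ
    by_cases hp : x < p
    · rw [h1 hp, if_pos hp, if_neg (by omega), Nat.add_sub_cancel_left]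
      exact .of_eq rfl
    · obtain ⟨q, rfl⟩ : ∃ q, x = q + p := ⟨x - p, by omega⟩
      rw [if_neg hp, Nat.add_sub_cancel]
      by_cases hq : q < t ∨ t + p ≤ q
      · rw [h2 hq, if_neg (by omega), Nat.add_sub_cancel]
        exact .step rfl
      · rw [h3 (by omega) (by omega), if_pos (by omega), ← h4 (by omega) (by omega)]
        exact .step rfl
  · intro q hq _
    by_cases hq : q < t ∨ t + p ≤ q
    · exact .step (h2 hq).symm
    · refine .trans (.step (h3 (q := q) (by omega) (by omega)).symm) (by omega) (.step ?_)
      rw [h1 (by omega), h4 (by omega) (by omega), add_comm]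
  · intro x hx
    split_ifs with h
    · refine .symm (.step ?_)
      rw [h1 h, add_comm]
    · exact .of_eq (by omega)
  · intro q hq
    rw [if_neg (by omega)]
    exact .of_eq (by omega)

/-- The vertices are transported by the reversal of `(s + u) :: a`, which inverts the permutation,
and then `y` and `y + u` are identified for `s ≤ y < s + u`. These two are consecutive in their
orbit, so no orbits are merged. -/
theorem orbitCount_long {n s u : ℕ} {a b : List ℕ} (ha : s + a.sum = n) (hb : s + u + b.sum = n) :
    orbitCount (n + u) (seaweedPerm ((s + u) :: a) ((s + u + u) :: b)) =
      orbitCount n (seaweedPerm (s :: a) ((s + u) :: b)) := by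
  have hat {x : ℕ} (hx : x < n - s) : blockRev a x < n - s := by
    have := blockRev_lt a (i := x) (by omega)
    omega
  have hbt {x : ℕ} (hx : x < n - s - u) : blockRev b x < n - s - u := by
    have := blockRev_lt b (i := x) (by omega)
    omega
  have h1 {x : ℕ} (hx : x < u) : seaweedPerm ((s + u) :: a) ((s + u + u) :: b) x =
      s + u + blockRev a (u - 1 - x) := by
    rw [seaweedPerm, blockRev_cons_lt b (by omega), blockRev_cons_ge a (by omega)]
    congr 2
    omega
  have h2 {x : ℕ} (hx : u ≤ x) (hx' : x < s + u + u) :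
      seaweedPerm ((s + u) :: a) ((s + u + u) :: b) x = x - u := by
    rw [seaweedPerm, blockRev_cons_lt b (by omega), blockRev_cons_lt a (by omega)]
    omega
  have h3 {x : ℕ} (hx : s + u + u ≤ x) :
      seaweedPerm ((s + u) :: a) ((s + u + u) :: b) x =
        s + u + blockRev a (u + blockRev b (x - (s + u + u))) := by
    rw [seaweedPerm, blockRev_cons_ge b (by omega), blockRev_cons_ge a (by omega)]
    congr 2
    omega
  have h4 {q : ℕ} (hq : u ≤ q) (hq' : q < s + u) :
      seaweedPerm (s :: a) ((s + u) :: b) q = q - u := by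
    rw [seaweedPerm, blockRev_cons_lt b (by omega), blockRev_cons_lt a (by omega)]
    omega
  have h5 {q : ℕ} (hq : q < u) :
      seaweedPerm (s :: a) ((s + u) :: b) q = s + blockRev a (u - 1 - q) := by
    rw [seaweedPerm, blockRev_cons_lt b (by omega), blockRev_cons_ge a (by omega)]
    congr 2
    omega
  have h6 {q : ℕ} (hq : s + u ≤ q) :
      seaweedPerm (s :: a) ((s + u) :: b) q = s + blockRev a (u + blockRev b (q - (s + u))) := by
    rw [seaweedPerm, blockRev_cons_ge b (by omega), blockRev_cons_ge a (by omega)]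
    congr 2
    omega
  have hf1 {x : ℕ} (hx : x < s + u) : blockRev ((s + u) :: a) x = s + u - 1 - x :=
    blockRev_cons_lt a hx
  refine orbitCount_congr
    (fun x => if x < s + u then s + u - 1 - x else s + blockRev a (x - (s + u)))
    (fun q => if q < s then s + u - 1 - q else s + u + blockRev a (q - s)) ?_ ?_ ?_ ?_ ?_ ?_
  · intro x hx
    split_ifs with h
    · omega
    · have := hat (x := x - (s + u)) (by omega)
      omega
  · intro q hq
    split_ifs with h
    · omega
    · have := hat (x := q - s) (by omega)
      omega
  · intro x hx hσ
    by_cases hu : x < u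
    · rw [h1 hu, if_pos (by omega), if_neg (by omega), Nat.add_sub_cancel_left,
        blockRev_blockRev]
      exact .of_eq (by omega)
    by_cases hm : x < s + u + u
    · rw [h2 (by omega) hm, if_pos (show x - u < s + u by omega)]
      refine .symm (.step ?_)
      by_cases hxp : x < s + u
      · rw [if_pos hxp, h4 (by omega) (by omega)]
        omega
      · rw [if_neg hxp, h5 (by omega)]
        congr 2
        omega
    · rw [h3 (by omega), if_neg (by omega), if_neg (by omega), Nat.add_sub_cancel_left,
        blockRev_blockRev]
      refine .symm (.step ?_)
      rw [h6 (by omega), show s + (u + blockRev b (x - (s + u + u))) - (s + u) =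
        blockRev b (x - (s + u + u)) by omega, blockRev_blockRev]
      congr 2
      omega
  · intro q hq _
    have hlast : s ≤ q → q < s + u →
        SameOrbit (n + u) (seaweedPerm ((s + u) :: a) ((s + u + u) :: b)) (s + u - 1 - q)
          (s + u + blockRev a (q - s)) := by
      intro hs hq'
      refine .step ?_
      rw [h1 (by omega)]
      congr 2
      omega
    have hcase : q < s + u → SameOrbit (n + u) (seaweedPerm ((s + u) :: a) ((s + u + u) :: b))
        (if q < s then s + u - 1 - q else s + u + blockRev a (q - s)) (s + u - 1 - q) := by
      intro hq'
      split_ifs with hs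
      · exact .of_eq rfl
      · exact (hlast (by omega) hq').symm
    by_cases hqp : q < s + u
    · refine (hcase hqp).trans (by omega) (.symm ?_)
      by_cases hqu : u ≤ q
      · rw [h4 hqu hqp, if_pos (by omega)]
        refine .step ?_
        rw [h2 (by omega) (by omega)]
        omega
      · rw [h5 (by omega), if_neg (by omega), Nat.add_sub_cancel_left, blockRev_blockRev]
        refine .step ?_
        rw [h2 (by omega) (by omega)]
        omega
    · rw [if_neg (by omega), h6 (by omega), if_neg (by omega), Nat.add_sub_cancel_left,
        blockRev_blockRev]
      refine .symm (.step ?_)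
      rw [h3 (by omega), show s + u + (u + blockRev b (q - (s + u))) - (s + u + u) =
        blockRev b (q - (s + u)) by omega, blockRev_blockRev]
      congr 2
      omega
  · intro x hx
    by_cases hxu : x < u
    · rw [if_pos (show x < s + u by omega), if_neg (by omega)]
      refine .symm (.step ?_)
      rw [h1 hxu]
      congr 2
      omega
    by_cases hxp : x < s + u
    · rw [if_pos hxp, if_pos (by omega)]
      exact .of_eq (by omega)
    · rw [if_neg hxp, if_neg (by omega), Nat.add_sub_cancel_left, blockRev_blockRev]
      exact .of_eq (by omega)
  · intro q hq
    by_cases hqs : q < s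
    · rw [if_pos hqs, if_pos (by omega)]
      exact .of_eq (by omega)
    · rw [if_neg hqs, if_neg (by omega), Nat.add_sub_cancel_left, blockRev_blockRev]
      exact .of_eq (by omega)

/-! ### The index of seaweed algebras. -/

theorem hasIndex_of_isEmpty {ι : Type*} [Fintype ι] [IsEmpty ι] (R : ι → ι → Prop) :
    HasIndex R 0 := by
  refine ⟨⟨0, ?_⟩, fun _ => Nat.zero_le _⟩
  have : Subsingleton (LinearMap.ker (incidenceForm R 0)) :=
    ⟨fun x y => Subtype.ext (Subtype.ext (Subsingleton.elim _ _))⟩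
  exact Module.finrank_zero_of_subsingleton

theorem hasIndex_seaweed_equal {n p m : ℕ} {a b : List ℕ} (h : HasIndex (seaweedRel n a b) m) :
    HasIndex (seaweedRel (p + n) (p :: a) (p :: b)) (p + m) := by
  refine (HasIndex.sum (Q := fun x y => seaweedRel (p + n) (p :: a) (p :: b)
    (finSumFinEquiv x) (finSumFinEquiv y)) ?_ ?_ ?_ ?_ (hasIndex_top p) h).reindex
    finSumFinEquiv fun _ _ => Iff.rfl
  all_goals intro i j
  all_goals simp only [seaweedRel, finSumFinEquiv_apply_left, finSumFinEquiv_apply_right,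
    Fin.val_castAdd, Fin.val_natAdd]
  · simp [blockIdx_cons_lt _ i.2, blockIdx_cons_lt _ j.2]
  · simp [blockIdx_cons_ge _ (Nat.le_add_right p _)]
  · simp [blockIdx_cons_ge _ (Nat.le_add_right p _), blockIdx_cons_lt _ i.2]
  · simp [blockIdx_cons_ge _ (Nat.le_add_right p _), blockIdx_cons_lt _ j.2]

theorem seaweedRel_trans {n : ℕ} {a b : List ℕ} (i j k : Fin n) (h : seaweedRel n a b i j)
    (h' : seaweedRel n a b j k) : seaweedRel n a b i k :=
  ⟨h.1.trans h'.1, h'.2.trans h.2⟩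

/-- Here `κ` is the set of the first `p` indices, `S` is empty, `T` consists of the next `t` indices
and `b(κ)` of the `p` after those. Dropping the entries `T × b(κ)` cuts the remaining block of size
`t + p` into `t` and `p`. -/
theorem hasIndex_seaweed_short {n p t m : ℕ} {a b : List ℕ} (hb : t + p + b.sum = n)
    (h : HasIndex (seaweedRel n a (t :: p :: b)) m) :
    HasIndex (seaweedRel (p + n) (p :: a) ((p + t + p) :: b)) m := by
  have hidx {q : ℕ} (hq : q < t + p) : blockIdx ((p + t + p) :: b) (p + q) = 0 :=
    blockIdx_cons_lt b (by omega)
  have hidx' {q : ℕ} (hq : t + p ≤ q) :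
      blockIdx ((p + t + p) :: b) (p + q) = blockIdx b (q - t - p) + 1 := by
    rw [blockIdx_cons_ge b (by omega)]
    congr 2
    omega
  have hnew {q : ℕ} (hq : q < t) : blockIdx (t :: p :: b) q = 0 := blockIdx_cons_lt _ hq
  have hnew' {q : ℕ} (hq : t ≤ q) (hq' : q < t + p) : blockIdx (t :: p :: b) q = 1 := by
    rw [blockIdx_cons_ge _ hq, blockIdx_cons_lt _ (by omega)]
  have hnew'' {q : ℕ} (hq : t + p ≤ q) :
      blockIdx (t :: p :: b) q = blockIdx b (q - t - p) + 2 := by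
    rw [blockIdx_cons_ge _ (by omega), blockIdx_cons_ge _ (by omega)]
  have hP {k : ℕ} (l : List ℕ) (hk : k < p) : blockIdx (p :: l) k = 0 := blockIdx_cons_lt l hk
  have hP' (q : ℕ) : blockIdx (p :: a) (p + q) = blockIdx a q + 1 := by
    rw [blockIdx_cons_ge a (by omega), Nat.add_sub_cancel_left]
  have hB {k : ℕ} (hk : k < p) : blockIdx ((p + t + p) :: b) k = 0 := blockIdx_cons_lt b (by omega)
  let β : Fin p → Fin n := fun k => ⟨t + k, by omega⟩
  have hβ (j : Fin n) : j ∈ Set.range β ↔ t ≤ j ∧ (j : ℕ) < t + p := by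
    constructor
    · rintro ⟨k, rfl⟩
      exact ⟨Nat.le_add_right _ _, Nat.add_lt_add_left k.2 _⟩
    · rintro ⟨h1, h2⟩
      exact ⟨⟨j - t, by omega⟩, Fin.ext (Nat.add_sub_of_le h1)⟩
  have hred : IsReduction (fun x y : Fin p ⊕ Fin n =>
      seaweedRel (p + n) (p :: a) ((p + t + p) :: b) (finSumFinEquiv x) (finSumFinEquiv y))
      (seaweedRel n a (t :: p :: b)) β (fun _ => False) (fun j => (j : ℕ) < t) := by
    refine ⟨fun k l hkl => ?_, fun i => ⟨le_rfl, le_rfl⟩, fun i j k => seaweedRel_trans _ _ _,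
      ?_, ?_, ?_, ?_, ?_, ?_, ?_, ?_, ?_, ?_, ?_⟩
    · have := congrArg Fin.val hkl
      simp only [β] at this
      exact Fin.ext (by omega)
    all_goals try simp only [seaweedRel, finSumFinEquiv_apply_left, finSumFinEquiv_apply_right,
      Fin.val_castAdd, Fin.val_natAdd, hβ, hP', false_or]
    · intro k l
      simp [hP _ k.2, hP _ l.2, hB k.2, hB l.2]
    · intro k j
      rw [hP _ k.2, hB k.2]
      by_cases hj : (j : ℕ) < t + p
      · rw [hidx hj]
        simp
        omega
      · rw [hidx' (by omega)]
        simp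
        omega
    · intro i k
      rw [hP _ k.2]
      simp
    · exact fun _ _ => False.elim
    · exact fun _ _ _ => id
    · rintro i j hi ⟨-, hij⟩
      rw [hidx (q := i) (by omega)] at hij
      by_contra hj
      rw [hidx' (q := j) (by omega)] at hij
      omega
    · exact fun _ => id
    · intro k
      exact not_lt.2 (Nat.le_add_right _ _)
    · intro i k hi
      have hk : ((β k : Fin n) : ℕ) = t + k := rfl
      rw [hidx (q := i) (by omega), hidx (q := β k) (by omega)]
      exact ⟨Nat.succ_le_succ (blockIdx_mono a (by omega)), le_rfl⟩
    · exact fun _ _ => False.elim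
    · intro i j
      rcases lt_or_ge (i : ℕ) t with hi | hi
      · rw [hnew hi, hidx (q := i) (by omega)]
        rcases lt_or_ge (j : ℕ) t with hj | hj
        · rw [hnew hj, hidx (q := j) (by omega)]
          omega
        rcases lt_or_ge (j : ℕ) (t + p) with hj' | hj'
        · rw [hnew' hj hj', hidx hj']
          omega
        · rw [hnew'' hj', hidx' hj']
          omega
      rcases lt_or_ge (i : ℕ) (t + p) with hi' | hi'
      · rw [hnew' hi hi', hidx hi']
        rcases lt_or_ge (j : ℕ) t with hj | hj
        · rw [hnew hj, hidx (q := j) (by omega)]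
          omega
        rcases lt_or_ge (j : ℕ) (t + p) with hj' | hj'
        · rw [hnew' hj hj', hidx hj']
          omega
        · rw [hnew'' hj', hidx' hj']
          omega
      · rw [hnew'' hi', hidx' hi']
        rcases lt_or_ge (j : ℕ) t with hj | hj
        · rw [hnew hj, hidx (q := j) (by omega)]
          omega
        rcases lt_or_ge (j : ℕ) (t + p) with hj' | hj'
        · rw [hnew' hj hj', hidx hj']
          omega
        · rw [hnew'' hj', hidx' hj']
          omega
  exact (hred.hasIndex h).reindex finSumFinEquiv fun _ _ => Iff.rfl

/-- Here `κ` is the set of the first `u` indices, `S` consists of the next `s` indices, `b(κ)` of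
the `u` after those, and `T` is empty. No entry is dropped: the reduced relation is the restriction
to the last `n` indices. -/
theorem hasIndex_seaweed_long {n s u m : ℕ} {a b : List ℕ} (hb : s + u + b.sum = n)
    (h : HasIndex (seaweedRel n (s :: a) ((s + u) :: b)) m) :
    HasIndex (seaweedRel (u + n) ((s + u) :: a) ((s + u + u) :: b)) m := by
  have hA {q : ℕ} (hq : q < s) : blockIdx ((s + u) :: a) (u + q) = 0 :=
    blockIdx_cons_lt a (by omega)
  have hA' {q : ℕ} (hq : s ≤ q) :
      blockIdx ((s + u) :: a) (u + q) = blockIdx a (q - s) + 1 := by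
    rw [blockIdx_cons_ge a (by omega)]
    congr 2
    omega
  have hB {q : ℕ} (hq : q < s + u) : blockIdx ((s + u + u) :: b) (u + q) = 0 :=
    blockIdx_cons_lt b (by omega)
  have hB' {q : ℕ} (hq : s + u ≤ q) :
      blockIdx ((s + u + u) :: b) (u + q) = blockIdx b (q - (s + u)) + 1 := by
    rw [blockIdx_cons_ge b (by omega)]
    congr 2
    omega
  have hA0 {k : ℕ} (hk : k < u) : blockIdx ((s + u) :: a) k = 0 := blockIdx_cons_lt a (by omega)
  have hB0 {k : ℕ} (hk : k < u) : blockIdx ((s + u + u) :: b) k = 0 :=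
    blockIdx_cons_lt b (by omega)
  have hAeq (q : ℕ) : blockIdx ((s + u) :: a) (u + q) = blockIdx (s :: a) q := by
    rcases lt_or_ge q s with hq | hq
    · rw [hA hq, blockIdx_cons_lt _ hq]
    · rw [hA' hq, blockIdx_cons_ge _ hq]
  have hBeq (q : ℕ) : blockIdx ((s + u + u) :: b) (u + q) = blockIdx ((s + u) :: b) q := by
    rcases lt_or_ge q (s + u) with hq | hq
    · rw [hB hq, blockIdx_cons_lt _ hq]
    · rw [hB' hq, blockIdx_cons_ge _ hq]
  let β : Fin u → Fin n := fun k => ⟨s + k, by omega⟩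
  have hβ (j : Fin n) : j ∈ Set.range β ↔ s ≤ j ∧ (j : ℕ) < s + u := by
    constructor
    · rintro ⟨k, rfl⟩
      exact ⟨Nat.le_add_right _ _, Nat.add_lt_add_left k.2 _⟩
    · rintro ⟨h1, h2⟩
      exact ⟨⟨j - s, by omega⟩, Fin.ext (Nat.add_sub_of_le h1)⟩
  have hred : IsReduction (fun x y : Fin u ⊕ Fin n =>
      seaweedRel (u + n) ((s + u) :: a) ((s + u + u) :: b) (finSumFinEquiv x) (finSumFinEquiv y))
      (seaweedRel n (s :: a) ((s + u) :: b)) β (fun j => (j : ℕ) < s) (fun _ => False) := by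
    refine ⟨fun k l hkl => ?_, fun i => ⟨le_rfl, le_rfl⟩, fun i j k => seaweedRel_trans _ _ _,
      ?_, ?_, ?_, ?_, ?_, ?_, ?_, ?_, ?_, ?_, ?_⟩
    · have := congrArg Fin.val hkl
      simp only [β] at this
      exact Fin.ext (by omega)
    all_goals try simp only [seaweedRel, finSumFinEquiv_apply_left, finSumFinEquiv_apply_right,
      Fin.val_castAdd, Fin.val_natAdd, hβ, false_or]
    · intro k l
      simp [hA0 k.2, hA0 l.2, hB0 k.2, hB0 l.2]
    · intro k j
      rw [hA0 k.2, hB0 k.2]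
      by_cases hj : (j : ℕ) < s + u
      · rw [hB hj]
        simp
        omega
      · rw [hB' (by omega)]
        simp
        omega
    · intro i k
      rw [hA0 k.2, hB0 k.2]
      by_cases hi : (i : ℕ) < s
      · rw [hA hi]
        simp [hi]
      · rw [hA' (by omega)]
        simp [hi]
    · intro i j hi
      rw [hA hi, hB (q := i) (by omega)]
      by_cases hj : (j : ℕ) < s + u
      · rw [hB hj]
        simp
        omega
      · rw [hB' (by omega)]
        simp
        omega
    · rintro i j ⟨hij, -⟩ hj
      by_contra hi
      rw [hA hj, hA' (by omega)] at hij
      omega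
    · rintro i j hi ⟨hij, hij'⟩
      rw [hA' (q := i) (by omega)] at hij
      rw [hB (q := i) (by omega)] at hij'
      constructor
      · by_contra hj
        rw [hA (by omega)] at hij
        omega
      · by_contra hj
        rw [hB' (by omega)] at hij'
        omega
    · intro k
      exact not_lt.2 (Nat.le_add_right _ _)
    · exact fun _ => id
    · exact fun _ _ => False.elim
    · exact fun _ _ _ => id
    · intro i j
      rw [hAeq, hAeq, hBeq, hBeq]
      simp
  exact (hred.hasIndex h).reindex finSumFinEquiv fun _ _ => Iff.rfl

/-- The index of the seaweed subalgebra attached to the compositions `a` and `b` is the number of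
orbits of `θ_a ∘ θ_b`. -/
theorem hasIndex_seaweed (n : ℕ) (a b : List ℕ) (ha : a.sum = n) (hb : b.sum = n) :
    HasIndex (seaweedRel n a b) (orbitCount n (seaweedPerm a b)) := by
  -- The lengths enter the measure because a block of size `0` can arise (`t = 0`), and deleting it
  -- leaves the sums unchanged.
  induction hN : a.sum + b.sum + a.length + b.length using Nat.strong_induction_on
    generalizing n a b with
  | _ N ih =>
    subst hN
    rcases Nat.eq_zero_or_pos n with rfl | hn
    · have : orbitCount 0 (seaweedPerm a b) = 0 := by
        rw [orbitCount]
        have : IsEmpty (Quot fun x y : Fin 0 => (y : ℕ) = seaweedPerm a b x) :=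
          ⟨fun q => Quot.ind (β := fun _ => False) (fun x => x.elim0) q⟩
        exact Nat.card_of_isEmpty
      rw [this]
      exact hasIndex_of_isEmpty _
    have key : ∀ (p m : ℕ) (a' b' : List ℕ), a.sum + b.sum + a.length + b.length =
        (p :: a').sum + (m :: b').sum + (p :: a').length + (m :: b').length →
        (p :: a').sum = n → (m :: b').sum = n → p ≤ m →
        HasIndex (seaweedRel n (p :: a') (m :: b'))
          (orbitCount n (seaweedPerm (p :: a') (m :: b'))) := by
      intro p m a' b' hsize hsa hsb hpm
      simp only [List.sum_cons, List.length_cons] at hsize hsa hsb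
      rcases Nat.eq_zero_or_pos p with rfl | hp
      · have h1 := ih _ (by simp only [List.sum_cons, List.length_cons]; omega) n a' (m :: b')
          (by omega) (by rw [List.sum_cons]; omega) rfl
        have hrel : seaweedRel n (0 :: a') (m :: b') = seaweedRel n a' (m :: b') := by
          ext i j
          simp [seaweedRel, blockIdx_cons_ge a' (Nat.zero_le _)]
        have hperm : seaweedPerm (0 :: a') (m :: b') = seaweedPerm a' (m :: b') := by
          ext x
          rw [seaweedPerm, blockRev_cons_ge a' (Nat.zero_le _), Nat.sub_zero, zero_add]
          rfl
        rw [hrel, hperm]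
        exact h1
      rcases eq_or_lt_of_le hpm with rfl | hlt
      · obtain ⟨n', rfl⟩ : ∃ n', n = p + n' := ⟨n - p, by omega⟩
        rw [orbitCount_equal (by omega) (by omega)]
        exact hasIndex_seaweed_equal (ih _ (by omega) n' a' b' (by omega) (by omega) rfl)
      rcases le_or_gt (2 * p) m with h2 | h2
      · obtain ⟨n', rfl⟩ : ∃ n', n = p + n' := ⟨n - p, by omega⟩
        obtain ⟨t, rfl⟩ : ∃ t, m = p + t + p := ⟨m - 2 * p, by omega⟩
        rw [orbitCount_short (by omega) (by omega)]
        exact hasIndex_seaweed_short (by omega) (ih _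
          (by simp only [List.sum_cons, List.length_cons]; omega) n' a' (t :: p :: b') (by omega)
          (by simp only [List.sum_cons]; omega) rfl)
      · obtain ⟨u, rfl⟩ : ∃ u, m = p + u := ⟨m - p, by omega⟩
        obtain ⟨s, rfl⟩ : ∃ s, p = s + u := ⟨p - u, by omega⟩
        obtain ⟨n', rfl⟩ : ∃ n', n = n' + u := ⟨n - u, by omega⟩
        rw [orbitCount_long (by omega) (by omega), add_comm n' u]
        exact hasIndex_seaweed_long (by omega) (ih _
          (by simp only [List.sum_cons, List.length_cons]; omega) n' (s :: a') ((s + u) :: b')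
          (by simp only [List.sum_cons]; omega) (by simp only [List.sum_cons]; omega) rfl)
    cases a with
    | nil => simp at ha; omega
    | cons p a' =>
      cases b with
      | nil => simp at hb; omega
      | cons m b' =>
        rcases le_total p m with hpm | hpm
        · exact key p m a' b' rfl ha hb hpm
        · rw [orbitCount_swap ha hb]
          have := (key m p b' a' (by ring) hb ha hpm).swap
          exact this.reindex (Equiv.refl (Fin n)) fun i j =>
            ⟨fun h => ⟨h.2, h.1⟩, fun h => ⟨h.2, h.1⟩⟩

/-! ### Bad gaps and strips; the parity argument. -/

/-- `[A, B)` is one of the intervals into which the boundaries `D` cut the natural numbers. -/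
def IsBlock (D : ℕ → Prop) (A B : ℕ) : Prop :=
  D A ∧ D B ∧ A < B ∧ ∀ g, A < g → g < B → ¬ D g

/-- `θ` reverses the order of the vertices within each of the blocks of `{0, …, n - 1}` with
boundaries `D`. -/
structure IsReversal (n : ℕ) (D : ℕ → Prop) (θ : ℕ → ℕ) : Prop where
  exists_block : ∀ x < n, ∃ A B, IsBlock D A B ∧ A ≤ x ∧ x < B ∧ B ≤ n
  apply_eq : ∀ A B, IsBlock D A B → B ≤ n → ∀ x, A ≤ x → x < B → θ x = A + B - 1 - x

/-- The gaps (between `g - 1` and `g`) which are linked to a block boundary by reflections in the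
blocks. -/
inductive BadGap (n : ℕ) (D : Bool → ℕ → Prop) : ℕ → Prop
  | of_boundary (c : Bool) (g : ℕ) : D c g → g ≤ n → BadGap n D g
  | reflect (c : Bool) (g A B : ℕ) : BadGap n D g → IsBlock (D c) A B → B ≤ n → A < g → g < B →
      BadGap n D (A + B - g)

/-- The maximal intervals of vertices without bad gap. -/
structure IsStrip (n : ℕ) (D : Bool → ℕ → Prop) (l r : ℕ) : Prop where
  left : BadGap n D l
  right : BadGap n D r
  lt : l < r
  le : r ≤ n
  good : ∀ g, l < g → g < r → ¬ BadGap n D g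

/-- The vertices `x` and `y` are linked by a sequence of arcs. -/
def Linked (θ : Bool → ℕ → ℕ) (x y : ℕ) : Prop :=
  Relation.ReflTransGen (fun x y => ∃ c, y = θ c x) x y

theorem even_card_of_involution {X : Finset ℕ} (τ : ℕ → ℕ) (hτ : ∀ x ∈ X, τ x ∈ X)
    (hττ : ∀ x ∈ X, τ (τ x) = x) (hne : ∀ x ∈ X, τ x ≠ x) : Even X.card := by
  have h : ∑ _x ∈ X, (1 : ZMod 2) = 0 :=
    Finset.sum_involution (fun x _ => τ x) (fun _ _ => by decide) (fun x hx _ => hne x hx)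
      hτ hττ
  rw [Finset.sum_const, nsmul_eq_mul, mul_one, ZMod.natCast_eq_zero_iff] at h
  exact even_iff_two_dvd.2 h

theorem card_filter_lt_add (X : Finset ℕ) {u v : ℕ} (huv : u ≤ v) :
    (X.filter (· < v)).card = (X.filter (· < u)).card +
      (X.filter fun x => u ≤ x ∧ x < v).card := by
  rw [← Finset.card_union_of_disjoint]
  · congr 1
    ext x
    simp only [Finset.mem_filter, Finset.mem_union]
    constructor
    · rintro ⟨hx, hv⟩
      rcases lt_or_ge x u with h | h
      · exact .inl ⟨hx, h⟩
      · exact .inr ⟨hx, h, hv⟩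
    · rintro (⟨hx, h⟩ | ⟨hx, -, h⟩)
      · exact ⟨hx, h.trans_le huv⟩
      · exact ⟨hx, h⟩
  · rw [Finset.disjoint_filter]
    intro x _ h
    omega

open Classical in
/-- The left end of the strip of `x`. -/
noncomputable def stripLeft (n : ℕ) (D : Bool → ℕ → Prop) (x : ℕ) : ℕ :=
  Nat.findGreatest (BadGap n D) x

section Strips

variable {n : ℕ} {D : Bool → ℕ → Prop} {θ : Bool → ℕ → ℕ}

section

variable {c : Bool} (hθ : IsReversal n (D c) (θ c))
include hθ

theorem IsReversal.apply_apply {x : ℕ} (hx : x < n) : θ c (θ c x) = x := by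
  obtain ⟨A, B, hAB, h1, h2, h3⟩ := hθ.exists_block x hx
  rw [hθ.apply_eq A B hAB h3 x h1 h2, hθ.apply_eq A B hAB h3 _ (by omega) (by omega)]
  omega

theorem IsReversal.lt {x : ℕ} (hx : x < n) : θ c x < n := by
  obtain ⟨A, B, hAB, h1, h2, h3⟩ := hθ.exists_block x hx
  rw [hθ.apply_eq A B hAB h3 x h1 h2]
  omega

theorem IsReversal.badGap_zero (hn : 0 < n) : BadGap n D 0 := by
  obtain ⟨A, B, hAB, h1, h2, h3⟩ := hθ.exists_block 0 hn
  obtain rfl : A = 0 := by omega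
  exact .of_boundary c _ hAB.1 (Nat.zero_le _)

theorem IsReversal.badGap_last (hn : 0 < n) : BadGap n D n := by
  obtain ⟨A, B, hAB, h1, h2, h3⟩ := hθ.exists_block (n - 1) (by omega)
  obtain rfl : B = n := by omega
  exact .of_boundary c _ hAB.2.1 le_rfl

end

theorem IsStrip.unique {l r l' r' x : ℕ} (h : IsStrip n D l r) (h' : IsStrip n D l' r')
    (h1 : l ≤ x) (h2 : x < r) (h3 : l' ≤ x) (h4 : x < r') : l = l' ∧ r = r' := by
  have hl : ¬ l < l' := fun hc => h.good l' hc (by omega) h'.left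
  have hl' : ¬ l' < l := fun hc => h'.good l hc (by omega) h.left
  have hr : ¬ r < r' := fun hc => h'.good r (by omega) hc h.right
  have hr' : ¬ r' < r := fun hc => h.good r' (by omega) hc h'.right
  omega

theorem IsStrip.le_of_badGap {l r g : ℕ} (h : IsStrip n D l r) (hg : BadGap n D g) (hlg : l < g) :
    r ≤ g := by
  by_contra hc
  exact h.good g hlg (by omega) hg

theorem IsStrip.stripLeft_eq {l r x : ℕ} (h : IsStrip n D l r) (h1 : l ≤ x) (h2 : x < r) :
    stripLeft n D x = l := by
  classical
  rw [stripLeft]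
  exact Nat.findGreatest_eq_iff.2 ⟨h1, fun _ => h.left, fun g hg hgx => h.good g hg (by omega)⟩

/-- The image of a strip under the reversal of a block is a strip. -/
theorem IsStrip.reflect {c : Bool} {l r A B : ℕ} (h : IsStrip n D l r) (hAB : IsBlock (D c) A B)
    (hB : B ≤ n) (hA : A ≤ l) (hlB : l < B) :
    r ≤ B ∧ IsStrip n D (A + B - r) (A + B - l) := by
  have hAb : BadGap n D A := .of_boundary c _ hAB.1 (by omega)
  have hBb : BadGap n D B := .of_boundary c _ hAB.2.1 hB
  have hrB := h.le_of_badGap hBb hlB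
  have hlr := h.lt
  have hr : ∀ g, BadGap n D g → A ≤ g → g ≤ B → BadGap n D (A + B - g) := by
    intro g hg h1 h2
    rcases eq_or_lt_of_le h1 with rfl | h1
    · rwa [Nat.add_sub_cancel_left]
    rcases eq_or_lt_of_le h2 with rfl | h2
    · rwa [Nat.add_sub_cancel]
    exact .reflect c g A B hg hAB hB h1 h2
  refine ⟨hrB, hr r h.right (by omega) hrB, hr l h.left hA hlB.le, by omega, by omega, ?_⟩
  intro g h1 h2 hg
  refine h.good (A + B - g) (by omega) (by omega) (hr g hg (by omega) (by omega))

variable (hθ : ∀ c, IsReversal n (D c) (θ c))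
include hθ

theorem exists_isStrip {x : ℕ} (hx : x < n) : ∃ l r, IsStrip n D l r ∧ l ≤ x ∧ x < r := by
  classical
  have h0 : BadGap n D 0 := (hθ true).badGap_zero (by omega)
  have hn : ∃ g, x < g ∧ BadGap n D g := ⟨n, hx, (hθ true).badGap_last (by omega)⟩
  refine ⟨Nat.findGreatest (BadGap n D) x, Nat.find hn,
    ⟨Nat.findGreatest_spec (Nat.zero_le _) h0, (Nat.find_spec hn).2,
      (Nat.findGreatest_le x).trans_lt (Nat.find_spec hn).1,
      Nat.find_min' hn ⟨hx, (hθ true).badGap_last (by omega)⟩, fun g h1 h2 hg => ?_⟩,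
    Nat.findGreatest_le x, (Nat.find_spec hn).1⟩
  rcases le_or_gt g x with hgx | hgx
  · exact Nat.findGreatest_is_greatest h1 hgx hg
  · exact Nat.find_min hn h2 ⟨hgx, hg⟩

theorem IsStrip.map {l r : ℕ} (h : IsStrip n D l r) (c : Bool) :
    ∃ s, r ≤ s ∧ IsStrip n D (s - r) (s - l) ∧ ∀ x, l ≤ x → x < r → θ c x = s - 1 - x := by
  have hlr := h.lt
  have hrn := h.le
  obtain ⟨A, B, hAB, h1, h2, h3⟩ := (hθ c).exists_block l (by omega)
  obtain ⟨h4, h5⟩ := h.reflect hAB h3 h1 h2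
  exact ⟨A + B, by omega, h5, fun x hx hx' => (hθ c).apply_eq A B hAB h3 x (by omega) (by omega)⟩

theorem Linked.lt {x y : ℕ} (h : Linked θ x y) (hx : x < n) : y < n := by
  induction h with
  | refl => exact hx
  | tail _ hyz ih =>
    obtain ⟨c, rfl⟩ := hyz
    exact (hθ c).lt ih

theorem Linked.symm {x y : ℕ} (h : Linked θ x y) (hx : x < n) : Linked θ y x := by
  induction h with
  | refl => exact .refl
  | tail hxy hyz ih =>
    obtain ⟨c, rfl⟩ := hyz
    exact .head ⟨c, ((hθ c).apply_apply (Linked.lt hθ hxy hx)).symm⟩ ih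

/-- Linked vertices lie in strips whose vertices are linked one by one, either in the same or in
the opposite order. -/
theorem Linked.transport {x y l r : ℕ} (h : Linked θ x y) (hs : IsStrip n D l r) (hl : l ≤ x)
    (hr : x < r) : ∃ l' r', IsStrip n D l' r' ∧ r' - l' = r - l ∧
      (((∀ i < r - l, Linked θ (l + i) (l' + i)) ∧ y = l' + (x - l)) ∨
        ((∀ i < r - l, Linked θ (l + i) (r' - 1 - i)) ∧ y = r' - 1 - (x - l))) := by
  induction h with
  | refl => exact ⟨l, r, hs, rfl, .inl ⟨fun _ _ => .refl, by omega⟩⟩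
  | tail _ hyz ih =>
    obtain ⟨c, rfl⟩ := hyz
    obtain ⟨l', r', hs', hw, h⟩ := ih
    obtain ⟨s, hrs, hs'', hmap⟩ := hs'.map hθ c
    have hlt := hs'.lt
    refine ⟨s - r', s - l', hs'', by omega, ?_⟩
    rcases h with ⟨h, rfl⟩ | ⟨h, rfl⟩
    · refine .inr ⟨fun i hi => .tail (h i hi) ⟨c, ?_⟩, ?_⟩
      · rw [hmap _ (by omega) (by omega)]
        omega
      · rw [hmap _ (by omega) (by omega)]
        omega
    · refine .inl ⟨fun i hi => .tail (h i hi) ⟨c, ?_⟩, ?_⟩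
      · rw [hmap _ (by omega) (by omega)]
        omega
      · rw [hmap _ (by omega) (by omega)]
        omega

/-- A set of vertices on which two fixed point free involutions act compatibly with the block
reversals has an even number of elements on the left of each bad gap. -/
theorem even_card_filter_lt {X : Finset ℕ} (hXn : ∀ x ∈ X, x < n) (τ : Bool → ℕ → ℕ)
    (hτ : ∀ c, ∀ x ∈ X, τ c x ∈ X) (hττ : ∀ c, ∀ x ∈ X, τ c (τ c x) = x)
    (hne : ∀ c, ∀ x ∈ X, τ c x ≠ x)
    (hblock : ∀ c A B, IsBlock (D c) A B → B ≤ n → ∀ x ∈ X, A ≤ x → x < B →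
      A ≤ τ c x ∧ τ c x < B ∧ ∀ g, BadGap n D g → A < g → g < B → (x < g ↔ A + B - g ≤ τ c x))
    {g : ℕ} (hg : BadGap n D g) : Even (X.filter (· < g)).card := by
  have hbd (c : Bool) (g : ℕ) (hg : D c g) : Even (X.filter (· < g)).card := by
    refine even_card_of_involution (τ c) (fun x hx => ?_)
      (fun x hx => hττ c x (Finset.mem_filter.1 hx).1)
      (fun x hx => hne c x (Finset.mem_filter.1 hx).1)
    rw [Finset.mem_filter] at hx ⊢
    refine ⟨hτ c x hx.1, ?_⟩
    obtain ⟨A, B, hAB, h1, h2, h3⟩ := (hθ c).exists_block x (hXn x hx.1)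
    obtain ⟨h4, h5, -⟩ := hblock c A B hAB h3 x hx.1 h1 h2
    by_contra hc
    exact hAB.2.2.2 g (by omega) (by omega) hg
  induction hg with
  | of_boundary c g hD _ => exact hbd c g hD
  -- The involution exchanges the elements of `X` in `[A, g)` with those in `[A + B - g, B)`, and
  -- the counts at `A` and `B` are even, so the parity at `g` passes to `A + B - g`.
  | reflect c g A B hg hAB hB hAg hgB ih =>
    have h1 := card_filter_lt_add X (show A ≤ g from hAg.le)
    have h2 := card_filter_lt_add X (show A + B - g ≤ B by omega)
    have h3 : (X.filter fun x => A ≤ x ∧ x < g).card =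
        (X.filter fun x => A + B - g ≤ x ∧ x < B).card := by
      refine Finset.card_bij' (fun x _ => τ c x) (fun x _ => τ c x) ?_ ?_ ?_ ?_
      · intro x hx
        rw [Finset.mem_filter] at hx ⊢
        obtain ⟨h4, h5, h6⟩ := hblock c A B hAB hB x hx.1 hx.2.1 (by omega)
        exact ⟨hτ c x hx.1, (h6 g hg hAg hgB).1 hx.2.2, h5⟩
      · intro x hx
        rw [Finset.mem_filter] at hx ⊢
        obtain ⟨h4, h5, h6⟩ := hblock c A B hAB hB x hx.1 (by omega) hx.2.2
        obtain ⟨-, -, h7⟩ := hblock c A B hAB hB _ (hτ c x hx.1) h4 h5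
        refine ⟨hτ c x hx.1, h4, (h7 g hg hAg hgB).2 ?_⟩
        rw [hττ c x hx.1]
        exact hx.2.1
      · intro x hx
        exact hττ c x (Finset.mem_filter.1 hx).1
      · intro x hx
        exact hττ c x (Finset.mem_filter.1 hx).1
    have hA := hbd c A hAB.1
    have hB' := hbd c B hAB.2.1
    rw [Nat.even_iff] at *
    omega

theorem IsStrip.stripLeft_apply {c : Bool} {l r A B : ℕ} (h : IsStrip n D l r)
    (hAB : IsBlock (D c) A B) (hB : B ≤ n) (hA : A ≤ l) (hlB : l < B) :
    stripLeft n D (θ c l) = A + B - r := by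
  have hlt := h.lt
  obtain ⟨h1, h2⟩ := h.reflect hAB hB hA hlB
  refine h2.stripLeft_eq ?_ ?_ <;> rw [(hθ c).apply_eq A B hAB hB l hA hlB] <;> omega

/-- Each strip is linked to a strip which is mapped to itself by one of the reversals. -/
theorem IsStrip.exists_fixed {l r : ℕ} (h : IsStrip n D l r) :
    ∃ l' r' c, IsStrip n D l' r' ∧ Linked θ l l' ∧ θ c l' = r' - 1 := by
  classical
  by_contra! hcon
  have hln : l < n := h.lt.trans_le h.le
  -- `X` is the set of left ends of the strips reached from `l`. If no such strip were mapped to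
  -- itself, both reversals would act on `X` without fixed points, and evenly many elements would
  -- precede each bad gap. But only `l` lies between the bad gaps `l` and `r`.
  let X : Finset ℕ := (Finset.range n).filter fun w =>
    ∃ r', IsStrip n D w r' ∧ (Linked θ l w ∨ Linked θ l (r' - 1))
  have hXmem (w : ℕ) : w ∈ X ↔ ∃ r', IsStrip n D w r' ∧ (Linked θ l w ∨ Linked θ l (r' - 1)) := by
    rw [Finset.mem_filter, Finset.mem_range]
    refine ⟨fun hw => hw.2, fun hw => ⟨?_, hw⟩⟩
    obtain ⟨r', hr', -⟩ := hw
    exact hr'.lt.trans_le hr'.le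
  let τ (c : Bool) (w : ℕ) : ℕ := stripLeft n D (θ c w)
  have hτ' {c : Bool} {w r' A B : ℕ} (hw : IsStrip n D w r') (hAB : IsBlock (D c) A B)
      (hB : B ≤ n) (hA : A ≤ w) (hwB : w < B) : τ c w = A + B - r' :=
    hw.stripLeft_apply hθ hAB hB hA hwB
  have key := fun g hg => even_card_filter_lt hθ (X := X) (g := g) ?_ τ ?_ ?_ ?_ ?_ hg
  · have h1 := key l h.left
    have h2 := key r h.right
    have h3 := card_filter_lt_add X h.lt.le
    have h4 : X.filter (fun x => l ≤ x ∧ x < r) = {l} := by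
      ext x
      rw [Finset.mem_filter, Finset.mem_singleton, hXmem]
      constructor
      · rintro ⟨⟨r', hr', -⟩, hx1, hx2⟩
        by_contra hne
        exact h.good x (by omega) hx2 hr'.left
      · rintro rfl
        exact ⟨⟨r, h, .inl .refl⟩, le_rfl, h.lt⟩
    rw [h4, Finset.card_singleton] at h3
    rw [Nat.even_iff] at h1 h2
    omega
  · intro x hx
    exact Finset.mem_range.1 (Finset.mem_filter.1 hx).1
  · intro c w hw
    obtain ⟨r', hr', hlink⟩ := (hXmem w).1 hw
    have hlt := hr'.lt
    have hle := hr'.le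
    obtain ⟨A, B, hAB, h1, h2, h3⟩ := (hθ c).exists_block w (by omega)
    obtain ⟨h4, h5⟩ := hr'.reflect hAB h3 h1 h2
    rw [hXmem, hτ' hr' hAB h3 h1 h2]
    refine ⟨A + B - w, h5, ?_⟩
    rcases hlink with hlink | hlink
    · refine .inr (.tail hlink ⟨c, ?_⟩)
      rw [(hθ c).apply_eq A B hAB h3 w h1 h2]
      omega
    · refine .inl (.tail hlink ⟨c, ?_⟩)
      rw [(hθ c).apply_eq A B hAB h3 (r' - 1) (by omega) (by omega)]
      omega
  · intro c w hw
    obtain ⟨r', hr', hlink⟩ := (hXmem w).1 hw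
    have hlt := hr'.lt
    have hle := hr'.le
    obtain ⟨A, B, hAB, h1, h2, h3⟩ := (hθ c).exists_block w (by omega)
    obtain ⟨h4, h5⟩ := hr'.reflect hAB h3 h1 h2
    rw [hτ' hr' hAB h3 h1 h2, hτ' h5 hAB h3 (by omega) (by omega)]
    omega
  · intro c w hw heq
    obtain ⟨r', hr', hlink⟩ := (hXmem w).1 hw
    have hlt := hr'.lt
    have hle := hr'.le
    obtain ⟨A, B, hAB, h1, h2, h3⟩ := (hθ c).exists_block w (by omega)
    obtain ⟨h4, h5⟩ := hr'.reflect hAB h3 h1 h2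
    rw [hτ' hr' hAB h3 h1 h2] at heq
    have hθw : θ c w = r' - 1 := by
      rw [(hθ c).apply_eq A B hAB h3 w h1 h2]
      omega
    refine hcon w r' c hr' ?_ hθw
    rcases hlink with hlink | hlink
    · exact hlink
    · refine .tail hlink ⟨c, ?_⟩
      rw [← hθw, (hθ c).apply_apply (by omega)]
  · intro c A B hAB hB w hw hA hwB
    obtain ⟨r', hr', -⟩ := (hXmem w).1 hw
    have hlt := hr'.lt
    obtain ⟨h4, h5⟩ := hr'.reflect hAB hB hA hwB
    rw [hτ' hr' hAB hB hA hwB]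
    refine ⟨by omega, by omega, fun g hg hAg hgB => ⟨fun hwg => ?_, fun hg' => ?_⟩⟩
    · have := hr'.le_of_badGap hg hwg
      omega
    · omega

/-- A strip mapped to itself by a reversal is reversed by it. -/
theorem IsStrip.apply_of_fixed {l r : ℕ} {c : Bool} (h : IsStrip n D l r) (hc : θ c l = r - 1)
    {x : ℕ} (h1 : l ≤ x) (h2 : x < r) : θ c x = l + r - 1 - x := by
  obtain ⟨s, hs, -, hmap⟩ := h.map hθ c
  have hlt := h.lt
  rw [hmap x h1 h2]
  rw [hmap l le_rfl h.lt] at hc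
  omega

/-- A vertex is linked to its mirror image in its strip. -/
theorem IsStrip.linked_mirror {l r x : ℕ} (h : IsStrip n D l r) (h1 : l ≤ x) (h2 : x < r) :
    Linked θ x (l + r - 1 - x) := by
  have hle := h.le
  -- Move to a strip which is reversed onto itself, take the mirror image there, and come back by
  -- the same arcs.
  obtain ⟨l', r', c, hs', hlink, hc⟩ := h.exists_fixed hθ
  obtain ⟨l'', r'', hs'', hw, htr⟩ := hlink.transport hθ h le_rfl h.lt
  have hlt' := hs'.lt
  have hlt'' := hs''.lt
  have hmir (i : ℕ) (hi : i < r' - l') : Linked θ (l' + i) (r' - 1 - i) := by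
    refine .single ⟨c, ?_⟩
    rw [hs'.apply_of_fixed hθ hc (by omega) (by omega)]
    omega
  obtain ⟨rfl, rfl⟩ : l' = l'' ∧ r' = r'' := by
    refine hs'.unique hs'' (x := l') le_rfl hlt' ?_ ?_ <;> rcases htr with ⟨-, h3⟩ | ⟨-, h3⟩ <;>
      omega
  rcases htr with ⟨htr, -⟩ | ⟨htr, -⟩
  · have e1 := htr (x - l) (by omega)
    have e2 := hmir (x - l) (by omega)
    have e3 := (htr (r - 1 - x) (by omega)).symm hθ (by omega)
    rw [show l' + (r - 1 - x) = r' - 1 - (x - l) by omega,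
      show l + (r - 1 - x) = l + r - 1 - x by omega] at e3
    rw [show l + (x - l) = x by omega] at e1
    exact e1.trans (e2.trans e3)
  · have e1 := htr (x - l) (by omega)
    have e2 := (hmir (x - l) (by omega)).symm hθ (by have := hs'.le; omega)
    have e3 := (htr (r - 1 - x) (by omega)).symm hθ (by omega)
    rw [show r' - 1 - (r - 1 - x) = l' + (x - l) by omega,
      show l + (r - 1 - x) = l + r - 1 - x by omega] at e3
    rw [show l + (x - l) = x by omega] at e1
    exact e1.trans (e2.trans e3)

end Strips

/-! ### Orbits, linking classes and widths of strips. -/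

section Strips

variable {n : ℕ} {D : Bool → ℕ → Prop} {θ : Bool → ℕ → ℕ} (hθ : ∀ c, IsReversal n (D c) (θ c))
include hθ

/-- Linking refers to the group generated by both involutions, the orbits only to their product. The
statement is clear in a strip which an involution maps to itself, and it propagates along arcs. It
lets a single involution be traded for a reflection within the strip. -/
theorem IsStrip.sameOrbit_mirror {l r x : ℕ} (h : IsStrip n D l r) (h1 : l ≤ x) (h2 : x < r) :
    SameOrbit n (fun x => θ true (θ false x)) (θ true x) (l + r - 1 - x) := by
  set σ : ℕ → ℕ := fun x => θ true (θ false x) with hσ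
  obtain ⟨l', r', c, hs', hlink, hc⟩ := h.exists_fixed hθ
  have hrec (z : ℕ) (hz : Linked θ l' z) : ∀ l r, IsStrip n D l r → l ≤ z → z < r →
      ∀ x, l ≤ x → x < r → SameOrbit n σ (θ true x) (l + r - 1 - x) := by
    induction hz with
    | refl =>
      intro l r hs h3 h4 x h1 h2
      obtain ⟨rfl, rfl⟩ := hs.unique hs' h3 h4 le_rfl hs'.lt
      have hle := hs.le
      cases c with
      | true => exact .of_eq (hs.apply_of_fixed hθ hc h1 h2)
      | false =>
        refine .symm (.step ?_)
        rw [hσ]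
        change _ = θ true (θ false _)
        rw [hs.apply_of_fixed hθ hc (by omega) (by omega)]
        congr 1
        omega
    | @tail z w hz hw ih =>
      obtain ⟨d, rfl⟩ := hw
      intro l₂ r₂ hs h3 h4 x h1 h2
      have hzn : z < n := Linked.lt hθ hz (hs'.lt.trans_le hs'.le)
      obtain ⟨l₁, r₁, hs₁, h5, h6⟩ := exists_isStrip hθ hzn
      obtain ⟨s, hrs, hs₂, hmap⟩ := hs₁.map hθ d
      have hlt := hs₁.lt
      have hle := hs₁.le
      rw [hmap z h5 h6] at h3 h4
      obtain ⟨rfl, rfl⟩ := hs.unique hs₂ h3 h4 (by omega) (by omega)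
      have hle₂ := hs₂.le
      obtain ⟨y, hy1, hy2, rfl⟩ : ∃ y, l₁ ≤ y ∧ y < r₁ ∧ x = θ d y :=
        ⟨s - 1 - x, by omega, by omega, by rw [hmap _ (by omega) (by omega)]; omega⟩
      have hmir : s - r₁ + (s - l₁) - 1 - θ d y = θ d (l₁ + r₁ - 1 - y) := by
        rw [hmap _ hy1 hy2, hmap _ (by omega) (by omega)]
        omega
      rw [hmir]
      have hP := ih l₁ r₁ hs₁ h5 h6 (l₁ + r₁ - 1 - y) (by omega) (by omega)
      rw [show l₁ + r₁ - 1 - (l₁ + r₁ - 1 - y) = y by omega] at hP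
      cases d with
      | true =>
        rw [(hθ true).apply_apply (by omega)]
        exact hP.symm
      | false =>
        refine SameOrbit.trans (y := y) (.symm (.step rfl)) (by omega) ?_
        refine SameOrbit.trans hP.symm ((hθ true).lt (by omega)) (.symm (.step ?_))
        rw [hσ]
        change _ = θ true (θ false _)
        rw [(hθ false).apply_apply (by omega)]
  exact hrec l (hlink.symm hθ (h.lt.trans_le h.le)) l r h le_rfl h.lt x h1 h2

theorem IsStrip.exists_sameOrbit {l₀ r₀ l r y : ℕ} (h₀ : IsStrip n D l₀ r₀)
    (h : IsStrip n D l r) (hl : Linked θ l₀ l) (h1 : l ≤ y) (h2 : y < r) :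
    ∃ x, l₀ ≤ x ∧ x < r₀ ∧ SameOrbit n (fun x => θ true (θ false x)) x y := by
  have hrec (z : ℕ) (hz : Linked θ l₀ z) : ∀ l r, IsStrip n D l r → l ≤ z → z < r →
      ∀ y, l ≤ y → y < r →
        ∃ x, l₀ ≤ x ∧ x < r₀ ∧ SameOrbit n (fun x => θ true (θ false x)) x y := by
    induction hz with
    | refl =>
      intro l r hs h1 h2 y h3 h4
      obtain ⟨rfl, rfl⟩ := hs.unique h₀ h1 h2 le_rfl h₀.lt
      exact ⟨y, h3, h4, .of_eq rfl⟩
    | @tail z w hz hw ih =>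
      obtain ⟨d, rfl⟩ := hw
      intro l₂ r₂ hs h3 h4 x h1 h2
      have hzn : z < n := Linked.lt hθ hz (h₀.lt.trans_le h₀.le)
      obtain ⟨l₁, r₁, hs₁, h5, h6⟩ := exists_isStrip hθ hzn
      obtain ⟨s, hrs, hs₂, hmap⟩ := hs₁.map hθ d
      have hlt := hs₁.lt
      have hle := hs₁.le
      rw [hmap z h5 h6] at h3 h4
      obtain ⟨rfl, rfl⟩ := hs.unique hs₂ h3 h4 (by omega) (by omega)
      obtain ⟨y, hy1, hy2, rfl⟩ : ∃ y, l₁ ≤ y ∧ y < r₁ ∧ x = θ d y :=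
        ⟨s - 1 - x, by omega, by omega, by rw [hmap _ (by omega) (by omega)]; omega⟩
      obtain ⟨x, hx1, hx2, hx⟩ := ih l₁ r₁ hs₁ h5 h6 (l₁ + r₁ - 1 - y) (by omega) (by omega)
      refine ⟨x, hx1, hx2, hx.trans (by omega) ?_⟩
      have hP := hs₁.sameOrbit_mirror hθ hy1 hy2
      cases d with
      | true => exact hP.symm
      | false =>
        refine SameOrbit.trans hP.symm ((hθ true).lt (by omega)) (.symm (.step ?_))
        rw [(hθ false).apply_apply (by omega)]
  exact hrec l hl l r h le_rfl h.lt y h1 h2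

/-- Vertices in the same orbit are linked and lie at the same distance from the left end of their
strips. -/
theorem SameOrbit.linked_and_sub_eq {x y : ℕ} (hx : x < n) (hy : y < n)
    (h : SameOrbit n (fun x => θ true (θ false x)) x y) :
    Linked θ x y ∧ x - stripLeft n D x = y - stripLeft n D y := by
  -- Each involution reverses the position in the strip, so their product preserves it; it also
  -- preserves the linking class. Thus `f` is constant on orbits.
  let f : Fin n → ℕ × (ℕ → Prop) := fun x => (x - stripLeft n D x, fun z => Linked θ x z)
  have hf : ∀ x y : Fin n, (y : ℕ) = θ true (θ false x) → f x = f y := by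
    intro x y hxy
    have hlink : Linked θ x y := .tail (.single ⟨false, rfl⟩) ⟨true, hxy⟩
    obtain ⟨l, r, hs, h1, h2⟩ := exists_isStrip hθ x.2
    obtain ⟨s, hrs, hs', hmap⟩ := hs.map hθ false
    obtain ⟨s', hrs', hs'', hmap'⟩ := hs'.map hθ true
    have hlt := hs.lt
    rw [hmap _ h1 h2, hmap' _ (by omega) (by omega)] at hxy
    refine Prod.ext ?_ (funext fun z => propext ⟨fun hz => (hlink.symm hθ x.2).trans hz,
      fun hz => hlink.trans hz⟩)
    change (x : ℕ) - _ = y - _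
    rw [hs.stripLeft_eq h1 h2, hs''.stripLeft_eq (x := y) (by omega) (by omega)]
    omega
  have hq := congrArg (Quot.lift f hf) (h hx hy)
  refine ⟨?_, congrArg Prod.fst hq⟩
  have h2 : Linked θ x y = Linked θ y y := congrFun (congrArg Prod.snd hq) y
  rw [h2]
  exact .refl

theorem IsStrip.eq_of_sameOrbit {l r x y : ℕ} (h : IsStrip n D l r) (h1 : l ≤ x) (h2 : x < r)
    (h3 : l ≤ y) (h4 : y < r) (hxy : SameOrbit n (fun x => θ true (θ false x)) x y) : x = y := by
  have hle := h.le
  have := (hxy.linked_and_sub_eq hθ (by omega) (by omega)).2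
  rw [h.stripLeft_eq h1 h2, h.stripLeft_eq h3 h4] at this
  omega

/-- The vertices of the first strip represent each orbit exactly once. -/
theorem orbitCount_eq_of_linked {s : ℕ} (h₀ : IsStrip n D 0 s)
    (hall : ∀ l r, IsStrip n D l r → Linked θ 0 l) :
    orbitCount n (fun x => θ true (θ false x)) = s := by
  have hle := h₀.le
  let f : Fin s → Quot fun x y : Fin n => (y : ℕ) = θ true (θ false x) :=
    fun i => Quot.mk _ ⟨i, by omega⟩
  have hf : Function.Bijective f := by
    constructor
    · intro i j hij
      exact Fin.ext (h₀.eq_of_sameOrbit hθ (Nat.zero_le _) i.2 (Nat.zero_le _) j.2 fun _ _ => hij)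
    · rintro ⟨z⟩
      obtain ⟨l, r, hs, h1, h2⟩ := exists_isStrip hθ z.2
      obtain ⟨x, -, hx, hxz⟩ := h₀.exists_sameOrbit hθ hs (hall l r hs) h1 h2
      exact ⟨⟨x, hx⟩, hxz _ _⟩
  rw [orbitCount, ← Nat.card_eq_of_bijective f hf, Nat.card_fin]

/-- The vertices of the two strips lie in distinct orbits. A link between the strips would, if it
reversed them, still link their left ends through `IsStrip.linked_mirror`. -/
theorem le_orbitCount_of_not_linked {l r l' r' : ℕ} (h : IsStrip n D l r)
    (h' : IsStrip n D l' r') (hll : ¬ Linked θ l l') :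
    (r - l) + (r' - l') ≤ orbitCount n (fun x => θ true (θ false x)) := by
  have hle := h.le
  have hle' := h'.le
  have hlt := h.lt
  have hlt' := h'.lt
  let f : Fin (r - l) ⊕ Fin (r' - l') → Quot fun x y : Fin n => (y : ℕ) = θ true (θ false x) :=
    Sum.elim (fun i => Quot.mk _ ⟨l + i, by omega⟩) fun i => Quot.mk _ ⟨l' + i, by omega⟩
  have hne (i : Fin (r - l)) (j : Fin (r' - l')) : f (.inl i) ≠ f (.inr j) := by
    intro hij
    have hlink : Linked θ (l + i) (l' + j) :=
      (SameOrbit.linked_and_sub_eq hθ (by omega) (by omega) fun _ _ => hij).1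
    obtain ⟨l₁, r₁, hs, hw, htr⟩ := hlink.transport hθ h (by omega) (by omega)
    have hlt₁ := hs.lt
    obtain ⟨rfl, rfl⟩ : l' = l₁ ∧ r' = r₁ := by
      refine h'.unique hs (x := l' + j) (by omega) (by omega) ?_ ?_ <;>
        rcases htr with ⟨-, h3⟩ | ⟨-, h3⟩ <;> omega
    rcases htr with ⟨htr, -⟩ | ⟨htr, -⟩
    · exact hll (by simpa using htr 0 (by omega))
    · have := htr (r - l - 1) (by omega)
      rw [show l + (r - l - 1) = r - 1 by omega, show r' - 1 - (r - l - 1) = l' by omega] at this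
      refine hll (.trans ?_ this)
      have hm := h.linked_mirror hθ le_rfl h.lt
      rwa [show l + r - 1 - l = r - 1 by omega] at hm
  have hf : Function.Injective f := by
    rintro (i | i) (j | j) hij
    · have := h.eq_of_sameOrbit hθ (x := l + i) (y := l + j) (by omega) (by omega) (by omega)
        (by omega) fun _ _ => hij
      exact congrArg _ (Fin.ext (by omega))
    · exact absurd hij (hne i j)
    · exact absurd hij.symm (hne j i)
    · have := h'.eq_of_sameOrbit hθ (x := l' + i) (y := l' + j) (by omega) (by omega) (by omega)
        (by omega) fun _ _ => hij
      exact congrArg _ (Fin.ext (by omega))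
  have : Finite (Quot fun x y : Fin n => (y : ℕ) = θ true (θ false x)) := Quot.finite _
  have := Nat.card_le_card_of_injective f hf
  rwa [Nat.card_sum, Nat.card_fin, Nat.card_fin] at this

/-- The number of linking classes of strips is at most half the number of blocks. -/
theorem two_mul_card_le {C : Type*} (comp : ℕ → C)
    (hcomp : ∀ x < n, ∀ y < n, comp x = comp y ↔ Linked θ x y) (M : Finset C)
    (hM : ∀ Y ∈ M, ∃ l r, IsStrip n D l r ∧ comp l = Y) (K : Bool → ℕ) (blk : Bool → ℕ → ℕ)
    (hblk : ∀ c, ∀ x < n, blk c x < K c)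
    (hblock : ∀ c, ∀ x < n, ∀ y < n, blk c x = blk c y →
      ∃ A B, IsBlock (D c) A B ∧ B ≤ n ∧ A ≤ x ∧ x < B ∧ A ≤ y ∧ y < B) :
    2 * M.card ≤ K true + K false := by
  classical
  -- A strip mapped to itself is centred in its block, so each block holds at most one.
  let Fx (c : Bool) : Finset ℕ := (Finset.range n).filter fun w =>
    ∃ r, IsStrip n D w r ∧ θ c w = r - 1
  have hcard (c : Bool) : (Fx c).card ≤ K c := by
    rw [← Finset.card_range (K c)]
    refine Finset.card_le_card_of_injOn (blk c) (fun w hw => ?_) ?_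
    · simp only [Fx, Finset.coe_filter, Finset.mem_range, Set.mem_ofPred_eq] at hw
      exact Finset.mem_coe.2 (Finset.mem_range.2 (hblk c w hw.1))
    · intro w hw w' hw' heq
      simp only [Fx, Finset.coe_filter, Finset.mem_range, Set.mem_ofPred_eq] at hw hw'
      obtain ⟨hwn, r, hs, hr⟩ := hw
      obtain ⟨hwn', r', hs', hr'⟩ := hw'
      obtain ⟨A, B, hAB, hB, h1, h2, h3, h4⟩ := hblock c w hwn w' hwn' heq
      rw [(hθ c).apply_eq A B hAB hB w h1 h2] at hr
      rw [(hθ c).apply_eq A B hAB hB w' h3 h4] at hr'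
      have hlt := hs.lt
      have hlt' := hs'.lt
      rcases lt_trichotomy w w' with h | h | h
      · have := hs.le_of_badGap hs'.left h
        omega
      · exact h
      · have := hs'.le_of_badGap hs.left h
        omega
  have hY (Y : C) (hY : Y ∈ M) : 2 ≤ ((Fx true).filter fun w => comp w = Y).card +
      ((Fx false).filter fun w => comp w = Y).card := by
    let L : Finset ℕ := (Finset.range n).filter fun w => (∃ r, IsStrip n D w r) ∧ comp w = Y
    -- Each reversal permutes the strips of a class as an involution, so its number of fixed strips
    -- has the parity of the number of strips. The two numbers therefore have equal parity. One of
    -- them is positive, so their sum is at least 2.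
    have hpar (c : Bool) : Even (L.card + ((Fx c).filter fun w => comp w = Y).card) := by
      have h1 : ((Fx c).filter fun w => comp w = Y) =
          L.filter fun w => stripLeft n D (θ c w) = w := by
        ext w
        simp only [Fx, L, Finset.mem_filter, Finset.mem_range]
        constructor
        · rintro ⟨⟨hw, r, hs, hr⟩, hwY⟩
          refine ⟨⟨hw, ⟨r, hs⟩, hwY⟩, ?_⟩
          have := hs.lt
          rw [hr]
          exact hs.stripLeft_eq (by omega) (by omega)
        · rintro ⟨⟨hw, ⟨r, hs⟩, hwY⟩, hl⟩
          refine ⟨⟨hw, r, hs, ?_⟩, hwY⟩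
          obtain ⟨A, B, hAB, h1, h2, h3⟩ := (hθ c).exists_block w hw
          have hlt := hs.lt
          have hrB := (hs.reflect hAB h3 h1 h2).1
          rw [hs.stripLeft_apply hθ hAB h3 h1 h2] at hl
          rw [(hθ c).apply_eq A B hAB h3 w h1 h2]
          omega
      have h2 : Even (L.filter fun w => ¬ stripLeft n D (θ c w) = w).card := by
        have himg : ∀ w ∈ L, stripLeft n D (θ c w) ∈ L ∧
            stripLeft n D (θ c (stripLeft n D (θ c w))) = w := by
          intro w hw
          simp only [L, Finset.mem_filter, Finset.mem_range] at hw ⊢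
          obtain ⟨hwn, ⟨r, hs⟩, hwY⟩ := hw
          obtain ⟨A, B, hAB, h1, h2, h3⟩ := (hθ c).exists_block w hwn
          have hlt := hs.lt
          obtain ⟨hrB, hs'⟩ := hs.reflect hAB h3 h1 h2
          rw [hs.stripLeft_apply hθ hAB h3 h1 h2,
            hs'.stripLeft_apply hθ hAB h3 (by omega) (by omega)]
          refine ⟨⟨by omega, ⟨_, hs'⟩, ?_⟩, by omega⟩
          rw [← hwY, eq_comm, hcomp w hwn _ (by omega)]
          have hm := hs.linked_mirror hθ le_rfl hs.lt
          refine hm.tail ⟨c, ?_⟩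
          rw [(hθ c).apply_eq A B hAB h3 _ (by omega) (by omega)]
          omega
        refine even_card_of_involution (fun w => stripLeft n D (θ c w)) (fun w hw => ?_)
          (fun w hw => (himg w (Finset.mem_filter.1 hw).1).2)
          (fun w hw => (Finset.mem_filter.1 hw).2)
        obtain ⟨h3, h4⟩ := himg w (Finset.mem_filter.1 hw).1
        refine Finset.mem_filter.2 ⟨h3, ?_⟩
        rw [h4]
        exact fun h5 => (Finset.mem_filter.1 hw).2 h5.symm
      have h3 := Finset.card_filter_add_card_filter_not (s := L)
        (fun w => stripLeft n D (θ c w) = w)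
      rw [h1, ← h3]
      rw [Nat.even_iff] at h2 ⊢
      omega
    obtain ⟨l, r, hs, rfl⟩ := hM Y hY
    obtain ⟨l', r', c, hs', hlink, hc⟩ := hs.exists_fixed hθ
    have hmem : l' ∈ (Fx c).filter fun w => comp w = comp l := by
      have hn' := hs'.lt.trans_le hs'.le
      have hn := hs.lt.trans_le hs.le
      exact Finset.mem_filter.2 ⟨Finset.mem_filter.2 ⟨Finset.mem_range.2 hn', r', hs', hc⟩,
        (hcomp _ hn' _ hn).2 (hlink.symm hθ hn)⟩
    have hpos := Finset.card_pos.2 ⟨_, hmem⟩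
    have h1 := hpar true
    have h2 := hpar false
    rw [Nat.even_iff] at h1 h2
    cases c <;> omega
  have hsum (c : Bool) : ∑ Y ∈ M, ((Fx c).filter fun w => comp w = Y).card ≤ (Fx c).card := by
    rw [← Finset.card_biUnion]
    · refine Finset.card_le_card fun w hw => ?_
      obtain ⟨Y, -, hw⟩ := Finset.mem_biUnion.1 hw
      exact (Finset.mem_filter.1 hw).1
    · intro Y _ Y' _ hne
      refine Finset.disjoint_filter.2 fun w _ h1 h2 => hne (h1.symm.trans h2)
  calc 2 * M.card = ∑ _Y ∈ M, 2 := by rw [Finset.sum_const, smul_eq_mul, mul_comm]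
    _ ≤ ∑ Y ∈ M, (((Fx true).filter fun w => comp w = Y).card +
        ((Fx false).filter fun w => comp w = Y).card) := Finset.sum_le_sum hY
    _ ≤ (Fx true).card + (Fx false).card := by
      rw [Finset.sum_add_distrib]
      exact add_le_add (hsum true) (hsum false)
    _ ≤ K true + K false := add_le_add (hcard true) (hcard false)

/-- The vertices linked to the left end of a strip are the ends of the strips linked to it. -/
theorem IsStrip.ends_of_linked {l r v : ℕ} (h : IsStrip n D l r) (hv : Linked θ l v) :
    ∃ l' r', IsStrip n D l' r' ∧ r' - l' = r - l ∧ Linked θ l l' ∧ Linked θ l (r' - 1) ∧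
      (v = l' ∨ v = r' - 1) := by
  have hlt := h.lt
  obtain ⟨l', r', hs, hw, htr⟩ := hv.transport hθ h le_rfl h.lt
  have hlt' := hs.lt
  have hle' := hs.le
  have hm := hs.linked_mirror hθ le_rfl hs.lt
  rw [show l' + r' - 1 - l' = r' - 1 by omega] at hm
  refine ⟨l', r', hs, hw, ?_⟩
  rcases htr with ⟨-, h3⟩ | ⟨-, h3⟩
  · obtain rfl : v = l' := by omega
    exact ⟨hv, hv.trans hm, .inl rfl⟩
  · obtain rfl : v = r' - 1 := by omega
    exact ⟨hv.trans (hm.symm hθ (by omega)), hv, .inr rfl⟩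

/-- A fixed vertex is the centre of its strip, whereas `v` is an end of a strip of width greater
than 1. -/
theorem IsStrip.apply_ne_of_linked {l r v : ℕ} (h : IsStrip n D l r) (hw : l + 1 < r)
    (hv : Linked θ l v) (c : Bool) : θ c v ≠ v := by
  intro hfix
  obtain ⟨l', r', hs, hw', -, -, hv'⟩ := h.ends_of_linked hθ hv
  have hlt := hs.lt
  obtain ⟨s, hrs, hs', hmap⟩ := hs.map hθ c
  have h1 := hmap v (by omega) (by omega)
  obtain ⟨h2, h3⟩ := hs.unique hs' (x := v) (by omega) (by omega) (by omega) (by omega)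
  omega

theorem even_card_filter_lt_of_closed {X : Finset ℕ} (hXn : ∀ x ∈ X, x < n)
    (hX : ∀ c, ∀ x ∈ X, θ c x ∈ X) (hne : ∀ c, ∀ x ∈ X, θ c x ≠ x) {g : ℕ}
    (hg : BadGap n D g) : Even (X.filter (· < g)).card := by
  refine even_card_filter_lt hθ hXn θ hX (fun c x hx => (hθ c).apply_apply (hXn x hx)) hne ?_ hg
  intro c A B hAB hB x hx h1 h2
  rw [(hθ c).apply_eq A B hAB hB x h1 h2]
  refine ⟨by omega, by omega, fun g _ h3 h4 => by omega⟩

omit hθ in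
theorem BadGap.dvd {d : ℕ} (hd : ∀ c g, D c g → d ∣ g) {g : ℕ} (hg : BadGap n D g) : d ∣ g := by
  induction hg with
  | of_boundary c g h _ => exact hd c g h
  | reflect c g A B _ hAB _ h1 h2 ih =>
    exact Nat.dvd_sub (Nat.dvd_add (hd c A hAB.1) (hd c B hAB.2.1)) ih

/-- If all strips have length `s`, then all bad gaps are multiples of `s`. -/
theorem BadGap.dvd_of_forall_isStrip {s : ℕ} (hs : ∀ l r, IsStrip n D l r → r = l + s) {g : ℕ}
    (hg : BadGap n D g) (hgn : g ≤ n) : s ∣ g := by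
  induction g using Nat.strong_induction_on with
  | _ g ih =>
    rcases Nat.eq_zero_or_pos g with rfl | hpos
    · exact dvd_zero s
    obtain ⟨l, r, h, h1, h2⟩ := exists_isStrip hθ (x := g - 1) (by omega)
    have hlt := h.lt
    obtain rfl : r = g := by
      have := h.le_of_badGap hg (by omega)
      omega
    have := hs l r h
    rw [this]
    exact Nat.dvd_add (ih l hlt h.left (by omega)) dvd_rfl

end Strips

/-! ### From compositions to lists and block boundaries. -/

theorem block_characterization (l : List ℕ) {k x : ℕ} (h1 : (l.take k).sum ≤ x)
    (h2 : x < (l.take (k + 1)).sum) :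
    blockIdx l x = k ∧ blockRev l x = (l.take k).sum + (l.take (k + 1)).sum - 1 - x := by
  induction l generalizing k x with
  | nil => simp at h2
  | cons p l ih =>
    cases k with
    | zero =>
      simp only [zero_add, List.take_succ_cons, List.take_zero, List.sum_cons, List.sum_nil,
        add_zero] at h2 ⊢
      exact ⟨blockIdx_cons_lt l h2, blockRev_cons_lt l h2⟩
    | succ k =>
      simp only [List.take_succ_cons, List.sum_cons] at h1 h2 ⊢
      obtain ⟨h3, h4⟩ := ih (k := k) (x := x - p) (by omega) (by omega)
      rw [blockIdx_cons_ge l (by omega), blockRev_cons_ge l (by omega), h3, h4]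
      exact ⟨rfl, by omega⟩

section Bridge

variable {n : ℕ} (c : Composition n)

theorem blockIdx_blocks (x : Fin n) : blockIdx c.blocks x = c.index x :=
  (block_characterization c.blocks (c.sizeUpTo_index_le x) (c.lt_sizeUpTo_index_succ x)).1

theorem blockRev_blocks (x : Fin n) : blockRev c.blocks x =
    c.sizeUpTo (c.index x) + c.sizeUpTo (c.index x + 1) - 1 - x :=
  (block_characterization c.blocks (c.sizeUpTo_index_le x) (c.lt_sizeUpTo_index_succ x)).2

theorem val_theta (x : Fin n) : (theta c x : ℕ) = blockRev c.blocks x := by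
  have h1 := c.sizeUpTo_index_le x
  have h2 : (x : ℕ) < c.sizeUpTo (c.index x + 1) := c.lt_sizeUpTo_index_succ x
  rw [blockRev_blocks, theta, Composition.coe_embedding, Fin.val_rev, Composition.coe_invEmbedding]
  rw [c.sizeUpTo_succ'] at h2 ⊢
  omega

/-- The boundaries of the blocks of a composition. -/
def compBoundary (g : ℕ) : Prop := ∃ k, g = c.sizeUpTo k

theorem isBlock_index (x : Fin n) :
    IsBlock (compBoundary c) (c.sizeUpTo (c.index x)) (c.sizeUpTo (c.index x + 1)) := by
  refine ⟨⟨_, rfl⟩, ⟨_, rfl⟩, c.sizeUpTo_strict_mono (c.index x).2, ?_⟩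
  rintro _ h1 h2 ⟨k, rfl⟩
  rcases le_or_gt k (c.index x) with hk | hk
  · exact absurd (c.monotone_sizeUpTo hk) (not_le.2 h1)
  · exact absurd (c.monotone_sizeUpTo (Nat.succ_le_of_lt hk)) (not_le.2 h2)

theorem isReversal_blocks : IsReversal n (compBoundary c) (blockRev c.blocks) := by
  refine ⟨fun x hx => ⟨_, _, isBlock_index c ⟨x, hx⟩, c.sizeUpTo_index_le ⟨x, hx⟩,
    c.lt_sizeUpTo_index_succ ⟨x, hx⟩, c.sizeUpTo_le _⟩, fun A B hAB hB x h1 h2 => ?_⟩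
  have hx : x < n := by omega
  obtain ⟨hA', hB', -, hno⟩ := isBlock_index c ⟨x, hx⟩
  have h3 : c.sizeUpTo (c.index ⟨x, hx⟩) ≤ x := c.sizeUpTo_index_le ⟨x, hx⟩
  have h4 : x < c.sizeUpTo (c.index ⟨x, hx⟩ + 1) := c.lt_sizeUpTo_index_succ ⟨x, hx⟩
  rw [blockRev_blocks c ⟨x, hx⟩]
  change _ - x = _
  have e1 : c.sizeUpTo (c.index ⟨x, hx⟩) = A := by
    refine le_antisymm ?_ ?_ <;> by_contra hc
    · exact hAB.2.2.2 _ (not_le.1 hc) (by omega) hA'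
    · exact hno _ (not_le.1 hc) (by omega) hAB.1
  have e2 : c.sizeUpTo (c.index ⟨x, hx⟩ + 1) = B := by
    refine le_antisymm ?_ ?_ <;> by_contra hc
    · exact hno _ (by omega) (not_le.1 hc) hAB.2.1
    · exact hAB.2.2.2 _ (by omega) (not_le.1 hc) hB'
  rw [e1, e2]

end Bridge

/-! ### The index of a parabolic subalgebra as a number of orbits. -/

section Parabolic

attribute [local instance] LieRing.ofAssociativeRing

variable {n : ℕ} (a : Composition n)

theorem finrank_coadjointStabilizer_parabolic (f : Module.Dual ℂ (parabolic a))
    (F : Matrix (Fin n) (Fin n) ℂ) (hf : ∀ x : parabolic a, f x = Matrix.trace (F * x.1)) :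
    Module.finrank ℂ (coadjointStabilizer ℂ f) =
      stabDim (fun i j => a.index i ≤ a.index j) F := by
  let e : parabolic a ≃ₗ[ℂ] incidence fun i j => a.index i ≤ a.index j :=
    { toFun := fun x => ⟨x.1, fun i j hij => x.2 (not_le.1 hij)⟩
      map_add' := fun _ _ => rfl
      map_smul' := fun _ _ => rfl
      invFun := fun x => ⟨x.1, fun i j hij => x.2 i j (not_le.2 hij)⟩
      left_inv := fun _ => rfl
      right_inv := fun _ => rfl }
  have hform (x y : parabolic a) :
      incidenceForm (fun i j => a.index i ≤ a.index j) F (e x) (e y) = f ⁅x, y⁆ := by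
    rw [hf]
    rfl
  have hmap : (coadjointStabilizer ℂ f).map
      (e : parabolic a →ₗ[ℂ] incidence fun i j => a.index i ≤ a.index j) =
      LinearMap.ker (incidenceForm (fun i j => a.index i ≤ a.index j) F) := by
    ext z
    obtain ⟨x, rfl⟩ := e.surjective z
    rw [Submodule.mem_map_equiv, LinearEquiv.symm_apply_apply]
    constructor
    · intro hx
      refine LinearMap.ext fun w => ?_
      obtain ⟨y, rfl⟩ := e.surjective w
      rw [hform, LinearMap.zero_apply]
      exact hx y
    · intro hx y
      rw [← hform]
      exact LinearMap.congr_fun hx (e y)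
  rw [stabDim, ← hmap]
  exact (LinearEquiv.finrank_map_eq e _).symm

/-- Every linear form on the subalgebra extends to all matrices, where it is `tr (G ·)` for some
`G`. -/
theorem lieIndex_parabolic {m : ℕ} (h : HasIndex (fun i j : Fin n => a.index i ≤ a.index j) m) :
    lieIndex ℂ (parabolic a) = m := by
  obtain ⟨⟨F, hF⟩, hmin⟩ := h
  apply le_antisymm
  · refine Nat.sInf_le ⟨(Matrix.traceLinearMap (Fin n) ℂ ℂ ∘ₗ LinearMap.mulLeft ℂ F) ∘ₗ
      (parabolic a).toSubmodule.subtype, ?_⟩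
    rw [← hF]
    exact finrank_coadjointStabilizer_parabolic a _ F fun x => rfl
  · refine le_csInf ⟨_, 0, rfl⟩ ?_
    rintro _ ⟨f, rfl⟩
    obtain ⟨g, hg⟩ := LinearMap.exists_extend (p := (parabolic a).toSubmodule) f
    obtain ⟨G, hG⟩ := exists_forall_eq_trace g
    change m ≤ Module.finrank ℂ (coadjointStabilizer ℂ f)
    rw [finrank_coadjointStabilizer_parabolic a f G fun x => by
      rw [← hG, ← hg]
      rfl]
    exact hmin G

/-- The index of a parabolic subalgebra is the number of orbits of `θ_a ∘ θ_(n)`. -/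
theorem lieIndex_parabolic_eq_orbitCount (hn : 0 < n) : lieIndex ℂ (parabolic a) =
    orbitCount n (seaweedPerm a.blocks (Composition.single n hn).blocks) := by
  have h := hasIndex_seaweed n a.blocks (Composition.single n hn).blocks a.blocks_sum
    (Composition.single n hn).blocks_sum
  refine lieIndex_parabolic a (h.reindex (Equiv.refl _) fun i j => ?_)
  rw [seaweedRel, blockIdx_blocks, blockIdx_blocks, blockIdx_blocks, blockIdx_blocks]
  have h0 (x : Fin n) : (((Composition.single n hn).index x : Fin _) : ℕ) = 0 := by
    have h1 := ((Composition.single n hn).index x).2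
    have h2 := Composition.single_length hn
    omega
  rw [h0, h0]
  exact and_iff_left le_rfl

end Parabolic

/-! ### Components of the meander, and maximal cycles as classes of strips. -/

section Graph

variable {n : ℕ} (hn : 0 < n) (a : Composition n)

/-- The block boundaries of the two compositions defining the meander `Γ(a)`. -/
def meanderBoundary (c : Bool) : ℕ → Prop := compBoundary (cond c a (Composition.single n hn))

/-- The two involutions defining the meander `Γ(a)`. -/
def meanderReversal (c : Bool) : ℕ → ℕ := blockRev (cond c a (Composition.single n hn)).blocks

theorem isReversal_meander (c : Bool) :
    IsReversal n (meanderBoundary hn a c) (meanderReversal hn a c) := isReversal_blocks _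

theorem parabolicMeander_adj {x y : Fin n} : (parabolicMeander hn a).Adj x y ↔
    x ≠ y ∧ ∃ c, (y : ℕ) = meanderReversal hn a c x := by
  rw [parabolicMeander, meander, SimpleGraph.fromRel_adj]
  refine and_congr_right fun _ => ?_
  have hval (b : Composition n) (u v : Fin n) : theta b u = v ↔ (v : ℕ) = blockRev b.blocks u := by
    rw [Fin.ext_iff, val_theta, eq_comm]
  have hinv (b : Composition n) (u v : Fin n) : (v : ℕ) = blockRev b.blocks u ↔
      (u : ℕ) = blockRev b.blocks v := by
    constructor <;> intro h <;> rw [h, blockRev_blockRev]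
  rw [hval, hval, hval, hval, hinv a y x, hinv (Composition.single n hn) y x, or_self]
  constructor
  · rintro (h | h)
    · exact ⟨true, h⟩
    · exact ⟨false, h⟩
  · rintro ⟨c, h⟩
    cases c
    · exact .inr h
    · exact .inl h

theorem reachable_iff_linked {x y : Fin n} : (parabolicMeander hn a).Reachable x y ↔
    Linked (meanderReversal hn a) x y := by
  constructor
  · rw [SimpleGraph.reachable_iff_reflTransGen]
    intro h
    induction h with
    | refl => exact .refl
    | tail _ hyz ih => exact .tail ih ((parabolicMeander_adj hn a).1 hyz).2
  · intro h
    have hrec (z : ℕ) (hz : Linked (meanderReversal hn a) x z) :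
        ∀ hzn : z < n, (parabolicMeander hn a).Reachable x ⟨z, hzn⟩ := by
      induction hz with
      | refl => exact fun _ => .refl _
      | @tail z w hz hw ih =>
        intro hwn
        have hzn : z < n := Linked.lt (isReversal_meander hn a) hz x.2
        by_cases heq : z = w
        · subst heq
          exact ih hzn
        · exact (ih hzn).trans (SimpleGraph.Adj.reachable
            ((parabolicMeander_adj hn a).2 ⟨fun hc => heq (congrArg Fin.val hc), hw⟩))
    exact hrec y h y.2

theorem isCycle_iff (X : (parabolicMeander hn a).ConnectedComponent) :
    IsCycle hn a X ↔ ∀ x ∈ X.supp, ∀ c, meanderReversal hn a c x ≠ x := by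
  refine forall₂_congr fun x _ => ?_
  rw [Bool.forall_bool, and_comm, Ne, Ne, Fin.ext_iff, Fin.ext_iff, val_theta, val_theta]
  rfl

theorem mem_supp_iff_linked {x y : Fin n} :
    y ∈ ((parabolicMeander hn a).connectedComponentMk x).supp ↔
      Linked (meanderReversal hn a) x y := by
  rw [SimpleGraph.ConnectedComponent.mem_supp_iff, SimpleGraph.ConnectedComponent.eq,
    ← reachable_iff_linked]
  exact ⟨fun h => h.symm, fun h => h.symm⟩

/-- Two vertices of a cycle which delimit one of the intervals of its pattern lie in the same
strip. -/
theorem not_badGap_of_isPattern {X : (parabolicMeander hn a).ConnectedComponent}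
    (hX : IsCycle hn a X) {s m : ℕ} {x y : Fin m → Fin n} (hp : IsPattern X.supp s m x y)
    {i : Fin m} {g : ℕ} (h1 : x i < g) (h2 : g ≤ y i) :
    ¬ BadGap n (meanderBoundary hn a) g := by
  classical
  intro hg
  have hgap := hp.gap
  have hone := hp.one_lt
  have hsep (j k : Fin m) (hjk : j < k) : (y j : ℕ) < x k := hp.sep j k hjk
  let A : Finset ℕ := (Finset.univ.filter fun v : Fin n => v ∈ X.supp).map Fin.valEmbedding
  have hmemA (v : ℕ) : v ∈ A ↔ ∃ j, v = x j ∨ v = y j := by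
    simp only [A, Finset.mem_map, Finset.mem_filter, Finset.mem_univ, true_and, hp.mem_iff]
    constructor
    · rintro ⟨v, ⟨j, rfl | rfl⟩, rfl⟩
      · exact ⟨j, .inl rfl⟩
      · exact ⟨j, .inr rfl⟩
    · rintro ⟨j, rfl | rfl⟩
      · exact ⟨x j, ⟨j, .inl rfl⟩, rfl⟩
      · exact ⟨y j, ⟨j, .inr rfl⟩, rfl⟩
  have hAX (v : ℕ) : v ∈ A ↔ ∃ u : Fin n, u ∈ X.supp ∧ (u : ℕ) = v := by
    simp [A]
  -- A cycle has evenly many vertices to the left of a bad gap. To the left of `g` lie the `x j`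
  -- with `j ≤ i` and the `y j` with `j < i`, an odd number.
  have heven := even_card_filter_lt_of_closed (isReversal_meander hn a) (X := A) ?_ ?_ ?_ hg
  · have hfil : A.filter (· < g) = (Finset.Iic i).image (fun j => (x j : ℕ)) ∪
        (Finset.Iio i).image (fun j => (y j : ℕ)) := by
      ext v
      simp only [Finset.mem_filter, hmemA, Finset.mem_union, Finset.mem_image, Finset.mem_Iic,
        Finset.mem_Iio]
      constructor
      · rintro ⟨⟨j, rfl | rfl⟩, hv⟩
        · refine .inl ⟨j, ?_, rfl⟩
          by_contra hc
          have := hsep i j (not_le.1 hc)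
          omega
        · refine .inr ⟨j, ?_, rfl⟩
          rcases lt_trichotomy j i with hc | rfl | hc
          · exact hc
          · omega
          · have h3 := hsep i j hc
            have := hgap j
            omega
      · rintro (⟨j, hj, rfl⟩ | ⟨j, hj, rfl⟩)
        · refine ⟨⟨j, .inl rfl⟩, ?_⟩
          rcases eq_or_lt_of_le hj with rfl | hj
          · exact h1
          · have h3 := hsep j i hj
            have := hgap j
            omega
        · refine ⟨⟨j, .inr rfl⟩, ?_⟩
          have h3 := hsep j i hj
          omega
    have hxinj : Function.Injective fun j => (x j : ℕ) := by
      intro j k hjk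
      simp only at hjk
      rcases lt_trichotomy j k with hc | hc | hc
      · have h3 := hsep j k hc
        have := hgap j
        omega
      · exact hc
      · have h3 := hsep k j hc
        have := hgap k
        omega
    have hyinj : Function.Injective fun j => (y j : ℕ) := by
      intro j k hjk
      simp only at hjk
      rw [hgap, hgap] at hjk
      exact hxinj (Nat.add_right_cancel hjk)
    have hdisj : Disjoint ((Finset.Iic i).image fun j => (x j : ℕ))
        ((Finset.Iio i).image fun j => (y j : ℕ)) := by
      rw [Finset.disjoint_left]
      intro v hv hv'
      obtain ⟨j, -, rfl⟩ := Finset.mem_image.1 hv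
      obtain ⟨k, -, hk⟩ := Finset.mem_image.1 hv'
      have h3 := hgap k
      rcases lt_trichotomy j k with hc | rfl | hc
      · have h4 := hsep j k hc
        have := hgap j
        omega
      · omega
      · have h4 := hsep k j hc
        omega
    rw [hfil, Finset.card_union_of_disjoint hdisj, Finset.card_image_of_injective _ hxinj,
      Finset.card_image_of_injective _ hyinj, Fin.card_Iic, Fin.card_Iio, Nat.even_iff] at heven
    omega
  · intro v hv
    obtain ⟨u, -, rfl⟩ := (hAX v).1 hv
    exact u.2
  · intro c v hv
    obtain ⟨u, hu, rfl⟩ := (hAX v).1 hv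
    refine (hAX _).2 ⟨⟨_, (isReversal_meander hn a c).lt u.2⟩, ?_, rfl⟩
    rw [SimpleGraph.ConnectedComponent.mem_supp_iff] at hu
    rw [← hu, mem_supp_iff_linked]
    exact .single ⟨c, rfl⟩
  · intro c v hv
    obtain ⟨u, hu, rfl⟩ := (hAX v).1 hv
    exact (isCycle_iff hn a X).1 hX u hu c

theorem exists_isPattern {l r : ℕ} (h : IsStrip n (meanderBoundary hn a) l r) (hlr : l + 1 < r)
    (hln : l < n) : ∃ m x y,
      IsPattern ((parabolicMeander hn a).connectedComponentMk ⟨l, hln⟩).supp (r - l) m x y ∧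
        ∃ i, x i = ⟨l, hln⟩ := by
  classical
  have hθ := isReversal_meander hn a
  -- `E` collects the left ends of the linked strips: the right end of a strip of width greater than
  -- 1 is not at a bad gap. Listed in increasing order, they are the `x i`.
  let E : Finset (Fin n) := Finset.univ.filter fun v =>
    Linked (meanderReversal hn a) l v ∧ BadGap n (meanderBoundary hn a) v
  have hE (v : Fin n) : v ∈ E ↔
      Linked (meanderReversal hn a) l v ∧ BadGap n (meanderBoundary hn a) v := by simp [E]
  have hstrip (v : Fin n) (hv : v ∈ E) : IsStrip n (meanderBoundary hn a) v (v + (r - l)) ∧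
      Linked (meanderReversal hn a) l (v + (r - l) - 1) := by
    obtain ⟨hv1, hv2⟩ := (hE v).1 hv
    obtain ⟨l', r', hs, hw, hl', hr', hv'⟩ := h.ends_of_linked hθ hv1
    have hlt := hs.lt
    have hvl : (v : ℕ) = l' := by
      rcases hv' with hv' | hv'
      · exact hv'
      · exact absurd hv2 (hs.good _ (by omega) (by omega))
    rw [hvl, show l' + (r - l) = r' by omega]
    exact ⟨hs, hr'⟩
  have hlE : (⟨l, hln⟩ : Fin n) ∈ E := (hE _).2 ⟨.refl, h.left⟩
  let x : Fin E.card → Fin n := E.orderEmbOfFin rfl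
  have hxE (i) : x i ∈ E := E.orderEmbOfFin_mem rfl i
  have hxlt (i) : (x i : ℕ) + (r - l - 1) < n := by
    have := (hstrip _ (hxE i)).1.le
    omega
  refine ⟨E.card, x, fun i => ⟨x i + (r - l - 1), hxlt i⟩, ⟨by omega,
    Finset.card_pos.2 ⟨_, hlE⟩, fun i => rfl, fun i j hij => ?_, fun v => ?_⟩, ?_⟩
  · have h1 : x i < x j := (E.orderEmbOfFin rfl).strictMono hij
    have h2 := (hstrip _ (hxE i)).1.le_of_badGap ((hE _).1 (hxE j)).2 h1
    rw [Fin.lt_def]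
    change (x i : ℕ) + (r - l - 1) < x j
    omega
  · rw [mem_supp_iff_linked]
    have hrange (w : Fin n) (hw : w ∈ E) : ∃ i, w = x i := by
      have : w ∈ Set.range (E.orderEmbOfFin rfl) := by
        rw [Finset.range_orderEmbOfFin]
        exact hw
      obtain ⟨i, hi⟩ := this
      exact ⟨i, hi.symm⟩
    constructor
    · intro hv
      obtain ⟨l', r', hs, hw, hl', hr', hv'⟩ := h.ends_of_linked hθ hv
      have hlt := hs.lt
      have hle := hs.le
      obtain ⟨i, hi⟩ := hrange ⟨l', by omega⟩ ((hE _).2 ⟨hl', hs.left⟩)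
      refine ⟨i, ?_⟩
      have hxi : l' = (x i : ℕ) := congrArg Fin.val hi
      rcases hv' with hv' | hv'
      · exact .inl (Fin.ext (hv'.trans hxi))
      · refine .inr (Fin.ext ?_)
        change (v : ℕ) = x i + (r - l - 1)
        omega
    · rintro ⟨i, rfl | rfl⟩
      · exact ((hE _).1 (hxE i)).1
      · have := (hstrip _ (hxE i)).2
        rwa [show (x i : ℕ) + (r - l) - 1 = x i + (r - l - 1) by omega] at this
  · have : (⟨l, hln⟩ : Fin n) ∈ Set.range (E.orderEmbOfFin rfl) := by
      rw [Finset.range_orderEmbOfFin]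
      exact hlE
    exact this

/-- The maximal cycles are the components which contain an end of a strip. -/
theorem isMaximalCycle_iff (Y : (parabolicMeander hn a).ConnectedComponent) :
    IsMaximalCycle hn a Y ↔ ∃ v ∈ Y.supp, BadGap n (meanderBoundary hn a) v := by
  have hθ := isReversal_meander hn a
  constructor
  · intro hY
    obtain ⟨v, rfl⟩ := Y.exists_rep
    change IsMaximalCycle hn a ((parabolicMeander hn a).connectedComponentMk v) at hY
    change ∃ v' ∈ ((parabolicMeander hn a).connectedComponentMk v).supp, _
    obtain ⟨l, r, hs, h1, h2⟩ := exists_isStrip hθ v.2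
    have hln : l < n := by omega
    by_cases hlv : Linked (meanderReversal hn a) l v
    · exact ⟨⟨l, hln⟩, (mem_supp_iff_linked hn a).2 (hlv.symm hθ hln), hs.left⟩
    exfalso
    have hvl : l ≠ v := by
      rintro rfl
      exact hlv .refl
    have hvr : (v : ℕ) ≠ r - 1 := by
      intro hc
      have := hs.linked_mirror hθ le_rfl hs.lt
      rw [show l + r - 1 - l = v by omega] at this
      exact hlv this
    -- `v` is strictly between the ends of its strip and not linked to them, so it is inside the
    -- cycle which they form.
    obtain ⟨m, x, y, hp, i, hi⟩ := exists_isPattern hn a hs (by omega) hln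
    refine hY ((parabolicMeander hn a).connectedComponentMk ⟨l, hln⟩) ⟨fun hc => ?_, ?_, r - l, m,
      x, y, hp, by omega, i, v, SimpleGraph.ConnectedComponent.connectedComponentMk_mem, ?_, ?_⟩
    · rw [SimpleGraph.ConnectedComponent.eq, reachable_iff_linked] at hc
      exact hlv (hc.symm hθ v.2)
    · rw [isCycle_iff]
      intro u hu c
      exact hs.apply_ne_of_linked hθ (by omega) ((mem_supp_iff_linked hn a).1 hu) c
    · rw [hi]
      exact h1
    · have := hp.gap i
      rw [hi] at this
      rw [Fin.le_def, this]
      change (v : ℕ) ≤ l + (r - l - 1)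
      omega
  · rintro ⟨v, hvY, hv⟩ X ⟨hne, hX, s, m, x, y, hp, hs2, i, w, hwY, h1, h2⟩
    rw [SimpleGraph.ConnectedComponent.mem_supp_iff] at hvY hwY
    have hvw : Linked (meanderReversal hn a) v w := by
      rw [← reachable_iff_linked, ← SimpleGraph.ConnectedComponent.eq, hvY, hwY]
    obtain ⟨l, r, hs, h3, h4⟩ := exists_isStrip hθ v.2
    obtain rfl : l = v := by
      by_contra hc
      exact hs.good v (by omega) h4 hv
    obtain ⟨l', r', hs', hw', -, -, hend⟩ := hs.ends_of_linked hθ hvw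
    have hlt := hs'.lt
    have hlt' := hs.lt
    have hle := hs'.le
    rw [Fin.le_def] at h1 h2
    -- The interval from `x i` to `y i` stays within one strip. As `w` is an end of that strip, it
    -- equals `x i` or `y i`, and so belongs to `X`.
    have hgood (g : ℕ) (h5 : x i < g) (h6 : g ≤ y i) :=
      not_badGap_of_isPattern hn a hX hp h5 h6
    have hxl : l' ≤ x i := by
      by_contra hc
      exact hgood l' (by omega) (by omega) hs'.left
    have hyr : (y i : ℕ) < r' := by
      by_contra hc
      exact hgood r' (by omega) (by omega) hs'.right
    have hmem : w ∈ X.supp := by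
      rw [hp.mem_iff]
      refine ⟨i, ?_⟩
      rcases hend with hend | hend
      · exact .inl (Fin.ext (by omega))
      · exact .inr (Fin.ext (by omega))
    rw [SimpleGraph.ConnectedComponent.mem_supp_iff] at hmem
    exact hne (hwY.symm.trans hmem)

end Graph

end Meander

/-! ### The bound and the criterion. -/

theorem mainTheorem12 (n : ℕ) (hn : 0 < n) (a : Composition n) :
    Meander.numMaximalCycles hn a ≤ (a.length + 1) / 2 ∧
    (Meander.numMaximalCycles hn a = 1 ↔
      Meander.lieIndex ℂ (Meander.parabolic a) = Finset.univ.gcd a.blocksFun) := by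
  classical
  open Meander in
  have hθ := isReversal_meander hn a
  set G := parabolicMeander hn a with hG
  set M : Set G.ConnectedComponent := {Y | IsMaximalCycle hn a Y} with hM
  have hnum : numMaximalCycles hn a = M.ncard := rfl
  have hMmem {v : ℕ} (hv : v < n) (hbad : BadGap n (meanderBoundary hn a) v) :
      G.connectedComponentMk ⟨v, hv⟩ ∈ M :=
    (isMaximalCycle_iff hn a _).2
      ⟨⟨v, hv⟩, SimpleGraph.ConnectedComponent.connectedComponentMk_mem, hbad⟩
  have hMstrip {Y : G.ConnectedComponent} (hY : Y ∈ M) : ∃ l r, ∃ hl : l < n,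
      IsStrip n (meanderBoundary hn a) l r ∧ G.connectedComponentMk ⟨l, hl⟩ = Y := by
    obtain ⟨v, hv, hbad⟩ := (isMaximalCycle_iff hn a Y).1 hY
    obtain ⟨l, r, hs, h1, h2⟩ := exists_isStrip hθ v.2
    obtain rfl : l = v := by
      by_contra hc
      exact hs.good v (by omega) h2 hbad
    exact ⟨v, r, v.2, hs, hv⟩
  have hMfin : M.Finite := Set.toFinite M
  have h0 : BadGap n (meanderBoundary hn a) 0 := (hθ true).badGap_zero hn
  obtain ⟨l₀, s, hs₀, hl₀, hs0⟩ := exists_isStrip hθ hn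
  obtain rfl : l₀ = 0 := by omega
  have hcompeq {u v : ℕ} (hu : u < n) (hv : v < n) :
      G.connectedComponentMk ⟨u, hu⟩ = G.connectedComponentMk ⟨v, hv⟩ ↔
        Linked (meanderReversal hn a) u v := by
    rw [SimpleGraph.ConnectedComponent.eq, hG, reachable_iff_linked]
  refine ⟨?_, ?_⟩
  · let comp : ℕ → G.ConnectedComponent := fun x =>
      if hx : x < n then G.connectedComponentMk ⟨x, hx⟩ else G.connectedComponentMk ⟨0, hn⟩
    have hbound := two_mul_card_le hθ comp ?_ hMfin.toFinset ?_
      (fun c => (cond c a (Composition.single n hn)).length)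
      (fun c => blockIdx (cond c a (Composition.single n hn)).blocks) ?_ ?_
    · rw [← Set.ncard_eq_toFinset_card M hMfin, ← hnum] at hbound
      simp only [cond_true, cond_false, Composition.single_length] at hbound
      omega
    · intro x hx y hy
      simp only [comp, dif_pos hx, dif_pos hy]
      exact hcompeq hx hy
    · intro Y hY
      obtain ⟨l, r, hl, hs, hlY⟩ := hMstrip (hMfin.mem_toFinset.1 hY)
      refine ⟨l, r, hs, ?_⟩
      simp only [comp, dif_pos hl]
      exact hlY
    · intro c x hx
      have := blockIdx_blocks (cond c a (Composition.single n hn)) ⟨x, hx⟩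
      simp only at this ⊢
      rw [this]
      exact Fin.is_lt _
    · intro c x hx y hy hxy
      set b := cond c a (Composition.single n hn) with hb
      have hx' := blockIdx_blocks b ⟨x, hx⟩
      have hy' := blockIdx_blocks b ⟨y, hy⟩
      simp only at hx' hy' hxy
      have hidx : ((b.index ⟨y, hy⟩ : Fin _) : ℕ) = b.index ⟨x, hx⟩ := by
        rw [← hx', ← hy', hxy]
      refine ⟨_, _, isBlock_index b ⟨x, hx⟩, b.sizeUpTo_le _, b.sizeUpTo_index_le ⟨x, hx⟩,
        b.lt_sizeUpTo_index_succ ⟨x, hx⟩, ?_, ?_⟩ <;> rw [← hidx]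
      · exact b.sizeUpTo_index_le ⟨y, hy⟩
      · exact b.lt_sizeUpTo_index_succ ⟨y, hy⟩
  · rw [hnum, lieIndex_parabolic_eq_orbitCount a hn]
    change _ ↔ orbitCount n (fun x => meanderReversal hn a true (meanderReversal hn a false x)) = _
    set d := Finset.univ.gcd a.blocksFun with hd
    have hda (x : ℕ) (hx : x ∈ a.blocks) : d ∣ x := by
      rw [← a.ofFn_blocksFun, List.mem_ofFn] at hx
      obtain ⟨i, rfl⟩ := hx
      exact Finset.gcd_dvd (Finset.mem_univ i)
    have hdn : d ∣ n := by
      have := List.dvd_sum hda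
      rwa [a.blocks_sum] at this
    have hdpos : 0 < d := Nat.pos_of_dvd_of_pos hdn hn
    have hdD (c : Bool) (g : ℕ) (hg : meanderBoundary hn a c g) : d ∣ g := by
      obtain ⟨k, rfl⟩ := hg
      refine List.dvd_sum fun x hx => ?_
      have hx' := List.mem_of_mem_take hx
      cases c with
      | true => exact hda x hx'
      | false =>
        rw [cond_false, Composition.single_blocks, List.mem_singleton] at hx'
        rwa [hx']
    -- All boundaries, hence all bad gaps, are multiples of `d`.
    have hwidth {l r : ℕ} (hs : IsStrip n (meanderBoundary hn a) l r) : d ≤ r - l :=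
      Nat.le_of_dvd (by have := hs.lt; omega)
        (Nat.dvd_sub (BadGap.dvd hdD hs.right) (BadGap.dvd hdD hs.left))
    constructor
    · intro hone
      obtain ⟨Y, hY⟩ := Set.ncard_eq_one.1 hone
      have hall (l r : ℕ) (hs : IsStrip n (meanderBoundary hn a) l r) :
          Linked (meanderReversal hn a) 0 l := by
        have hl := hs.lt.trans_le hs.le
        have h1 := hMmem hn h0
        have h2 := hMmem hl hs.left
        rw [hY, Set.mem_singleton_iff] at h1 h2
        exact (hcompeq hn hl).1 (h1.trans h2.symm)
      rw [orbitCount_eq_of_linked hθ hs₀ hall]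
      have hlen (l r : ℕ) (hs : IsStrip n (meanderBoundary hn a) l r) : r = l + s := by
        obtain ⟨l', r', hs', hw, -, -, hend⟩ := hs₀.ends_of_linked hθ (hall l r hs)
        have hlt := hs.lt
        have hlt' := hs'.lt
        obtain ⟨h1, h2⟩ := hs.unique hs' (x := l) le_rfl hs.lt (by omega) (by omega)
        omega
      -- Linked strips have equal widths, so strips of width `s` tile the vertices and `s` divides
      -- every boundary, hence every part.
      have hdvd (k : ℕ) : s ∣ a.sizeUpTo k :=
        BadGap.dvd_of_forall_isStrip hθ hlen (.of_boundary true _ ⟨k, rfl⟩ (a.sizeUpTo_le k))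
          (a.sizeUpTo_le k)
      refine Nat.dvd_antisymm (Finset.dvd_gcd fun i _ => ?_) (BadGap.dvd hdD hs₀.right)
      have := a.sizeUpTo_succ' i
      exact (Nat.dvd_add_right (hdvd i)).1 (this ▸ hdvd _)
    · intro hidx
      refine Set.ncard_eq_one.2 ⟨G.connectedComponentMk ⟨0, hn⟩, Set.eq_singleton_iff_unique_mem.2
        ⟨hMmem hn h0, fun Y hY => ?_⟩⟩
      obtain ⟨l, r, hl, hs, rfl⟩ := hMstrip hY
      by_contra hne
      -- A second class would make the index at least `2 * d`, more than `d`.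
      have hle := le_orbitCount_of_not_linked hθ hs₀ hs fun hc =>
        hne ((hcompeq hn hl).2 hc).symm
      have h1 := hwidth hs₀
      have h2 := hwidth hs
      omega
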